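/- Let $K$ be a commutative ring with $1$, and let $R=\bigoplus_{i\ge 0}R_i$ be an associative graded $K$-algebra with $1$ and with a $K$-linear involution $a\mapsto\bar a$ (an additive anti-automorphism of order at most two). Let $(R,\Lambda)$ be a form ring: $\lambda\in R$ is central with $\lambda\bar\lambda=1$, and $\Lambda$ is an additive subgroup of $R$ with $\{a-\lambda\bar a : a\in R\}\subseteq\Lambda\subseteq\{a\in R : a=-\lambda\bar a\}$ and $\bar x\Lambda x\subseteq\Lambda$ for all $x\in R$. Assume that the form ring is graded, that is, $\overline{R_i}\subseteq R_i$ for all $i$, $\lambda\in R_0$, and $\Lambda$ contains the homogeneous components of its elements; and that $R$ is module finite, that is, finitely generated as a module over its centre. For $M=(m_{ij})$ write $M^*=(\bar m_{ji})$, and let $e_{kl}$ be the matrix units. For $n\ge 1$ let $\mathrm{GQ}(2n,R,\Lambda)$ be the group of all $\sigma=\begin{pmatrix}a&b\\c&d\end{pmatrix}\in\mathrm{GL}_{2n}(R)$ (with $n\times n$ blocks) such that $\sigma^*\psi\sigma=\psi$ for $\psi=\begin{pmatrix}0&I_n\\ \lambda I_n&0\end{pmatrix}$ and the diagonal entries of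 $a^*c$ and $b^*d$ lie in $\Lambda$ (the last condition is automatic if $\Lambda=\{a : a=-\lambda\bar a\}$). Let $\mathrm{EQ}(2n,R,\Lambda)$ be its subgroup generated, for $1\le i\ne j\le n$ and $a\in R$, by $$I+a\,e_{ij}-\bar a\,e_{n+j,n+i},\qquad I+a\,e_{i,n+j}-\bar\lambda\bar a\,e_{j,n+i},\qquad I+a\,e_{n+i,j}-\lambda\bar a\,e_{n+j,i},$$ and, for $1\le i\le n$, by $I+a\,e_{i,n+i}$ with $\bar a\in\Lambda$ and $I+a\,e_{n+i,i}$ with $a\in\Lambda$. For $\alpha\in\mathrm{GL}_{2n}(R)$ let $\alpha^+(0)$ be the matrix of the degree-$0$ components of the entries of $\alpha$. For a maximal ideal $\mathfrak m$ of $K$ and $S=K\setminus\mathfrak m$, let $R_{\mathfrak m}=S^{-1}R$ with the induced involution, let $\Lambda_{\mathfrak m}=\{a/s^2 : a\in\Lambda,\ s\in S\}$ be the form parameter of $R_{\mathfrak m}$ generated by the image of $\Lambda$, and let $\alpha_{\mathfrak m}$ be the image of $\alpha$ over $R_{\mathfrak m}$. Suppose that $R_0$ is finitely generated as a $K$-module,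 and let $n\ge 3$. Then the following are equivalent: (1) $\mathrm{EQ}(2n,R,\Lambda)$ is a normal subgroup of $\mathrm{GQ}(2n,R,\Lambda)$. (2) If $\alpha\in\mathrm{GQ}(2n,R,\Lambda)$ satisfies $\alpha^+(0)=I_{2n}$ and $\alpha_{\mathfrak m}\in\mathrm{EQ}(2n,R_{\mathfrak m},\Lambda_{\mathfrak m})$ for every maximal ideal $\mathfrak m$ of $K$, then $\alpha\in\mathrm{EQ}(2n,R,\Lambda)$. -/

import Mathlib

open Matrix

/-- The data `(lam, Λ)` making a ring `R` with involution `star` into a form ring: a central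
element `lam` with `lam * star lam = 1`, and a `lam`-form parameter `Λ`, that is, an additive
subgroup with `Λ_min ≤ Λ ≤ Λ_max` stable under `a ↦ star x * a * x`. -/
structure FormStructure (R : Type*) [Ring R] [StarRing R] where
  lam : R
  lam_mem_center : lam ∈ Subring.center R
  lam_mul_star : lam * star lam = 1
  Λ : AddSubgroup R
  min_le : ∀ a : R, a - lam * star a ∈ Λ
  le_max : ∀ a ∈ Λ, a = -(lam * star a)
  conj_mem : ∀ a ∈ Λ, ∀ x : R, star x * a * x ∈ Λ

namespace FormStructure

section Groups

variable {R : Type*} [Ring R] [StarRing R] (F : FormStructure R) (n : ℕ)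

/-- The matrix `ψ = (0, I; lam I, 0)`. -/
def psi : Matrix (Fin n ⊕ Fin n) (Fin n ⊕ Fin n) R :=
  fromBlocks 0 1 (F.lam • (1 : Matrix (Fin n) (Fin n) R)) 0

/-- `Λ`-Hermitian matrices: `γ = -lam γ*`, with diagonal entries in `Λ`. -/
def IsHerm {m : Type*} (γ : Matrix m m R) : Prop :=
  γ = -(F.lam • γᴴ) ∧ ∀ i, γ i i ∈ F.Λ

/-- `σ = (a, b; c, d)` is a quadratic matrix: `σ* ψ σ = ψ`, and the diagonal entries of
`a* c` and of `b* d` lie in `Λ`. (If `Λ = Λ_max`, the second condition is automatic.) -/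
def IsQuadratic (σ : Matrix (Fin n ⊕ Fin n) (Fin n ⊕ Fin n) R) : Prop :=
  σᴴ * F.psi n * σ = F.psi n ∧
    (∀ i, (σ.toBlocks₁₁ᴴ * σ.toBlocks₂₁) i i ∈ F.Λ) ∧
    (∀ i, (σ.toBlocks₁₂ᴴ * σ.toBlocks₂₂) i i ∈ F.Λ)

variable {F n}

theorem lam_comm (x : R) : F.lam * x = x * F.lam :=
  (Subring.mem_center_iff.1 F.lam_mem_center x).symm

theorem sum_mem_of_skew {m : Type*} [DecidableEq m] (s : Finset m) (f : m → m → R)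
    (hd : ∀ i, f i i ∈ F.Λ) (hf : ∀ i j, f i j = -(F.lam * star (f j i))) :
    ∑ i ∈ s, ∑ j ∈ s, f i j ∈ F.Λ := by
  induction s using Finset.induction_on with
  | empty => simp
  | insert a s ha ih =>
    rw [Finset.sum_insert ha, Finset.sum_insert ha]
    have h1 : ∑ i ∈ s, ∑ j ∈ insert a s, f i j
        = ∑ i ∈ s, f i a + ∑ i ∈ s, ∑ j ∈ s, f i j := by
      rw [← Finset.sum_add_distrib]
      exact Finset.sum_congr rfl fun i _ => Finset.sum_insert ha
    have h2 : ∑ i ∈ s, f i a = -(F.lam * star (∑ j ∈ s, f a j)) := by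
      rw [star_sum, Finset.mul_sum, ← Finset.sum_neg_distrib]
      exact Finset.sum_congr rfl fun i _ => hf i a
    have h3 := F.Λ.add_mem (F.Λ.add_mem (hd a) (F.min_le (∑ j ∈ s, f a j))) ih
    rw [h1, h2]
    convert h3 using 1
    abel

theorem smul_mul_right {l m k : Type*} [Fintype m] (A : Matrix l m R) (B : Matrix m k R) :
    A * (F.lam • B) = F.lam • (A * B) := by
  ext i j
  simp only [Matrix.mul_apply, Matrix.smul_apply, smul_eq_mul, Finset.mul_sum]
  refine Finset.sum_congr rfl fun x _ => ?_
  rw [← mul_assoc, ← lam_comm, mul_assoc]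

theorem IsHerm.conj {m : Type*} [Fintype m] [DecidableEq m] {γ : Matrix m m R}
    (h : F.IsHerm γ) (τ : Matrix m m R) : F.IsHerm (τᴴ * γ * τ) := by
  refine ⟨?_, fun k => ?_⟩
  · conv_lhs => rw [h.1]
    simp only [conjTranspose_mul, conjTranspose_conjTranspose, Matrix.mul_neg, Matrix.neg_mul,
      smul_mul_right, Matrix.smul_mul, Matrix.mul_assoc]
  · have : (τᴴ * γ * τ) k k = ∑ i, ∑ j, star (τ i k) * γ i j * τ j k := by
      simp only [Matrix.mul_apply, conjTranspose_apply, Finset.sum_mul]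
      exact Finset.sum_comm
    rw [this]
    refine sum_mem_of_skew _ _ (fun i => F.conj_mem _ (h.2 i) _) fun i j => ?_
    have h1 : γ i j = -(F.lam * star (γ j i)) := by
      conv_lhs => rw [h.1]
      simp
    rw [h1]
    simp only [star_mul, star_star, mul_neg, neg_mul]
    rw [← mul_assoc, ← lam_comm]
    simp only [mul_assoc]

theorem IsHerm.add {m : Type*} {γ δ : Matrix m m R} (h : F.IsHerm γ) (h' : F.IsHerm δ) :
    F.IsHerm (γ + δ) := by
  refine ⟨?_, fun i => F.Λ.add_mem (h.2 i) (h'.2 i)⟩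
  conv_lhs => rw [h.1, h'.1]
  rw [conjTranspose_add, smul_add, neg_add]

theorem IsHerm.neg {m : Type*} {γ : Matrix m m R} (h : F.IsHerm γ) : F.IsHerm (-γ) := by
  refine ⟨?_, fun i => F.Λ.neg_mem (h.2 i)⟩
  conv_lhs => rw [h.1]
  rw [conjTranspose_neg, smul_neg]

theorem isQuadratic_iff (σ : Matrix (Fin n ⊕ Fin n) (Fin n ⊕ Fin n) R) :
    F.IsQuadratic n σ ↔
      F.IsHerm (σᴴ * fromBlocks 0 1 0 0 * σ - fromBlocks 0 1 0 0) := by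
  set φ : Matrix (Fin n ⊕ Fin n) (Fin n ⊕ Fin n) R := fromBlocks 0 1 0 0 with hφ
  have hψ : F.psi n = φ + F.lam • φᴴ := by
    simp [psi, hφ, fromBlocks_conjTranspose, fromBlocks_smul, fromBlocks_add]
  have hb : σᴴ * φ * σ = fromBlocks (σ.toBlocks₁₁ᴴ * σ.toBlocks₂₁) (σ.toBlocks₁₁ᴴ * σ.toBlocks₂₂)
      (σ.toBlocks₁₂ᴴ * σ.toBlocks₂₁) (σ.toBlocks₁₂ᴴ * σ.toBlocks₂₂) := by
    conv_lhs => rw [← fromBlocks_toBlocks σ]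
    simp [hφ, fromBlocks_conjTranspose, fromBlocks_multiply]
  have h1 : σᴴ * F.psi n * σ = F.psi n ↔
      σᴴ * φ * σ - φ = -(F.lam • (σᴴ * φ * σ - φ)ᴴ) := by
    rw [hψ, ← sub_eq_zero, eq_neg_iff_add_eq_zero]
    have : σᴴ * (φ + F.lam • φᴴ) * σ - (φ + F.lam • φᴴ)
        = σᴴ * φ * σ - φ + F.lam • (σᴴ * φ * σ - φ)ᴴ := by
      simp only [conjTranspose_sub, conjTranspose_mul, conjTranspose_conjTranspose, Matrix.mul_add,
        Matrix.add_mul, smul_mul_right, Matrix.smul_mul, smul_sub, Matrix.mul_assoc]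
      abel
    rw [this]
  unfold IsQuadratic IsHerm
  rw [h1, and_congr_right_iff]
  intro _
  rw [Sum.forall]
  rw [hφ] at hb
  simp [hb, hφ]

variable (F n)

/-- The general quadratic group `GQ(2n, R, Λ)`. -/
def GQ : Subgroup (Matrix (Fin n ⊕ Fin n) (Fin n ⊕ Fin n) R)ˣ where
  carrier := {σ | F.IsQuadratic n σ.val}
  one_mem' := by
    simp only [Set.mem_ofPred_eq, isQuadratic_iff]
    constructor <;> simp
  mul_mem' := by
    intro σ τ hσ hτ
    simp only [Set.mem_ofPred_eq, isQuadratic_iff] at hσ hτ ⊢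
    have := (hσ.conj τ.val).add hτ
    convert this using 1
    simp only [Units.val_mul, conjTranspose_mul, Matrix.mul_sub, Matrix.sub_mul, Matrix.mul_assoc]
    abel
  inv_mem' := by
    intro σ hσ
    simp only [Set.mem_ofPred_eq, isQuadratic_iff] at hσ ⊢
    have := (hσ.conj (σ⁻¹).val).neg
    convert this using 1
    have h1 : σ.val * (σ⁻¹).val = 1 := σ.mul_inv
    have h2 : ((σ⁻¹).val)ᴴ * (σ.val)ᴴ = 1 := by
      rw [← conjTranspose_mul, h1, conjTranspose_one]
    have h3 (φ : Matrix (Fin n ⊕ Fin n) (Fin n ⊕ Fin n) R) :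
        ((σ⁻¹).val)ᴴ * ((σ.val)ᴴ * φ * σ.val) * (σ⁻¹).val = φ := by
      calc _ = (((σ⁻¹).val)ᴴ * (σ.val)ᴴ) * φ * (σ.val * (σ⁻¹).val) := by
            simp only [Matrix.mul_assoc]
        _ = φ := by rw [h1, h2]; simp
    rw [Matrix.mul_sub, Matrix.sub_mul, h3]
    abel

/-- The elementary quadratic matrices; `inl i` is the index `i` and `inr i` is `n + i`. -/
inductive IsElementary : Matrix (Fin n ⊕ Fin n) (Fin n ⊕ Fin n) R → Prop
  | qe (i j : Fin n) (a : R) (h : i ≠ j) :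
      IsElementary (1 + single (.inl i) (.inl j) a - single (.inr j) (.inr i) (star a))
  | qr (i j : Fin n) (a : R) (h : i ≠ j) :
      IsElementary (1 + single (.inl i) (.inr j) a
        - single (.inl j) (.inr i) (star F.lam * star a))
  | qrDiag (i : Fin n) (a : R) (h : star a ∈ F.Λ) :
      IsElementary (1 + single (.inl i) (.inr i) a)
  | ql (i j : Fin n) (a : R) (h : i ≠ j) :
      IsElementary (1 + single (.inr i) (.inl j) a
        - single (.inr j) (.inl i) (F.lam * star a))
  | qlDiag (i : Fin n) (a : R) (h : a ∈ F.Λ) :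
      IsElementary (1 + single (.inr i) (.inl i) a)

/-- The elementary quadratic group `EQ(2n, R, Λ)`. -/
def EQ : Subgroup (Matrix (Fin n ⊕ Fin n) (Fin n ⊕ Fin n) R)ˣ :=
  Subgroup.closure {σ | F.IsElementary n σ.val}

end Groups

section Graded

variable {K R : Type*} [CommRing K] [Ring R] [StarRing R] [Algebra K R]

/-- A form structure compatible with a grading: the involution preserves degrees, `lam` has
degree `0`, and `Λ` contains the homogeneous components of its elements. -/
structure IsGraded (F : FormStructure R) (𝒜 : ℕ → Submodule K R) [GradedAlgebra 𝒜] : Prop where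
  star_mem : ∀ i, ∀ a ∈ 𝒜 i, star a ∈ 𝒜 i
  lam_mem : F.lam ∈ 𝒜 0
  component_mem : ∀ a ∈ F.Λ, ∀ i, GradedRing.proj 𝒜 i a ∈ F.Λ

end Graded

section Localization

variable {K R : Type*} [CommRing K] [StarRing K] [TrivialStar K] [Ring R] [StarRing R]
  [Algebra K R] [StarModule K R] (S : Submonoid K)

theorem star_smul_trivial (k : K) (a : R) : star (k • a) = k • star a := by
  rw [star_smul, star_trivial]

/-- The involution of `S⁻¹R`, given by `a / s ↦ (star a) / s`. -/
noncomputable instance localizedStarRing : StarRing (LocalizedModule S R) where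
  star x := LocalizedModule.liftOn x (fun p => LocalizedModule.mk (star p.1) p.2) (by
    rintro ⟨a, s⟩ ⟨b, t⟩ ⟨u, hu⟩
    refine LocalizedModule.mk_eq.2 ⟨u, ?_⟩
    have h := congrArg star hu
    simp only [Submonoid.smul_def, star_smul_trivial] at h ⊢
    exact h)
  star_involutive x := by
    induction x using LocalizedModule.induction_on with
    | _ a s => simp [LocalizedModule.liftOn_mk]
  star_mul x y := by
    induction x, y using LocalizedModule.induction_on₂ with
    | _ a b s t => simp [LocalizedModule.liftOn_mk, LocalizedModule.mk_mul_mk, mul_comm]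
  star_add x y := by
    induction x, y using LocalizedModule.induction_on₂ with
    | _ a b s t =>
      simp [LocalizedModule.liftOn_mk, LocalizedModule.mk_add_mk, Submonoid.smul_def,
        star_smul]

theorem star_mk (a : R) (s : S) :
    star (LocalizedModule.mk a s) = LocalizedModule.mk (star a) s := rfl

theorem sq_smul_mem (F : FormStructure R) (k : K) {a : R} (ha : a ∈ F.Λ) :
    (k * k) • a ∈ F.Λ := by
  have h := F.conj_mem a ha (algebraMap K R k)
  have h2 : star (algebraMap K R k) = algebraMap K R k := by
    rw [Algebra.algebraMap_eq_smul_one, star_smul_trivial, star_one]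
  rw [h2, mul_assoc, ← Algebra.commutes, ← mul_assoc, ← map_mul, ← Algebra.smul_def] at h
  exact h

/-- The localized form structure. Its form parameter `S⁻¹Λ` consists of the fractions
`a / s²` with `a ∈ Λ` and `s ∈ S`; it is the form parameter generated by the image of `Λ`
(and if `Λ` is a `K`-submodule, it is the set of all `a / s`). -/
noncomputable def localize (F : FormStructure R) : FormStructure (LocalizedModule S R) where
  lam := LocalizedModule.mk F.lam 1
  lam_mem_center := by
    rw [Subring.mem_center_iff]
    intro x
    induction x using LocalizedModule.induction_on with
    | _ a s => rw [LocalizedModule.mk_mul_mk, LocalizedModule.mk_mul_mk, lam_comm, mul_comm s 1]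
  lam_mul_star := by
    rw [star_mk, LocalizedModule.mk_mul_mk, F.lam_mul_star, mul_one]
    exact OreLocalization.one_def.symm
  Λ :=
    { carrier := {x | ∃ a ∈ F.Λ, ∃ s : S, x = LocalizedModule.mk a (s * s)}
      zero_mem' := ⟨0, F.Λ.zero_mem, 1, by simp⟩
      neg_mem' := by
        rintro _ ⟨a, ha, s, rfl⟩
        exact ⟨-a, F.Λ.neg_mem ha, s, by rw [LocalizedModule.mk_neg]⟩
      add_mem' := by
        rintro _ _ ⟨a, ha, s, rfl⟩ ⟨b, hb, t, rfl⟩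
        refine ⟨((t : K) * t) • a + ((s : K) * s) • b,
          F.Λ.add_mem (F.sq_smul_mem _ ha) (F.sq_smul_mem _ hb), s * t, ?_⟩
        rw [LocalizedModule.mk_add_mk, mul_mul_mul_comm]
        rfl }
  min_le x := by
    induction x using LocalizedModule.induction_on with
    | _ a s =>
      refine ⟨(s : K) • a - F.lam * star ((s : K) • a), F.min_le _, s, ?_⟩
      rw [star_mk, LocalizedModule.mk_mul_mk, one_mul, sub_eq_add_neg, ← LocalizedModule.mk_neg,
        LocalizedModule.mk_add_mk, star_smul_trivial, mul_smul_comm, sub_eq_add_neg, smul_neg]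
      rfl
  le_max := by
    rintro _ ⟨a, ha, s, rfl⟩
    rw [star_mk, LocalizedModule.mk_mul_mk, one_mul, ← LocalizedModule.mk_neg, ← F.le_max a ha]
  conj_mem := by
    rintro _ ⟨a, ha, s, rfl⟩ x
    induction x using LocalizedModule.induction_on with
    | _ b t =>
      refine ⟨star b * a * b, F.conj_mem a ha b, s * t, ?_⟩
      rw [star_mk, LocalizedModule.mk_mul_mk, LocalizedModule.mk_mul_mk]
      congr 1
      rw [mul_mul_mul_comm, mul_comm t (s * s), mul_assoc, mul_assoc, mul_left_comm s t t]

end Localization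

end FormStructure

/-- The image of an invertible matrix over `R` in the invertible matrices over `S⁻¹R`. -/
noncomputable def localizeMatrix {K R : Type*} [CommRing K] [Ring R] [Algebra K R]
    (S : Submonoid K) (n : ℕ) :
    (Matrix (Fin n ⊕ Fin n) (Fin n ⊕ Fin n) R)ˣ →*
      (Matrix (Fin n ⊕ Fin n) (Fin n ⊕ Fin n) (LocalizedModule S R))ˣ :=
  Units.map (LocalizedModule.numeratorRingHom (S := S) (A := R)).mapMatrix.toMonoidHom

/-! Both statements are true, so no implication between them is needed. Each is proved by
localization and patching, and both rest on the dilation principle `exists_scale_mem_elemMonoid`: if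
γ over A[X] satisfies γ(0) = 1 and becomes elementary over S⁻¹A[X], then γ(q²X) is elementary over
A[X] for some q in S.

Dilation works because rescaling the variable makes the nonconstant part of every parameter
divisible by as many denominators as desired. What remains is conjugation by the constant parts,
which have denominators. By `short_conj` and `long_conj` such a conjugation sends root elements with
sufficiently divisible parameters to products of root elements with divisible parameters. The only
obstruction is a pair of opposite roots. It is removed by writing one of the two as a product of
root elements of other roots, through a third index; this is where n ≥ 3 enters.

Multiplication by k in K need not preserve Λ, but multiplication by k² does. Hence all scalings are
by squares, and patching takes place in the subring of K generated by squares, over which K is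
integral (`eq_top_of_forall_isMaximal`).

Statement (2) is `mem_elemMonoid_of_forall_isMaximal`. The grading gives R → R[X], a ↦ ∑ aᵢXⁱ, so α
becomes a family α(X) with α(1) = α and α(0) = 1. The scalars k such that α(c + kd)α(c)⁻¹ is
elementary for all c, d form an ideal, dilation puts the square of a local denominator into it for
each maximal ideal, and so it contains 1.

Statement (1) is `IsQuadratic.conj_mem_elemMonoid`. All entries in question lie in a star subalgebra
A that is finite over the ring of symmetric central elements, which then serves as base ring. For a
root element T with parameter aX, the conjugate σTσ⁻¹ is elementary at every maximal ideal: there A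
is finite over a local ring, stable rank one of its semisimple quotient lets the relevant column of
σ be moved to a basis vector, and afterwards the conjugate lies in the unipotent radical of the
stabilizer of an isotropic line, hence is elementary. Dilation and patching then give the global
statement. -/

set_option linter.unusedSimpArgs false
set_option linter.unusedSectionVars false

namespace FormStructure

/-! ### Root elements and their commutator relations -/

section Roots

variable {R : Type*} [Ring R] [StarRing R] (F : FormStructure R) {n : ℕ}

theorem star_lam_mul : star F.lam * F.lam = 1 := by
  rw [← lam_comm (F := F), F.lam_mul_star]

theorem star_lam_comm (x : R) : star F.lam * x = x * star F.lam := by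
  have h := congrArg star (F.lam_comm (star x))
  simpa using h.symm

/-- The central unit attached to an index: `1` on the first half, `lam` on the second. -/
def kap : Fin n ⊕ Fin n → R := Sum.elim (fun _ => 1) (fun _ => F.lam)

@[simp] theorem kap_inl (i : Fin n) : F.kap (.inl i) = 1 := rfl
@[simp] theorem kap_inr (i : Fin n) : F.kap (.inr i : Fin n ⊕ Fin n) = F.lam := rfl

theorem kap_comm (i : Fin n ⊕ Fin n) (x : R) : F.kap i * x = x * F.kap i := by
  rcases i with i | i <;> simp [lam_comm]

theorem star_kap_comm (i : Fin n ⊕ Fin n) (x : R) : star (F.kap i) * x = x * star (F.kap i) := by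
  rcases i with i | i <;> simp [star_lam_comm]

theorem kap_mul_star (i : Fin n ⊕ Fin n) : F.kap i * star (F.kap i) = 1 := by
  rcases i with i | i <;> simp [F.lam_mul_star]

theorem star_kap_mul (i : Fin n ⊕ Fin n) : star (F.kap i) * F.kap i = 1 := by
  rcases i with i | i <;> simp [F.star_lam_mul]

theorem kap_mul_swap (i : Fin n ⊕ Fin n) : F.kap i * F.kap i.swap = F.lam := by
  rcases i with i | i <;> simp

/-- The involution occurring in the short root elements. -/
def bar (i j : Fin n ⊕ Fin n) (a : R) : R := F.kap i * star (F.kap j) * star a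

theorem bar_add (i j : Fin n ⊕ Fin n) (a b : R) : F.bar i j (a + b) = F.bar i j a + F.bar i j b := by
  simp [bar, mul_add]

@[simp] theorem bar_zero (i j : Fin n ⊕ Fin n) : F.bar i j 0 = 0 := by simp [bar]

@[simp] theorem bar_neg (i j : Fin n ⊕ Fin n) (a : R) : F.bar i j (-a) = -F.bar i j a := by
  simp [bar]

/-- The involution reverses products, and the central units contributed by the intermediate index
`j` cancel. Thus adjoints compose along a path `i`, `j`, `h`, which is what makes the commutator
formulas close up. -/
theorem bar_mul (i j h : Fin n ⊕ Fin n) (a b : R) :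
    F.bar i h (a * b) = F.bar j h b * F.bar i j a := by
  simp only [bar, star_mul]
  generalize star a = a', star b = b'
  have hi := F.kap_comm i
  have hh := F.star_kap_comm h
  have hj := F.star_kap_comm j
  have hk := F.kap_mul_star j
  generalize F.kap i = ki at *
  generalize star (F.kap h) = kh at *
  generalize F.kap j = kj at *
  generalize star kj = kj' at *
  calc ki * kh * (b' * a') = ki * (kh * (b' * a')) := by rw [mul_assoc]
    _ = kj * kj' * (kh * (b' * a') * ki) := by rw [hk, one_mul, hi]
    _ = kj * (kh * b' * (a' * ki) * kj') := by rw [mul_assoc, hj]; simp only [mul_assoc]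
    _ = _ := by rw [← hi, mul_assoc (kh * b'), mul_assoc ki a' kj', ← hj]; simp only [mul_assoc]

/-- The units at an index and at its swap multiply to `lam` in both halves, so the two contributions
cancel. Consequently the pairs (`i`, `j`) and (`j.swap`, `i.swap`) describe the same root, see
`shortRoot_symm`. -/
theorem bar_swap_bar (i j : Fin n ⊕ Fin n) (a : R) :
    F.bar j.swap i.swap (F.bar i j a) = a := by
  simp only [bar, star_mul, star_star]
  calc F.kap j.swap * star (F.kap i.swap) * (a * (F.kap j * star (F.kap i)))
      = F.kap j.swap * (star (F.kap i.swap) * (a * F.kap j * star (F.kap i))) := by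
        simp only [mul_assoc]
    _ = F.kap j.swap * (star (F.kap i.swap) * (star (F.kap i) * (F.kap j * a))) := by
        rw [← F.star_kap_comm i, F.kap_comm j a]
    _ = F.kap j.swap * ((star (F.kap i.swap) * star (F.kap i)) * (F.kap j * a)) := by
        rw [mul_assoc (star (F.kap i.swap))]
    _ = F.kap j.swap * (star F.lam * (F.kap j * a)) := by
        rw [← star_mul, F.kap_mul_swap]
    _ = F.kap j.swap * F.kap j * (star F.lam * a) := by
        rw [← mul_assoc (star F.lam), star_lam_comm]; simp only [mul_assoc]
    _ = a := by
        rw [F.kap_comm, F.kap_mul_swap, ← mul_assoc, F.lam_mul_star, one_mul]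

/-- The additive group of parameters of the long root elements. -/
def longParam (i : Fin n ⊕ Fin n) : AddSubgroup R where
  carrier := {a | F.lam * star (F.kap i) * a ∈ F.Λ}
  zero_mem' := by simp [F.Λ.zero_mem]
  add_mem' ha hb := by
    simp only [Set.mem_ofPred_eq, mul_add] at *
    exact F.Λ.add_mem ha hb
  neg_mem' ha := by
    simp only [Set.mem_ofPred_eq, mul_neg] at *
    exact F.Λ.neg_mem ha

theorem mem_longParam {i : Fin n ⊕ Fin n} {a : R} :
    a ∈ F.longParam i ↔ F.lam * star (F.kap i) * a ∈ F.Λ := Iff.rfl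

@[simp] theorem mem_longParam_inr {i : Fin n} {a : R} :
    a ∈ F.longParam (.inr i : Fin n ⊕ Fin n) ↔ a ∈ F.Λ := by
  simp [mem_longParam, F.lam_mul_star]

theorem star_mem_iff {a : R} : star a ∈ F.Λ ↔ F.lam * a ∈ F.Λ := by
  constructor <;> intro h
  · have h1 := F.le_max _ h
    rw [star_star] at h1
    rw [← neg_mem_iff, ← h1]
    exact h
  · have h1 := F.le_max _ h
    rw [star_mul, ← F.star_lam_comm, ← mul_assoc, F.lam_mul_star, one_mul] at h1
    rw [← neg_mem_iff, ← h1]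
    exact h

@[simp] theorem mem_longParam_inl {i : Fin n} {a : R} :
    a ∈ F.longParam (.inl i : Fin n ⊕ Fin n) ↔ star a ∈ F.Λ := by
  simp [mem_longParam, star_mem_iff]

theorem bar_of_mem_longParam {i : Fin n ⊕ Fin n} {a : R} (h : a ∈ F.longParam i) :
    F.bar i i.swap a = -a := by
  rcases i with i | i
  · have h1 := F.le_max _ ((F.mem_longParam_inl).1 h)
    simp only [bar, Sum.swap_inl, kap_inl, kap_inr, one_mul]
    rw [h1, star_star, mul_neg, ← mul_assoc, star_lam_mul, one_mul]
  · have h1 := F.le_max _ ((F.mem_longParam_inr).1 h)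
    simp only [bar, Sum.swap_inr, kap_inl, kap_inr, star_one, mul_one]
    conv_rhs => rw [h1, neg_neg]

theorem sub_bar_mem_longParam (i : Fin n ⊕ Fin n) (a : R) :
    a - F.bar i i.swap a ∈ F.longParam i := by
  rcases i with i | i
  · simp only [bar, Sum.swap_inl, kap_inl, kap_inr, one_mul, mem_longParam_inl, star_sub, star_mul,
      star_star, ← lam_comm]
    have := F.min_le (star a)
    rwa [star_star] at this
  · simpa [bar] using F.min_le a

theorem mul_mul_bar_mem_longParam {i j : Fin n ⊕ Fin n} {y : R} (hy : y ∈ F.longParam j) (x : R) :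
    x * y * F.bar i j x ∈ F.longParam i := by
  rw [mem_longParam] at *
  have h := F.conj_mem _ hy (star x)
  rw [star_star] at h
  convert h using 1
  simp only [bar]
  calc F.lam * star (F.kap i) * (x * y * (F.kap i * star (F.kap j) * star x))
      = F.lam * (star (F.kap i) * (x * y) * F.kap i) * star (F.kap j) * star x := by
        simp only [mul_assoc]
    _ = x * (F.lam * y) * star (F.kap j) * star x := by
        rw [star_kap_comm, mul_assoc (x * y), star_kap_mul, mul_one, ← mul_assoc x, ← lam_comm,
          ← mul_assoc]
    _ = _ := by
        rw [mul_assoc x, ← star_kap_comm, ← mul_assoc (star (F.kap j)), star_kap_comm]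

theorem swap_ne_self (i : Fin n ⊕ Fin n) : i.swap ≠ i := by rcases i with i | i <;> simp

theorem ne_swap_self (i : Fin n ⊕ Fin n) : i ≠ i.swap := (swap_ne_self i).symm

@[simp] theorem swap_inj {i j : Fin n ⊕ Fin n} : i.swap = j.swap ↔ i = j :=
  Sum.swap_leftInverse.injective.eq_iff

theorem swap_eq_comm {i j : Fin n ⊕ Fin n} : i.swap = j ↔ i = j.swap := by
  rw [← swap_inj, Sum.swap_swap]

omit [StarRing R] in
theorem single_mul_single_eq_ite {ι : Type*} [DecidableEq ι] [Fintype ι] (i j k l : ι) (a b : R) :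
    single i j a * single k l b = if j = k then single i l (a * b) else 0 := by
  split_ifs with h
  · subst h; rw [single_mul_single_same]
  · rw [single_mul_single_of_ne _ _ _ _ h]

omit [StarRing R] in
theorem single_neg' {ι : Type*} [DecidableEq ι] (i j : ι) (a : R) :
    single i j (-a) = -single i j a := by
  ext; simp [single_apply]; split_ifs <;> simp

omit [StarRing R] in
theorem single_sub' {ι : Type*} [DecidableEq ι] (i j : ι) (a b : R) :
    single i j (a - b) = single i j a - single i j b := by
  rw [sub_eq_add_neg, single_add, single_neg', sub_eq_add_neg]

/-- The short root elements. -/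
def shortRoot (i j : Fin n ⊕ Fin n) (a : R) : Matrix (Fin n ⊕ Fin n) (Fin n ⊕ Fin n) R :=
  1 + single i j a - single j.swap i.swap (F.bar i j a)

/-- The long root elements. -/
def longRoot (i : Fin n ⊕ Fin n) (a : R) : Matrix (Fin n ⊕ Fin n) (Fin n ⊕ Fin n) R :=
  1 + single i i.swap a

theorem shortRoot_symm (i j : Fin n ⊕ Fin n) (a : R) :
    F.shortRoot i j a = F.shortRoot j.swap i.swap (-F.bar i j a) := by
  simp only [shortRoot, bar_neg, bar_swap_bar, Sum.swap_swap, single_neg']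
  abel

theorem ne_swap_comm {i j : Fin n ⊕ Fin n} (h : i ≠ j.swap) : j ≠ i.swap := by
  rintro rfl; simp at h

@[simp] theorem shortRoot_zero (i j : Fin n ⊕ Fin n) : F.shortRoot i j 0 = 1 := by
  simp [shortRoot]

omit [StarRing R] in
@[simp] theorem longRoot_zero (i : Fin n ⊕ Fin n) : longRoot i (0 : R) = 1 := by
  simp [longRoot]

theorem shortRoot_add {i j : Fin n ⊕ Fin n} (h : i ≠ j) (a b : R) :
    F.shortRoot i j (a + b) = F.shortRoot i j a * F.shortRoot i j b := by
  simp only [shortRoot, bar_add, single_add]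
  simp only [mul_add, add_mul, mul_sub, sub_mul, single_mul_single_eq_ite, mul_one, one_mul,
    swap_inj, swap_eq_comm, Sum.swap_swap, h, h.symm, ne_swap_self, if_false]
  abel

omit [StarRing R] in
theorem longRoot_add (i : Fin n ⊕ Fin n) (a b : R) :
    longRoot i (a + b) = longRoot i a * longRoot i b := by
  simp only [longRoot, single_add]
  simp only [mul_add, add_mul, single_mul_single_eq_ite, mul_one, one_mul, swap_ne_self, if_false]
  abel

theorem shortRoot_mul_neg {i j : Fin n ⊕ Fin n} (h : i ≠ j) (a : R) :
    F.shortRoot i j a * F.shortRoot i j (-a) = 1 := by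
  rw [← shortRoot_add _ h, add_neg_cancel, shortRoot_zero]

theorem shortRoot_neg_mul {i j : Fin n ⊕ Fin n} (h : i ≠ j) (a : R) :
    F.shortRoot i j (-a) * F.shortRoot i j a = 1 := by
  rw [← shortRoot_add _ h, neg_add_cancel, shortRoot_zero]

omit [StarRing R] in
theorem longRoot_mul_neg (i : Fin n ⊕ Fin n) (a : R) : longRoot i a * longRoot i (-a) = 1 := by
  rw [← longRoot_add, add_neg_cancel, longRoot_zero]

omit [StarRing R] in
theorem longRoot_neg_mul (i : Fin n ⊕ Fin n) (a : R) : longRoot i (-a) * longRoot i a = 1 := by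
  rw [← longRoot_add, neg_add_cancel, longRoot_zero]

/-- This relation and those that follow are checked by multiplying out. The index inequalities
decide which products of matrix units vanish, `bar_mul` identifies the adjoint of a product of
parameters, and an additive identity is left. -/
theorem shortRoot_conj_shortRoot {i j h : Fin n ⊕ Fin n} (hij : i ≠ j) (hij' : i ≠ j.swap)
    (hjh : j ≠ h) (hjh' : j ≠ h.swap) (hih : i ≠ h) (a b : R) :
    F.shortRoot i j a * F.shortRoot j h b * F.shortRoot i j (-a) =
      F.shortRoot i h (a * b) * F.shortRoot j h b := by
  simp only [shortRoot, F.bar_mul i j h, bar_neg, single_neg']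
  simp only [mul_add, add_mul, mul_sub, sub_mul, mul_neg, neg_mul, single_mul_single_eq_ite,
    mul_one, one_mul, swap_inj, swap_eq_comm, hij, hjh, hih, hij', hjh', hij.symm, hjh.symm,
    hih.symm, ne_swap_comm hij', ne_swap_comm hjh', ne_swap_self, swap_ne_self,
    if_false, if_true, Sum.swap_swap, zero_mul, mul_zero]
  abel

/-- The degenerate case of the previous relation: the two off-diagonal terms of the composed root
fall on the same matrix entry and merge into a long root, whose parameter comes from the minimal
form parameter. -/
theorem shortRoot_conj_shortRoot_swap {i j : Fin n ⊕ Fin n} (hij : i ≠ j) (hij' : i ≠ j.swap)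
    (a b : R) :
    F.shortRoot i j a * F.shortRoot j i.swap b * F.shortRoot i j (-a) =
      longRoot i (a * b - F.bar i i.swap (a * b)) * F.shortRoot j i.swap b := by
  simp only [shortRoot, longRoot, F.bar_mul i j i.swap, bar_neg, single_neg', single_sub']
  simp only [mul_add, add_mul, mul_sub, sub_mul, mul_neg, neg_mul, single_mul_single_eq_ite,
    mul_one, one_mul, swap_inj, swap_eq_comm, hij, hij', hij.symm,
    ne_swap_comm hij', ne_swap_self, swap_ne_self,
    if_false, if_true, Sum.swap_swap, zero_mul, mul_zero]
  abel

theorem shortRoot_conj_longRoot {i j : Fin n ⊕ Fin n} (hij : i ≠ j) (hij' : i ≠ j.swap)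
    (b : R) {y : R} (hy : y ∈ F.longParam j) :
    F.shortRoot i j b * longRoot j y * F.shortRoot i j (-b) =
      longRoot j y * F.shortRoot i j.swap (b * y) * longRoot i (b * y * F.bar i j b) := by
  simp only [shortRoot, longRoot, F.bar_mul i j j.swap, bar_neg, F.bar_of_mem_longParam hy,
    single_neg', neg_mul]
  simp only [mul_add, add_mul, mul_sub, sub_mul, mul_neg, neg_mul, single_mul_single_eq_ite,
    mul_one, one_mul, swap_inj, swap_eq_comm, hij, hij', hij.symm,
    ne_swap_comm hij', ne_swap_self, swap_ne_self,
    if_false, if_true, Sum.swap_swap, zero_mul, mul_zero, mul_assoc]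
  abel

theorem longRoot_conj_shortRoot {j h : Fin n ⊕ Fin n} (hjh : j ≠ h) (hjh' : j ≠ h.swap)
    {y : R} (hy : y ∈ F.longParam j) (b : R) :
    longRoot j y * F.shortRoot j.swap h b * longRoot j (-y) =
      F.shortRoot j.swap h b * F.shortRoot j h (y * b) *
        longRoot h.swap (F.bar j.swap h b * y * b) := by
  simp only [shortRoot, longRoot, F.bar_mul j j.swap h, bar_neg, F.bar_of_mem_longParam hy,
    single_neg', mul_neg]
  simp only [mul_add, add_mul, mul_sub, sub_mul, mul_neg, neg_mul, single_mul_single_eq_ite,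
    mul_one, one_mul, swap_inj, swap_eq_comm, hjh, hjh', hjh.symm,
    ne_swap_comm hjh', ne_swap_self, swap_ne_self,
    if_false, if_true, Sum.swap_swap, zero_mul, mul_zero, mul_assoc]
  abel

theorem shortRoot_commute_shortRoot {i j h k : Fin n ⊕ Fin n} (h1 : h ≠ j) (h2 : h ≠ i.swap)
    (h3 : k ≠ i) (h4 : k ≠ j.swap) (a b : R) :
    Commute (F.shortRoot i j a) (F.shortRoot h k b) := by
  simp only [Commute, SemiconjBy, shortRoot]
  simp only [mul_add, add_mul, mul_sub, sub_mul, single_mul_single_eq_ite,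
    mul_one, one_mul, swap_inj, swap_eq_comm, h1, h2, h3, h4, h1.symm, h3.symm,
    ne_swap_comm h2, ne_swap_comm h4,
    if_false, if_true, Sum.swap_swap]
  abel

theorem shortRoot_commute_longRoot {i j h : Fin n ⊕ Fin n} (h1 : h ≠ j) (h2 : h ≠ i.swap)
    (a b : R) : Commute (F.shortRoot i j a) (longRoot h b) := by
  simp only [Commute, SemiconjBy, shortRoot, longRoot]
  simp only [mul_add, add_mul, mul_sub, sub_mul, single_mul_single_eq_ite,
    mul_one, one_mul, swap_inj, swap_eq_comm, h1, h2, h1.symm,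
    ne_swap_comm h2,
    if_false, if_true, Sum.swap_swap]
  abel

omit [StarRing R] in
theorem longRoot_commute_longRoot {i j : Fin n ⊕ Fin n} (h : i ≠ j.swap) (a b : R) :
    Commute (longRoot i a) (longRoot j b) := by
  simp only [Commute, SemiconjBy, longRoot]
  simp only [mul_add, add_mul, single_mul_single_eq_ite,
    mul_one, one_mul, swap_eq_comm, h, ne_swap_comm h, if_false]
  abel

/-- The predicate of being a short or a long root element with parameters in `X` and `Y i`. -/
inductive IsRoot (X : Set R) (Y : Fin n ⊕ Fin n → Set R) :
    Matrix (Fin n ⊕ Fin n) (Fin n ⊕ Fin n) R → Prop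
  | short (i j : Fin n ⊕ Fin n) (hij : i ≠ j) (hij' : i ≠ j.swap) (a : R) (ha : a ∈ X) :
      IsRoot X Y (F.shortRoot i j a)
  | long (i : Fin n ⊕ Fin n) (a : R) (ha : a ∈ Y i) : IsRoot X Y (longRoot i a)

/-- All root elements of the form ring. -/
abbrev IsRootElt (M : Matrix (Fin n ⊕ Fin n) (Fin n ⊕ Fin n) R) : Prop :=
  F.IsRoot Set.univ (fun i => F.longParam i) M

variable {F} in
theorem IsRootElt.short {i j : Fin n ⊕ Fin n} (hij : i ≠ j) (hij' : i ≠ j.swap) (a : R) :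
    F.IsRootElt (F.shortRoot i j a) := IsRoot.short i j hij hij' a trivial

variable {F} in
theorem IsRootElt.long {i : Fin n ⊕ Fin n} {a : R} (ha : a ∈ F.longParam i) :
    F.IsRootElt (longRoot i a) := IsRoot.long i a ha

variable (n) in
/-- The monoid generated by all root elements. -/
def elemMonoid : Submonoid (Matrix (Fin n ⊕ Fin n) (Fin n ⊕ Fin n) R) :=
  Submonoid.closure {M | F.IsRootElt M}

theorem shortRoot_mem {i j : Fin n ⊕ Fin n} (h : i ≠ j) (h' : i ≠ j.swap) (a : R) :
    F.shortRoot i j a ∈ F.elemMonoid n :=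
  Submonoid.subset_closure (IsRoot.short i j h h' a trivial)

theorem longRoot_mem {i : Fin n ⊕ Fin n} {a : R} (ha : a ∈ F.longParam i) :
    longRoot i a ∈ F.elemMonoid n :=
  Submonoid.subset_closure (IsRoot.long i a ha)

variable {F} in
theorem IsElementary.isRootElt {M : Matrix (Fin n ⊕ Fin n) (Fin n ⊕ Fin n) R}
    (h : F.IsElementary n M) : F.IsRootElt M := by
  cases h with
  | qe i j a h =>
    convert IsRootElt.short (F := F) (i := (.inl i)) (j := (.inl j)) (by simpa) (by simp) a using 1
    simp [shortRoot, bar]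
  | qr i j a h =>
    convert IsRootElt.short (F := F) (i := (.inl i)) (j := (.inr j)) (by simp) (by simpa) a using 1
    simp [shortRoot, bar]
  | qrDiag i a h =>
    exact IsRootElt.long (i := (.inl i)) (by simpa)
  | ql i j a h =>
    convert IsRootElt.short (F := F) (i := (.inr i)) (j := (.inl j)) (by simp) (by simpa) a using 1
    simp [shortRoot, bar]
  | qlDiag i a h =>
    exact IsRootElt.long (i := (.inr i)) (by simpa)

variable {F} in
theorem IsRoot.isElementary {M : Matrix (Fin n ⊕ Fin n) (Fin n ⊕ Fin n) R}
    (h : F.IsRootElt M) : F.IsElementary n M := by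
  cases h with
  | short i j h h' a _ =>
    rcases i with i | i <;> rcases j with j | j
    · convert IsElementary.qe (F := F) i j a (by simpa using h) using 1
      simp [shortRoot, bar]
    · convert IsElementary.qr (F := F) i j a (by simpa using h') using 1
      simp [shortRoot, bar]
    · convert IsElementary.ql (F := F) i j a (by simpa using h') using 1
      simp [shortRoot, bar]
    -- The generators contain no family indexed by two positions in the second half; the same root
    -- is rewritten with both positions in the first half.
    · rw [shortRoot_symm]
      convert IsElementary.qe (F := F) j i (-F.bar (.inr i) (.inr j) a)
        (fun e => h (by rw [e])) using 1
      simp [shortRoot, bar, F.lam_mul_star]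
  | long i a ha =>
    rcases i with i | i
    · exact IsElementary.qrDiag i a (F.mem_longParam_inl.1 ha)
    · exact IsElementary.qlDiag i a (F.mem_longParam_inr.1 ha)

variable {F} in
theorem IsRoot.exists_inv {M : Matrix (Fin n ⊕ Fin n) (Fin n ⊕ Fin n) R} (h : F.IsRootElt M) :
    ∃ N, F.IsRootElt N ∧ M * N = 1 ∧ N * M = 1 := by
  cases h with
  | short i j h h' a _ =>
    exact ⟨_, IsRoot.short i j h h' (-a) trivial, F.shortRoot_mul_neg h a, F.shortRoot_neg_mul h a⟩
  | long i a ha =>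
    exact ⟨_, IsRoot.long i (-a) ((F.longParam i).neg_mem ha), longRoot_mul_neg i a,
      longRoot_neg_mul i a⟩

variable {F} in
theorem exists_inv_of_mem_elemMonoid {M : Matrix (Fin n ⊕ Fin n) (Fin n ⊕ Fin n) R}
    (h : M ∈ F.elemMonoid n) : ∃ N ∈ F.elemMonoid n, M * N = 1 ∧ N * M = 1 := by
  induction h using Submonoid.closure_induction with
  | mem x hx =>
    obtain ⟨N, hN, h⟩ := IsRoot.exists_inv hx
    exact ⟨N, Submonoid.subset_closure hN, h⟩
  | one => exact ⟨1, one_mem _, by simp, by simp⟩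
  | mul x y _ _ hx hy =>
    obtain ⟨N, hN, h1, h2⟩ := hx
    obtain ⟨N', hN', h1', h2'⟩ := hy
    refine ⟨N' * N, mul_mem hN' hN, ?_, ?_⟩
    · rw [Matrix.mul_assoc, ← Matrix.mul_assoc y, h1', Matrix.one_mul, h1]
    · rw [Matrix.mul_assoc, ← Matrix.mul_assoc N, h2, Matrix.one_mul, h2']

/-- The inverse of a root element is a root element, so the monoid they generate is closed under
inverses. This allows plain matrices instead of units from here on, which are easier to move along
ring homomorphisms. -/
theorem mem_EQ_iff (σ : (Matrix (Fin n ⊕ Fin n) (Fin n ⊕ Fin n) R)ˣ) :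
    σ ∈ F.EQ n ↔ σ.val ∈ F.elemMonoid n := by
  constructor
  · intro h
    induction h using Subgroup.closure_induction with
    | mem x hx => exact Submonoid.subset_closure (IsElementary.isRootElt hx)
    | one => exact one_mem _
    | mul x y _ _ hx hy => exact mul_mem hx hy
    | inv x _ hx =>
      obtain ⟨N, hN, h1, h2⟩ := exists_inv_of_mem_elemMonoid hx
      rwa [← Units.inv_eq_of_mul_eq_one_right h1] at hN
  · have key : ∀ M ∈ F.elemMonoid n, ∃ τ ∈ F.EQ n, τ.val = M := by
      intro M hM
      induction hM using Submonoid.closure_induction with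
      | mem x hx =>
        obtain ⟨N, _, h1, h2⟩ := IsRoot.exists_inv hx
        exact ⟨⟨x, N, h1, h2⟩, Subgroup.subset_closure (IsRoot.isElementary hx), rfl⟩
      | one => exact ⟨1, one_mem _, rfl⟩
      | mul x y _ _ hx hy =>
        obtain ⟨s, hs, rfl⟩ := hx
        obtain ⟨t, ht, rfl⟩ := hy
        exact ⟨s * t, mul_mem hs ht, rfl⟩
    intro h
    obtain ⟨τ, hτ, h⟩ := key _ h
    rwa [← Units.ext h]

theorem psi_apply (i j : Fin n ⊕ Fin n) :
    F.psi n i j = if j = i.swap then F.kap i else 0 := by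
  rcases i with i | i <;> rcases j with j | j <;> simp [psi, one_apply, eq_comm]

end Roots
end FormStructure

namespace FormStructure

/-! ### Elementary matrices are quadratic -/

section Quadratic

variable {R : Type*} [Ring R] [StarRing R] (F : FormStructure R) {n : ℕ}

theorem isQuadratic_diag {a d : Matrix (Fin n) (Fin n) R} (h : aᴴ * d = 1) (h' : dᴴ * a = 1) :
    F.IsQuadratic n (fromBlocks a 0 0 d) := by
  refine ⟨?_, by simp [F.Λ.zero_mem], by simp [F.Λ.zero_mem]⟩
  simp [psi, fromBlocks_conjTranspose, fromBlocks_multiply, h, smul_mul_right, h']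

/-- With d = 1 the diagonal condition on b*d concerns b*, which is why the Hermitian hypothesis is
placed on `bᴴ` and not on `b`. -/
theorem isQuadratic_upper {b : Matrix (Fin n) (Fin n) R} (h : F.IsHerm bᴴ) :
    F.IsQuadratic n (fromBlocks 1 b 0 1) := by
  refine ⟨?_, by simp [F.Λ.zero_mem], by simpa using h.2⟩
  have h1 := h.1
  rw [conjTranspose_conjTranspose] at h1
  simp [psi, fromBlocks_conjTranspose, fromBlocks_multiply, smul_mul_right]
  rw [h1]
  simp

theorem isQuadratic_lower {c : Matrix (Fin n) (Fin n) R} (h : F.IsHerm c) :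
    F.IsQuadratic n (fromBlocks 1 0 c 1) := by
  refine ⟨?_, by simpa using h.2, by simp [F.Λ.zero_mem]⟩
  have h1 := h.1
  simp [psi, fromBlocks_conjTranspose, fromBlocks_multiply, smul_mul_right]
  conv_lhs => enter [2]; rw [h1]
  simp

variable {F} in
-- Each generator is block diagonal or block unitriangular, so one of the three preceding criteria
-- applies.
theorem IsElementary.isQuadratic {M : Matrix (Fin n ⊕ Fin n) (Fin n ⊕ Fin n) R}
    (h : F.IsElementary n M) : F.IsQuadratic n M := by
  have hb (a b c d : Matrix (Fin n) (Fin n) R) {N : Matrix (Fin n ⊕ Fin n) (Fin n ⊕ Fin n) R}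
      (hq : F.IsQuadratic n (fromBlocks a b c d)) (h1 : N.toBlocks₁₁ = a) (h2 : N.toBlocks₁₂ = b)
      (h3 : N.toBlocks₂₁ = c) (h4 : N.toBlocks₂₂ = d) : F.IsQuadratic n N := by
    rwa [← fromBlocks_toBlocks N, h1, h2, h3, h4]
  cases h with
  | qe i j a h =>
    refine hb (1 + single i j a) 0 0 (1 - single j i (star a)) ?_ ?_ ?_ ?_ ?_
    · apply F.isQuadratic_diag
      · simp only [conjTranspose_add, conjTranspose_one, conjTranspose_single, mul_sub, add_mul,
          one_mul, mul_one, single_mul_single_eq_ite, h, h.symm, if_false]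
        abel
      · simp only [conjTranspose_sub, conjTranspose_one, conjTranspose_single, mul_add, sub_mul,
          one_mul, mul_one, single_mul_single_eq_ite, h, h.symm, if_false, star_star]
        abel
    all_goals
      ext k l
      simp [toBlocks₁₁, toBlocks₁₂, toBlocks₂₁, toBlocks₂₂, single_apply, one_apply]
  | qr i j a h =>
    refine hb 1 (single i j a - single j i (star F.lam * star a)) 0 1 ?_ ?_ ?_ ?_ ?_
    · apply F.isQuadratic_upper
      refine ⟨?_, fun k => ?_⟩
      · simp only [conjTranspose_sub, conjTranspose_single, star_mul, star_star, smul_sub,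
          smul_single, smul_eq_mul, neg_sub, ← mul_assoc, F.lam_mul_star, one_mul, lam_comm]
      · have : ¬ (j = k ∧ i = k) := fun e => h (e.2.trans e.1.symm)
        have h' : ¬ (i = k ∧ j = k) := fun e => h (e.1.trans e.2.symm)
        simp [single_apply, this, h', F.Λ.zero_mem]
    all_goals
      ext k l
      simp [toBlocks₁₁, toBlocks₁₂, toBlocks₂₁, toBlocks₂₂, single_apply, one_apply]
  | qrDiag i a h =>
    refine hb 1 (single i i a) 0 1 ?_ ?_ ?_ ?_ ?_
    · apply F.isQuadratic_upper
      refine ⟨?_, fun k => ?_⟩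
      · have h1 := F.le_max _ h
        rw [conjTranspose_single]
        conv_lhs => rw [h1]
        simp [single_neg']
      · simp only [conjTranspose_single, single_apply]
        split_ifs
        exacts [h, F.Λ.zero_mem]
    all_goals
      ext k l
      simp [toBlocks₁₁, toBlocks₁₂, toBlocks₂₁, toBlocks₂₂, single_apply, one_apply]
  | ql i j a h =>
    refine hb 1 0 (single i j a - single j i (F.lam * star a)) 1 ?_ ?_ ?_ ?_ ?_
    · apply F.isQuadratic_lower
      refine ⟨?_, fun k => ?_⟩
      · simp only [conjTranspose_sub, conjTranspose_single, star_mul, star_star, smul_sub,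
          smul_single, smul_eq_mul, neg_sub, ← F.star_lam_comm]
        simp only [← mul_assoc, F.lam_mul_star, one_mul]
      · have : ¬ (j = k ∧ i = k) := fun e => h (e.2.trans e.1.symm)
        have h' : ¬ (i = k ∧ j = k) := fun e => h (e.1.trans e.2.symm)
        simp [single_apply, this, h', F.Λ.zero_mem]
    all_goals
      ext k l
      simp [toBlocks₁₁, toBlocks₁₂, toBlocks₂₁, toBlocks₂₂, single_apply, one_apply]
  | qlDiag i a h =>
    refine hb 1 0 (single i i a) 1 ?_ ?_ ?_ ?_ ?_
    · apply F.isQuadratic_lower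
      refine ⟨?_, fun k => ?_⟩
      · have h1 := F.le_max _ h
        rw [conjTranspose_single]
        conv_lhs => rw [h1]
        simp [single_neg']
      · simp only [single_apply]
        split_ifs
        exacts [h, F.Λ.zero_mem]
    all_goals
      ext k l
      simp [toBlocks₁₁, toBlocks₁₂, toBlocks₂₁, toBlocks₂₂, single_apply, one_apply]

variable {F} in
theorem IsQuadratic.mul {σ τ : Matrix (Fin n ⊕ Fin n) (Fin n ⊕ Fin n) R}
    (hσ : F.IsQuadratic n σ) (hτ : F.IsQuadratic n τ) : F.IsQuadratic n (σ * τ) := by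
  rw [isQuadratic_iff] at *
  convert (hσ.conj τ).add hτ using 1
  simp only [conjTranspose_mul, Matrix.mul_sub, Matrix.sub_mul, Matrix.mul_assoc]
  abel

variable {F} in
theorem isQuadratic_of_mem_elemMonoid {M : Matrix (Fin n ⊕ Fin n) (Fin n ⊕ Fin n) R}
    (h : M ∈ F.elemMonoid n) : F.IsQuadratic n M := by
  induction h using Submonoid.closure_induction with
  | mem x hx => exact (IsRoot.isElementary hx).isQuadratic
  | one => exact (F.GQ n).one_mem
  | mul x y _ _ hx hy => exact hx.mul hy

variable {F} in
theorem IsQuadratic.of_mul_eq_one {σ τ : Matrix (Fin n ⊕ Fin n) (Fin n ⊕ Fin n) R}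
    (hσ : F.IsQuadratic n σ) (h : σ * τ = 1) (h' : τ * σ = 1) : F.IsQuadratic n τ :=
  (F.GQ n).inv_mem (x := ⟨σ, τ, h, h'⟩) hσ

end Quadratic

/-! ### Functoriality in the form ring -/

section Hom

variable {R R' R'' : Type*} [Ring R] [StarRing R] [Ring R'] [StarRing R'] [Ring R''] [StarRing R'']

/-- Ring homomorphisms compatible with involutions and form structures. -/
structure IsFormHom (F : FormStructure R) (F' : FormStructure R') (g : R →+* R') : Prop where
  map_star : ∀ a, g (star a) = star (g a)
  map_lam : g F.lam = F'.lam
  map_mem : ∀ a ∈ F.Λ, g a ∈ F'.Λ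

variable {F : FormStructure R} {F' : FormStructure R'} {F'' : FormStructure R''} {g : R →+* R'}
  {n : ℕ}

theorem IsFormHom.comp {g' : R' →+* R''} (h' : IsFormHom F' F'' g') (h : IsFormHom F F' g) :
    IsFormHom F F'' (g'.comp g) where
  map_star a := by simp [h.map_star, h'.map_star]
  map_lam := by simp [h.map_lam, h'.map_lam]
  map_mem a ha := h'.map_mem _ (h.map_mem a ha)

theorem IsFormHom.map_kap (h : IsFormHom F F' g) (i : Fin n ⊕ Fin n) :
    g (F.kap i) = F'.kap i := by
  rcases i with i | i <;> simp [h.map_lam]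

theorem IsFormHom.map_bar (h : IsFormHom F F' g) (i j : Fin n ⊕ Fin n) (a : R) :
    g (F.bar i j a) = F'.bar i j (g a) := by
  simp [bar, h.map_kap, h.map_star]

theorem IsFormHom.map_longParam (h : IsFormHom F F' g) {i : Fin n ⊕ Fin n} {a : R}
    (ha : a ∈ F.longParam i) : g a ∈ F'.longParam i := by
  rw [mem_longParam] at *
  rw [← h.map_lam, ← h.map_kap, ← h.map_star, ← map_mul, ← map_mul]
  exact h.map_mem _ ha

theorem IsFormHom.map_shortRoot (h : IsFormHom F F' g) (i j : Fin n ⊕ Fin n) (a : R) :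
    g.mapMatrix (F.shortRoot i j a) = F'.shortRoot i j (g a) := by
  simp only [shortRoot, map_sub, map_add, map_one, RingHom.mapMatrix_apply, Matrix.map_single,
    h.map_bar]

theorem map_longRoot (g : R →+* R') (i : Fin n ⊕ Fin n) (a : R) :
    g.mapMatrix (longRoot i a) = longRoot i (g a) := by
  simp only [longRoot, map_add, map_one, RingHom.mapMatrix_apply, Matrix.map_single]

theorem IsFormHom.map_isRootElt (h : IsFormHom F F' g)
    {M : Matrix (Fin n ⊕ Fin n) (Fin n ⊕ Fin n) R}
    (hM : F.IsRootElt M) : F'.IsRootElt (g.mapMatrix M) := by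
  cases hM with
  | short i j hij hij' a _ => rw [h.map_shortRoot]; exact .short hij hij' _
  | long i a ha => rw [map_longRoot]; exact .long (h.map_longParam ha)

theorem IsFormHom.map_elemMonoid (h : IsFormHom F F' g)
    {M : Matrix (Fin n ⊕ Fin n) (Fin n ⊕ Fin n) R}
    (hM : M ∈ F.elemMonoid n) : g.mapMatrix M ∈ F'.elemMonoid n := by
  induction hM using Submonoid.closure_induction with
  | mem x hx => exact Submonoid.subset_closure (h.map_isRootElt hx)
  | one => rw [map_one]; exact one_mem _
  | mul x y _ _ hx hy => rw [map_mul]; exact mul_mem hx hy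

theorem IsFormHom.map_isQuadratic (h : IsFormHom F F' g)
    {M : Matrix (Fin n ⊕ Fin n) (Fin n ⊕ Fin n) R}
    (hM : F.IsQuadratic n M) : F'.IsQuadratic n (g.mapMatrix M) := by
  obtain ⟨h1, h2, h3⟩ := hM
  have hs (N : Matrix (Fin n ⊕ Fin n) (Fin n ⊕ Fin n) R) :
      (g.mapMatrix N)ᴴ = g.mapMatrix Nᴴ := by
    ext i j; simp [h.map_star]
  have hp : F'.psi n = g.mapMatrix (F.psi n) := by
    ext i j
    simp only [RingHom.mapMatrix_apply, map_apply, psi_apply]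
    split_ifs <;> simp [h.map_kap]
  refine ⟨?_, fun i => ?_, fun i => ?_⟩
  · rw [hs, hp, ← map_mul, ← map_mul, h1]
  · convert h.map_mem _ (h2 i) using 1
    simp [mul_apply, map_sum, h.map_star, toBlocks₁₁, toBlocks₂₁]
  · convert h.map_mem _ (h3 i) using 1
    simp [mul_apply, map_sum, h.map_star, toBlocks₁₂, toBlocks₂₂]

end Hom

end FormStructure

namespace FormStructure

/-! ### Conjugation calculus over a localization -/

section Localization

variable {K B B' : Type*} [CommRing K] [StarRing K] [TrivialStar K]
  [Ring B] [StarRing B] [Algebra K B] [StarModule K B]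
  [Ring B'] [StarRing B'] [Algebra K B'] [StarModule K B']
  {S : Submonoid K} {F : FormStructure B} {F' : FormStructure B'} {f : B →ₐ[K] B'} {n : ℕ}

variable (S F F' f) in
/-- A homomorphism of form algebras which is a localization at `S`. -/
structure IsFormLocalization : Prop where
  hom : IsFormHom F F' (f : B →+* B')
  exists_smul : ∀ x, ∃ s ∈ S, ∃ b, (s * s) • x = f b
  exists_smul_mem : ∀ y ∈ F'.Λ, ∃ s ∈ S, ∃ b ∈ F.Λ, (s * s) • y = f b
  smul_injective : ∀ s ∈ S, ∀ x : B', s • x = 0 → x = 0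
  exists_smul_eq_zero : ∀ b, f b = 0 → ∃ s ∈ S, s • b = 0

theorem bar_smul (F : FormStructure B) (i j : Fin n ⊕ Fin n) (k : K) (a : B) :
    F.bar i j (k • a) = k • F.bar i j a := by
  simp [bar, star_smul_trivial]

theorem sq_smul_mem_longParam (F : FormStructure B) {i : Fin n ⊕ Fin n} (k : K) {a : B}
    (ha : a ∈ F.longParam i) : (k * k) • a ∈ F.longParam i := by
  rw [mem_longParam] at *
  rw [mul_smul_comm]
  exact F.sq_smul_mem k ha

theorem IsFormLocalization.exists_smul_mem_longParam (hf : IsFormLocalization S F F' f)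
    {i : Fin n ⊕ Fin n} {y : B'} (hy : y ∈ F'.longParam i) :
    ∃ s ∈ S, ∃ b ∈ F.longParam i, (s * s) • y = f b := by
  obtain ⟨s, hs, b, hb, h⟩ := hf.exists_smul_mem _ hy
  have hk (i : Fin n ⊕ Fin n) : f (F.kap i) = F'.kap i := hf.hom.map_kap i
  have hst (a : B) : f (star a) = star (f a) := hf.hom.map_star a
  refine ⟨s, hs, F.kap i * star F.lam * b, ?_, ?_⟩
  · rw [mem_longParam]
    convert hb using 1
    rw [← mul_assoc, mul_assoc F.lam, ← mul_assoc (star (F.kap i)), star_kap_mul, one_mul,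
      F.lam_mul_star, one_mul]
  · rw [map_mul, ← h, map_mul, hst, hk, show f F.lam = F'.lam from hf.hom.map_lam, mul_smul_comm]
    congr 1
    rw [← mul_assoc, mul_assoc (F'.kap i), ← mul_assoc (star F'.lam), star_lam_mul, one_mul,
      kap_mul_star, one_mul]

variable (f) in
/-- Multiples by `p²` of elements from `B`. -/
def sqMul (p : K) : Set B' := {x | ∃ b, x = (p * p) • f b}

variable (F f) in
/-- Multiples by `p²` of long root parameters from `B`. -/
def sqMulLong (p : K) (i : Fin n ⊕ Fin n) : Set B' :=
  {x | ∃ b ∈ F.longParam i, x = (p * p) • f b}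

variable (F F' f n) in
/-- The monoid generated by the root elements whose parameters are multiples by `p²` of
elements coming from `B`. -/
def sqElem (p : K) : Submonoid (Matrix (Fin n ⊕ Fin n) (Fin n ⊕ Fin n) B') :=
  Submonoid.closure {M | F'.IsRoot (sqMul f p) (sqMulLong F f p) M}

theorem short_mem_sqElem {p : K} {i j : Fin n ⊕ Fin n} (h : i ≠ j) (h' : i ≠ j.swap) {x : B'}
    (hx : x ∈ sqMul f p) : F'.shortRoot i j x ∈ sqElem F F' f n p :=
  Submonoid.subset_closure (IsRoot.short i j h h' x hx)

theorem long_mem_sqElem {p : K} {i : Fin n ⊕ Fin n} {x : B'}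
    (hx : x ∈ sqMulLong F f p i) : longRoot i x ∈ sqElem F F' f n p :=
  Submonoid.subset_closure (IsRoot.long i x hx)

theorem sqMul_neg {p : K} {x : B'} (h : x ∈ sqMul f p) : -x ∈ sqMul f p := by
  obtain ⟨b, rfl⟩ := h
  exact ⟨-b, by simp⟩

theorem sqMulLong_neg {p : K} {i : Fin n ⊕ Fin n} {x : B'} (h : x ∈ sqMulLong F f p i) :
    -x ∈ sqMulLong F f p i := by
  obtain ⟨b, hb, rfl⟩ := h
  exact ⟨-b, neg_mem hb, by simp⟩

theorem sqMulLong_subset {p : K} {i : Fin n ⊕ Fin n} {x : B'} (h : x ∈ sqMulLong F f p i) :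
    x ∈ sqMul f p := by
  obtain ⟨b, hb, rfl⟩ := h
  exact ⟨b, rfl⟩

theorem sqMul_mono (t : K) {p : K} {x : B'} (h : x ∈ sqMul f (t * p)) : x ∈ sqMul f p := by
  obtain ⟨b, rfl⟩ := h
  refine ⟨(t * t) • b, ?_⟩
  rw [map_smul, smul_smul]
  congr 1
  ring

theorem sqMulLong_mono (t : K) {p : K} {i : Fin n ⊕ Fin n} {x : B'}
    (h : x ∈ sqMulLong F f (t * p) i) : x ∈ sqMulLong F f p i := by
  obtain ⟨b, hb, rfl⟩ := h
  refine ⟨(t * t) • b, F.sq_smul_mem_longParam t hb, ?_⟩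
  rw [map_smul, smul_smul]
  congr 1
  ring

namespace IsFormLocalization

variable (hf : IsFormLocalization S F F' f)
include hf

theorem map_bar (i j : Fin n ⊕ Fin n) (a : B) : f (F.bar i j a) = F'.bar i j (f a) :=
  hf.hom.map_bar i j a

theorem sqMul_bar {p : K} {x : B'} (i j : Fin n ⊕ Fin n) (h : x ∈ sqMul f p) :
    F'.bar i j x ∈ sqMul f p := by
  obtain ⟨b, rfl⟩ := h
  exact ⟨F.bar i j b, by rw [bar_smul, hf.map_bar]⟩

omit hf in
theorem mul_mem_sqMul {s p : K} {x y : B'} {b : B} (hx : (s * s) • x = f b)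
    (hy : y ∈ sqMul f (s * p)) : x * y ∈ sqMul f p := by
  obtain ⟨c, rfl⟩ := hy
  refine ⟨b * c, ?_⟩
  rw [map_mul, ← hx, smul_mul_assoc, smul_smul, mul_smul_comm]
  congr 1
  ring

theorem sub_bar_mem {p : K} (i : Fin n ⊕ Fin n) {x : B'} (hx : x ∈ sqMul f p) :
    x - F'.bar i i.swap x ∈ sqMulLong F f p i := by
  obtain ⟨b, rfl⟩ := hx
  refine ⟨_, F.sub_bar_mem_longParam i b, ?_⟩
  rw [map_sub, smul_sub, bar_smul, hf.map_bar]

/-- The element `x` occurs twice and each occurrence uses up `s * s` to clear its denominator. This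
explains the factor `s * s` in front of `p`: its square is s⁴. -/
theorem mul_mul_bar_mem {s p : K} {x y : B'} {i j : Fin n ⊕ Fin n} {b : B}
    (hx : (s * s) • x = f b) (hy : y ∈ sqMulLong F f (s * s * p) j) :
    x * y * F'.bar i j x ∈ sqMulLong F f p i := by
  obtain ⟨c, hc, rfl⟩ := hy
  refine ⟨_, F.mul_mul_bar_mem_longParam hc b, ?_⟩
  rw [map_mul, map_mul, hf.map_bar, ← hx, bar_smul]
  simp only [smul_mul_assoc, mul_smul_comm, smul_smul]
  congr 1
  ring

theorem bar_mul_mul_mem {s p : K} {x y : B'} {i j : Fin n ⊕ Fin n} {c : B}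
    (hc : c ∈ F.longParam j)
    (hx : (s * s) • x = f c) (hy : y ∈ sqMul f (s * s * p)) :
    F'.bar j.swap i y * x * y ∈ sqMulLong F f p i.swap := by
  obtain ⟨b, rfl⟩ := hy
  -- The two occurrences of `y` contribute s⁸p⁴ and `x` absorbs s². The remaining s⁶p⁴ splits as
  -- p²·(s³p)², and the second factor, being a square, may be moved into the long parameter.
  have h := F.sq_smul_mem_longParam (s * s * s * p)
    (F.mul_mul_bar_mem_longParam (i := i.swap) hc (F.bar j.swap i b))
  have h2 := F.bar_swap_bar j.swap i b
  rw [Sum.swap_swap] at h2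
  rw [h2] at h
  refine ⟨_, h, ?_⟩
  simp only [map_smul, map_mul, hf.map_bar, ← hx, bar_smul]
  simp only [smul_mul_assoc, mul_smul_comm, smul_smul]
  congr 1
  ring

theorem short_conj_short_aligned {s p : K} {i j k : Fin n ⊕ Fin n} (hij : i ≠ j)
    (hij' : i ≠ j.swap) (hjk : j ≠ k) (hjk' : j ≠ k.swap) (hik : i ≠ k) {x y : B'} {b : B}
    (hx : (s * s) • x = f b) (hy : y ∈ sqMul f (s * s * p)) :
    F'.shortRoot i j x * F'.shortRoot j k y * F'.shortRoot i j (-x) ∈ sqElem F F' f n p := by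
  have hy' := sqMul_mono _ hy
  rw [mul_assoc] at hy
  have hxy := sqMul_mono _ (mul_mem_sqMul hx hy)
  by_cases h : i = k.swap
  · obtain rfl : k = i.swap := by rw [h, Sum.swap_swap]
    rw [shortRoot_conj_shortRoot_swap _ hij hij']
    exact mul_mem (long_mem_sqElem (hf.sub_bar_mem i hxy)) (short_mem_sqElem hjk hjk' hy')
  · rw [shortRoot_conj_shortRoot _ hij hij' hjk hjk' hik]
    exact mul_mem (short_mem_sqElem hik h hxy) (short_mem_sqElem hjk hjk' hy')

/-- The hypotheses `h1` and `h2` say that the two roots are not opposite, in either of the two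
descriptions of a root. If they can be composed, `shortRoot_symm` brings them to the aligned form;
otherwise they commute. -/
theorem short_conj_short {s p : K} {i j h k : Fin n ⊕ Fin n} (hij : i ≠ j)
    (hij' : i ≠ j.swap) (hhk : h ≠ k) (hhk' : h ≠ k.swap) (h1 : ¬ (h = j ∧ k = i))
    (h2 : ¬ (h = i.swap ∧ k = j.swap)) {x y : B'} {b : B}
    (hx : (s * s) • x = f b) (hy : y ∈ sqMul f (s * s * p)) :
    F'.shortRoot i j x * F'.shortRoot h k y * F'.shortRoot i j (-x) ∈ sqElem F F' f n p := by
  have hx' : (s * s) • (-F'.bar i j x) = f (-F.bar i j b) := by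
    rw [smul_neg, ← bar_smul, hx, map_neg, hf.map_bar]
  have hy' : -F'.bar h k y ∈ sqMul f (s * s * p) := sqMul_neg (hf.sqMul_bar h k hy)
  by_cases e1 : h = j
  · subst e1
    exact hf.short_conj_short_aligned hij hij' hhk hhk' (fun e => h1 ⟨rfl, e.symm⟩) hx hy
  by_cases e2 : k = i
  · subst e2
    rw [F'.shortRoot_symm k j, F'.shortRoot_symm h k, F'.shortRoot_symm k j, bar_neg]
    refine hf.short_conj_short_aligned ?_ ?_ ?_ ?_ ?_ hx' hy'
    · simpa using hij.symm
    · simpa [swap_eq_comm] using ne_swap_comm hij'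
    · simpa using hhk.symm
    · rw [Sum.swap_swap]; exact fun e => hhk' e.symm
    · simpa using fun e => e1 e.symm
  by_cases e3 : h = i.swap
  · subst e3
    rw [F'.shortRoot_symm i j, F'.shortRoot_symm i j, bar_neg]
    refine hf.short_conj_short_aligned ?_ ?_ hhk hhk' ?_ hx' hy
    · simpa using hij.symm
    · simpa [swap_eq_comm] using ne_swap_comm hij'
    · exact fun e => h2 ⟨rfl, e.symm⟩
  by_cases e4 : k = j.swap
  · subst e4
    rw [F'.shortRoot_symm h j.swap, Sum.swap_swap]
    refine hf.short_conj_short_aligned hij hij' ?_ ?_ ?_ hx hy'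
    · rw [ne_eq, ← swap_eq_comm]; exact fun e => hhk e.symm
    · rw [Sum.swap_swap]; exact fun e => e1 e.symm
    · exact fun e => e3 (by rw [e, Sum.swap_swap])
  rw [(F'.shortRoot_commute_shortRoot e1 e3 e2 e4 x y).eq, mul_assoc, shortRoot_mul_neg _ hij,
    mul_one]
  exact short_mem_sqElem hhk hhk' (sqMul_mono _ hy)

theorem short_conj_long {s p : K} {i j h : Fin n ⊕ Fin n} (hij : i ≠ j)
    (hij' : i ≠ j.swap) {x y : B'} {b : B}
    (hx : (s * s) • x = f b) (hy : y ∈ sqMulLong F f (s * s * p) h) :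
    F'.shortRoot i j x * longRoot h y * F'.shortRoot i j (-x) ∈ sqElem F F' f n p := by
  have key : ∀ {i j : Fin n ⊕ Fin n} (_ : i ≠ j) (_ : i ≠ j.swap) {x y : B'} {b : B}
      (_ : (s * s) • x = f b) (_ : y ∈ sqMulLong F f (s * s * p) j),
      F'.shortRoot i j x * longRoot j y * F'.shortRoot i j (-x) ∈ sqElem F F' f n p := by
    intro i j hij hij' x y b hx hy
    have hyl : y ∈ F'.longParam j := by
      obtain ⟨c, hc, rfl⟩ := hy
      exact F'.sq_smul_mem_longParam _ (hf.hom.map_longParam hc)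
    rw [shortRoot_conj_longRoot _ hij hij' _ hyl]
    refine mul_mem (mul_mem (long_mem_sqElem (sqMulLong_mono _ hy)) (short_mem_sqElem hij' ?_ ?_))
      (long_mem_sqElem (hf.mul_mul_bar_mem hx hy))
    · simpa using hij
    · have hy' := sqMulLong_subset hy
      rw [mul_assoc] at hy'
      exact sqMul_mono _ (mul_mem_sqMul hx hy')
  by_cases e1 : h = j
  · subst e1; exact key hij hij' hx hy
  by_cases e2 : h = i.swap
  · subst e2
    rw [F'.shortRoot_symm i j, F'.shortRoot_symm i j, bar_neg]
    refine key ?_ ?_ (b := -F.bar i j b) ?_ hy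
    · simpa using hij.symm
    · simpa [swap_eq_comm] using ne_swap_comm hij'
    · rw [smul_neg, ← bar_smul, hx, map_neg, hf.map_bar]
  rw [(F'.shortRoot_commute_longRoot e1 e2 x y).eq, mul_assoc, shortRoot_mul_neg _ hij, mul_one]
  exact long_mem_sqElem (sqMulLong_mono _ hy)

/-- A short root is never opposite to a long one, so no position has to be excluded. Up to
`shortRoot_symm`, either the short root starts at `j.swap` or the two elements commute. -/
theorem long_conj_short {s p : K} {j h k : Fin n ⊕ Fin n} (hhk : h ≠ k)
    (hhk' : h ≠ k.swap) {x y : B'} {c : B} (hc : c ∈ F.longParam j) (hxl : x ∈ F'.longParam j)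
    (hx : (s * s) • x = f c) (hy : y ∈ sqMul f (s * s * p)) :
    longRoot j x * F'.shortRoot h k y * longRoot j (-x) ∈ sqElem F F' f n p := by
  have key : ∀ {k : Fin n ⊕ Fin n} (_ : j.swap ≠ k) (_ : j.swap ≠ k.swap) {y : B'}
      (_ : y ∈ sqMul f (s * s * p)),
      longRoot j x * F'.shortRoot j.swap k y * longRoot j (-x) ∈ sqElem F F' f n p := by
    intro k hk hk' y hy
    have h1 : j ≠ k := by simpa using hk'
    have h2 : j ≠ k.swap := by rwa [ne_eq, ← swap_eq_comm]
    rw [longRoot_conj_shortRoot _ h1 h2 hxl]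
    refine mul_mem (mul_mem (short_mem_sqElem hk hk' (sqMul_mono _ hy))
      (short_mem_sqElem h1 h2 ?_)) (long_mem_sqElem (hf.bar_mul_mul_mem hc hx hy))
    rw [mul_assoc] at hy
    exact sqMul_mono _ (mul_mem_sqMul hx hy)
  by_cases e1 : h = j.swap
  · subst e1; exact key hhk hhk' hy
  by_cases e2 : k = j
  · subst e2
    rw [F'.shortRoot_symm h k]
    refine key ?_ ?_ (sqMul_neg (hf.sqMul_bar h k hy))
    · simpa using hhk.symm
    · rw [Sum.swap_swap]; exact fun e => hhk' e.symm
  have hc := (F'.shortRoot_commute_longRoot (i := h) (j := k) (h := j) (fun e => e2 e.symm)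
    (ne_swap_comm e1) y x).eq
  rw [← hc, mul_assoc, longRoot_mul_neg, mul_one]
  exact short_mem_sqElem hhk hhk' (sqMul_mono _ hy)

end IsFormLocalization

theorem conj_mem_of_generators {A : Type*} [Monoid A] {g g' : A} (h : g' * g = 1)
    (h' : g * g' = 1) {s : Set A} {T : Submonoid A} (hs : ∀ x ∈ s, g * x * g' ∈ T) {x : A}
    (hx : x ∈ Submonoid.closure s) : g * x * g' ∈ T := by
  induction hx using Submonoid.closure_induction with
  | mem x hx => exact hs x hx
  | one => rw [mul_one, h']; exact one_mem _
  | mul x y _ _ hx hy =>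
    have : g * (x * y) * g' = (g * x * g') * (g * y * g') := by
      calc _ = g * x * 1 * y * g' := by simp only [mul_assoc, mul_one, one_mul]
        _ = _ := by rw [← h]; simp only [mul_assoc]
    rw [this]
    exact mul_mem hx hy

theorem kap_congr {R : Type*} [Ring R] [StarRing R] (F : FormStructure R) {i j : Fin n ⊕ Fin n}
    (h : i.isLeft = j.isLeft) : F.kap i = F.kap j := by
  rcases i with i | i <;> rcases j with j | j <;> simp at h ⊢

/-- The positions `i` and `j` occupy at most two of the n ≥ 3 hyperbolic planes. Staying in the half
of `i` gives the new index the same central unit, hence the same long parameters, as `i`. -/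
theorem exists_third (hn : 3 ≤ n) (i j : Fin n ⊕ Fin n) :
    ∃ h : Fin n ⊕ Fin n, h ≠ i ∧ h ≠ i.swap ∧ h ≠ j ∧ h ≠ j.swap ∧
      h.isLeft = i.isLeft := by
  have : ∃ a : Fin n, a ≠ i.elim id id ∧ a ≠ j.elim id id := by
    have h : ({i.elim id id, j.elim id id} : Finset (Fin n)).card < (Finset.univ : Finset (Fin n)).card := by
      refine lt_of_le_of_lt Finset.card_le_two ?_
      rw [Finset.card_fin]; omega
    obtain ⟨a, _, ha⟩ := Finset.exists_mem_notMem_of_card_lt_card h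
    simp at ha
    exact ⟨a, ha.1, ha.2⟩
  obtain ⟨a, h1, h2⟩ := this
  rcases i with i | i <;> rcases j with j | j <;> simp at h1 h2
  · exact ⟨.inl a, by simp [h1, h2]⟩
  · exact ⟨.inl a, by simp [h1, h2]⟩
  · exact ⟨.inr a, by simp [h1, h2]⟩
  · exact ⟨.inr a, by simp [h1, h2]⟩

namespace IsFormLocalization

variable (hf : IsFormLocalization S F F' f)
include hf

/-- For a generator at a non-opposite root the previous lemmas suffice. At the opposite root it is a
commutator of two root elements through a third index, neither opposite to the conjugating root. The
sixth power leaves enough divisibility to distribute over the factors. -/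
theorem short_conj (hn : 3 ≤ n) {s : K} {i j : Fin n ⊕ Fin n} (hij : i ≠ j)
    (hij' : i ≠ j.swap) {x : B'} {b : B} (hx : (s * s) • x = f b) (p : K)
    {M : Matrix (Fin n ⊕ Fin n) (Fin n ⊕ Fin n) B'}
    (hM : M ∈ sqElem F F' f n ((s * s * p) ^ 6)) :
    F'.shortRoot i j x * M * F'.shortRoot i j (-x) ∈ sqElem F F' f n p := by
  set r := s * s * p with hr
  have hinv := F'.shortRoot_neg_mul hij x
  have hinv' := F'.shortRoot_mul_neg hij x
  refine conj_mem_of_generators hinv hinv' ?_ hM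
  have opp : ∀ y ∈ sqMul f (r ^ 6), F'.shortRoot i j x * F'.shortRoot j i y *
      F'.shortRoot i j (-x) ∈ sqElem F F' f n p := by
    rintro _ ⟨c, rfl⟩
    obtain ⟨h, h1, h2, h3, h4, -⟩ := exists_third hn i j
    -- The factor (r⁶)² = r¹² is split as r²·(r²·r⁸), so that both factors of the commutator have
    -- parameters divisible by r².
    set u : B' := (r * r) • f 1 with hu
    set v : B' := (r * r) • f (r ^ 8 • c) with hv
    have hu' : u ∈ sqMul f r := ⟨_, rfl⟩
    have hv' : v ∈ sqMul f r := ⟨_, rfl⟩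
    have huv : (r ^ 6 * r ^ 6) • f c = u * v := by
      rw [hu, hv, map_one, smul_one_mul, map_smul, smul_smul, smul_smul]
      congr 1
      ring
    have e : F'.shortRoot j i (u * v) = F'.shortRoot j h u * F'.shortRoot h i v *
        F'.shortRoot j h (-u) * F'.shortRoot h i (-v) := by
      rw [shortRoot_conj_shortRoot _ h3.symm (ne_swap_comm h4) h1 h2 hij.symm,
        mul_assoc, shortRoot_mul_neg _ h1, mul_one]
    rw [huv, e]
    refine conj_mem_of_generators hinv hinv' (s := {N | F'.shortRoot i j x * N *
      F'.shortRoot i j (-x) ∈ sqElem F F' f n p}) (fun _ h => h) ?_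
    have a1 : ∀ w ∈ sqMul f r, F'.shortRoot i j x * F'.shortRoot j h w *
        F'.shortRoot i j (-x) ∈ sqElem F F' f n p := fun w hw =>
      hf.short_conj_short hij hij' h3.symm (ne_swap_comm h4) (fun e => h1 e.2)
        (fun e => hij' (by rw [e.1, Sum.swap_swap])) hx hw
    have a2 : ∀ w ∈ sqMul f r, F'.shortRoot i j x * F'.shortRoot h i w *
        F'.shortRoot i j (-x) ∈ sqElem F F' f n p := fun w hw =>
      hf.short_conj_short hij hij' h1 h2 (fun e => h3 e.1) (fun e => h2 e.1) hx hw
    exact mul_mem (mul_mem (mul_mem (Submonoid.subset_closure (a1 _ hu'))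
      (Submonoid.subset_closure (a2 _ hv'))) (Submonoid.subset_closure (a1 _ (sqMul_neg hu'))))
      (Submonoid.subset_closure (a2 _ (sqMul_neg hv')))
  have hr6 : r ^ 6 = r ^ 5 * r := by ring
  rintro _ (⟨h, k, hhk, hhk', y, hy⟩ | ⟨h, y, hy⟩)
  · by_cases e1 : h = j ∧ k = i
    · obtain ⟨rfl, rfl⟩ := e1
      exact opp y hy
    by_cases e2 : h = i.swap ∧ k = j.swap
    · obtain ⟨rfl, rfl⟩ := e2
      rw [F'.shortRoot_symm i.swap, Sum.swap_swap, Sum.swap_swap]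
      exact opp _ (sqMul_neg (hf.sqMul_bar _ _ hy))
    rw [hr6] at hy
    exact hf.short_conj_short hij hij' hhk hhk' e1 e2 hx (sqMul_mono _ hy)
  · rw [hr6] at hy
    exact hf.short_conj_long hij hij' hx (sqMulLong_mono _ hy)

/-- Only the opposite long root is problematic. The relation `shortRoot_conj_longRoot`, solved for
its last factor, expresses it through short roots and a long root at another index, all of which are
harmless. -/
theorem long_conj (hn : 3 ≤ n) {s : K} {i : Fin n ⊕ Fin n} {x : B'} (hxl : x ∈ F'.longParam i)
    {c : B} (hc : c ∈ F.longParam i) (hx : (s * s) • x = f c) (p : K)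
    {M : Matrix (Fin n ⊕ Fin n) (Fin n ⊕ Fin n) B'}
    (hM : M ∈ sqElem F F' f n ((s * s * p) ^ 6)) :
    longRoot i x * M * longRoot i (-x) ∈ sqElem F F' f n p := by
  set r := s * s * p with hr
  have hinv := longRoot_neg_mul i x
  have hinv' := longRoot_mul_neg i x
  refine conj_mem_of_generators hinv hinv' ?_ hM
  have nonopp : ∀ h : Fin n ⊕ Fin n, h ≠ i.swap → ∀ y ∈ sqMulLong F f r h,
      longRoot i x * longRoot h y * longRoot i (-x) ∈ sqElem F F' f n p := by
    intro h hh y hy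
    rw [(longRoot_commute_longRoot (ne_swap_comm hh) x y).eq, mul_assoc, longRoot_mul_neg, mul_one]
    exact long_mem_sqElem (sqMulLong_mono _ hy)
  have hr6 : r ^ 6 = r ^ 5 * r := by ring
  rintro _ (⟨h, k, hhk, hhk', y, hy⟩ | ⟨h, y, hy⟩)
  · rw [hr6] at hy
    exact hf.long_conj_short hhk hhk' hc hxl hx (sqMul_mono _ hy)
  · by_cases e : h = i.swap
    swap
    · rw [hr6] at hy
      exact nonopp h e _ (sqMulLong_mono _ hy)
    obtain ⟨d, hd, rfl⟩ := hy
    obtain ⟨k, h1, h2, -, -, hk⟩ := exists_third hn h h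
    set u : B' := (r * r) • f 1 with hu
    -- Here r¹² = r²·(r²·r⁶)·r², with `u` used twice. The inner scalar r⁶ is written as the square
    -- of r³ so that it preserves long parameters.
    set v : B' := (r * r) • f ((r ^ 3 * r ^ 3) • d) with hv
    have hu' : u ∈ sqMul f r := ⟨_, rfl⟩
    have hdk : d ∈ F.longParam k := by rw [mem_longParam, F.kap_congr hk]; exact hd
    have hv' : v ∈ sqMulLong F f r k := ⟨_, F.sq_smul_mem_longParam _ hdk, rfl⟩
    have hvl : v ∈ F'.longParam k := F'.sq_smul_mem_longParam _
      (hf.hom.map_longParam (F.sq_smul_mem_longParam _ hdk))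
    have hub : F'.bar h k u = u := by
      rw [hu, bar_smul, map_one, bar, F'.kap_congr hk, kap_mul_star, star_one, one_mul]
    have huv : (r ^ 6 * r ^ 6) • f d = u * v * F'.bar h k u := by
      rw [hub, hu, hv, map_one, smul_one_mul, mul_smul_one, map_smul, smul_smul, smul_smul,
        smul_smul]
      congr 1
      ring
    have huv' : u * v ∈ sqMul f r := by
      refine ⟨(r * r) • ((r ^ 3 * r ^ 3) • d), ?_⟩
      rw [hu, map_one, smul_one_mul, hv, map_smul f (r * r)]
    have e1 : longRoot h (u * v * F'.bar h k u) = F'.shortRoot h k.swap (-(u * v)) *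
        longRoot k (-v) * (F'.shortRoot h k u * longRoot k v * F'.shortRoot h k (-u)) := by
      rw [shortRoot_conj_longRoot _ h1.symm (ne_swap_comm h2) u hvl]
      simp only [mul_assoc]
      rw [← mul_assoc (longRoot k (-v)), longRoot_neg_mul, one_mul,
        ← mul_assoc (F'.shortRoot h k.swap (-(u * v))), shortRoot_neg_mul _ (ne_swap_comm h2), one_mul]
    rw [huv, e1]
    refine conj_mem_of_generators hinv hinv' (s := {N | longRoot i x * N *
      longRoot i (-x) ∈ sqElem F F' f n p}) (fun _ h => h) ?_
    have a1 : ∀ w ∈ sqMul f r, longRoot i x * F'.shortRoot h k w *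
        longRoot i (-x) ∈ sqElem F F' f n p := fun w hw =>
      hf.long_conj_short h1.symm (ne_swap_comm h2) hc hxl hx hw
    have a2 : ∀ w ∈ sqMul f r, longRoot i x * F'.shortRoot h k.swap w *
        longRoot i (-x) ∈ sqElem F F' f n p := fun w hw =>
      hf.long_conj_short (ne_swap_comm h2) (by simpa using h1.symm) hc hxl hx hw
    have a3 := nonopp k (by rw [← e]; exact h1)
    exact mul_mem (mul_mem (Submonoid.subset_closure (a2 _ (sqMul_neg huv')))
      (Submonoid.subset_closure (a3 _ (sqMulLong_neg hv')))) (mul_mem (mul_mem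
      (Submonoid.subset_closure (a1 _ hu')) (Submonoid.subset_closure (a3 _ hv')))
      (Submonoid.subset_closure (a1 _ (sqMul_neg hu'))))

end IsFormLocalization

end Localization

end FormStructure

namespace FormStructure

/-! ### Form structures on polynomial rings and evaluation -/

section PolynomialRing

open Polynomial

variable {K R : Type*} [CommRing K] [StarRing K] [TrivialStar K]
  [Ring R] [StarRing R] [Algebra K R] [StarModule K R]

/-- The coefficientwise involution on polynomials, fixing the variable. -/
noncomputable instance polynomialStar : Star R[X] where
  star p := p.sum fun i a => monomial i (star a)

theorem coeff_star (p : R[X]) (i : ℕ) : (star p).coeff i = star (p.coeff i) := by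
  change (p.sum fun i a => monomial i (star a)).coeff i = _
  rw [Polynomial.sum, finsetSum_coeff]
  simp only [coeff_monomial]
  rw [Finset.sum_ite_eq' p.support i]
  split_ifs with h
  · rfl
  · rw [notMem_support_iff.1 h, star_zero]

noncomputable instance polynomialStarRing : StarRing R[X] where
  star_involutive p := by ext i; simp [coeff_star]
  star_mul p q := by
    ext i
    rw [coeff_star, coeff_mul, coeff_mul, star_sum, ← Finset.Nat.sum_antidiagonal_swap]
    simp [coeff_star]
  star_add p q := by ext i; simp [coeff_star]

noncomputable instance polynomialStarModule : StarModule K R[X] where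
  star_smul k p := by ext i; simp [coeff_star]

@[simp] theorem star_C (a : R) : star (C a) = C (star a) := by
  ext i
  rw [coeff_star, coeff_C, coeff_C]
  split_ifs <;> simp

@[simp] theorem star_X : star (X : R[X]) = X := by
  ext i
  rw [coeff_star, coeff_X]
  split_ifs <;> simp

/-- The form structure on the polynomial ring: its form parameter consists of the polynomials
with coefficients in `Λ`. -/
noncomputable def poly (F : FormStructure R) : FormStructure R[X] where
  lam := C F.lam
  lam_mem_center := by
    rw [Subring.mem_center_iff]
    intro p
    ext i
    rw [coeff_mul_C, coeff_C_mul, lam_comm]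
  lam_mul_star := by rw [star_C, ← C_mul, F.lam_mul_star, C_1]
  Λ :=
    { carrier := {p | ∀ i, p.coeff i ∈ F.Λ}
      zero_mem' := fun i => by simp [F.Λ.zero_mem]
      add_mem' := fun ha hb i => by rw [coeff_add]; exact F.Λ.add_mem (ha i) (hb i)
      neg_mem' := fun ha i => by rw [coeff_neg]; exact F.Λ.neg_mem (ha i) }
  min_le p i := by
    rw [coeff_sub, coeff_C_mul, coeff_star]
    exact F.min_le _
  le_max p hp := by
    ext i
    rw [coeff_neg, coeff_C_mul, coeff_star]
    exact F.le_max _ (hp i)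
  conj_mem := by
    intro p hp q i
    have hsum (k : ℕ) (a : R) (ha : a ∈ F.Λ) (i : ℕ) :
        (star q * monomial k a * q).coeff i ∈ F.Λ := by
      have h : star q * monomial k a * q =
          ∑ u ∈ q.support, ∑ v ∈ q.support,
            monomial (u + v + k) (star (q.coeff u) * a * q.coeff v) := by
        have h1 : star q * monomial k a * q = (∑ u ∈ q.support, monomial u (star (q.coeff u))) *
            monomial k a * ∑ v ∈ q.support, monomial v (q.coeff v) := by
          rw [← q.as_sum_support]; rfl
        rw [h1, Finset.sum_mul, Finset.sum_mul]
        refine Finset.sum_congr rfl fun u _ => ?_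
        rw [Finset.mul_sum]
        refine Finset.sum_congr rfl fun v _ => ?_
        rw [monomial_mul_monomial, monomial_mul_monomial]
        rw [show u + v + k = u + k + v by omega]
      rw [h, finsetSum_coeff]
      simp_rw [finsetSum_coeff, coeff_monomial]
      -- The coefficient is a double sum over pairs of exponents that is skew-Hermitian in (`u`,
      -- `v`): diagonal terms lie in `Λ` by closure under conjugation, and transposed terms pair up
      -- to elements of the minimal form parameter.
      refine sum_mem_of_skew (F := F) q.support (fun u v =>
        if u + v + k = i then star (q.coeff u) * a * q.coeff v else 0) (fun u => ?_) fun u v => ?_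
      · split_ifs
        exacts [F.conj_mem _ ha _, F.Λ.zero_mem]
      · rw [add_comm u v]
        split_ifs
        · conv_lhs => rw [F.le_max a ha]
          simp only [star_mul, star_star, mul_neg, neg_mul]
          rw [← mul_assoc, ← lam_comm]
          simp only [mul_assoc]
        · simp
    rw [p.as_sum_support, Finset.mul_sum, Finset.sum_mul, finsetSum_coeff]
    exact F.Λ.sum_mem fun k _ => hsum k _ (hp k) i

theorem mem_poly_Λ {F : FormStructure R} {p : R[X]} : p ∈ F.poly.Λ ↔ ∀ i, p.coeff i ∈ F.Λ :=
  Iff.rfl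

theorem isFormHom_C (F : FormStructure R) : IsFormHom F F.poly C where
  map_star a := by rw [star_C]
  map_lam := rfl
  map_mem a ha i := by
    rw [coeff_C]
    split_ifs
    exacts [ha, F.Λ.zero_mem]

/-- Central symmetric elements which act on the form parameter. -/
structure IsFormScalar (F : FormStructure R) (x : R) : Prop where
  comm : ∀ a, Commute a x
  star_eq : star x = x
  mul_mem : ∀ a ∈ F.Λ, a * x ∈ F.Λ

theorem IsFormScalar.add {F : FormStructure R} {x y : R} (hx : F.IsFormScalar x)
    (hy : F.IsFormScalar y) : F.IsFormScalar (x + y) where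
  comm a := (hx.comm a).add_right (hy.comm a)
  star_eq := by rw [star_add, hx.star_eq, hy.star_eq]
  mul_mem a ha := by
    rw [mul_add]
    exact F.Λ.add_mem (hx.mul_mem a ha) (hy.mul_mem a ha)

theorem IsFormScalar.neg {F : FormStructure R} {x : R} (hx : F.IsFormScalar x) :
    F.IsFormScalar (-x) where
  comm a := (hx.comm a).neg_right
  star_eq := by rw [star_neg, hx.star_eq]
  mul_mem a ha := by
    rw [mul_neg]
    exact F.Λ.neg_mem (hx.mul_mem a ha)

theorem IsFormScalar.mul {F : FormStructure R} {x y : R} (hx : F.IsFormScalar x)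
    (hy : F.IsFormScalar y) : F.IsFormScalar (x * y) where
  comm a := (hx.comm a).mul_right (hy.comm a)
  star_eq := by rw [star_mul, hx.star_eq, hy.star_eq, (hx.comm y).eq]
  mul_mem a ha := by
    rw [← mul_assoc]
    exact hy.mul_mem _ (hx.mul_mem a ha)

theorem isFormScalar_zero (F : FormStructure R) : F.IsFormScalar 0 where
  comm a := Commute.zero_right a
  star_eq := star_zero _
  mul_mem a ha := by rw [mul_zero]; exact F.Λ.zero_mem

theorem isFormScalar_one (F : FormStructure R) : F.IsFormScalar 1 where
  comm a := Commute.one_right a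
  star_eq := star_one _
  mul_mem a ha := by rwa [mul_one]

/-- Conjugating `Λ` by a scalar multiplies it by the square of that scalar, while `Λ` need not be a
`K`-submodule. For this reason variables are rescaled by squares throughout. -/
theorem isFormScalar_sq (F : FormStructure R) (k : K) :
    F.IsFormScalar (algebraMap K R (k * k)) where
  comm a := (Algebra.commutes (k * k) a).symm
  star_eq := by rw [Algebra.algebraMap_eq_smul_one, star_smul_trivial, star_one]
  mul_mem a ha := by
    rw [← Algebra.commutes, ← Algebra.smul_def]
    exact F.sq_smul_mem _ ha

theorem isFormScalar_X (F : FormStructure R) : F.poly.IsFormScalar X where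
  comm a := (commute_X a).symm
  star_eq := star_X
  mul_mem a ha i := by
    rcases i with _ | i
    · simp [F.Λ.zero_mem]
    · rw [coeff_mul_X]; exact ha i

theorem IsFormScalar.C {F : FormStructure R} {x : R} (hx : F.IsFormScalar x) :
    F.poly.IsFormScalar (C x) where
  comm a := by
    ext i
    rw [coeff_mul_C, coeff_C_mul, (hx.comm _).eq]
  star_eq := by rw [star_C, hx.star_eq]
  mul_mem a ha i := by
    rw [coeff_mul_C]; exact hx.mul_mem _ (ha i)

variable {B : Type*} [Ring B] [StarRing B] [Algebra K B] [StarModule K B]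

/-- Evaluation of polynomials at a form scalar, along an algebra homomorphism. -/
noncomputable def evalHom (g : R →ₐ[K] B) {F' : FormStructure B} {x : B}
    (hx : F'.IsFormScalar x) : R[X] →ₐ[K] B :=
  eval₂AlgHom g x fun a => hx.comm _

section

variable (g : R →ₐ[K] B) {F : FormStructure R} {F' : FormStructure B} {x : B}
  (hx : F'.IsFormScalar x)

theorem evalHom_monomial (i : ℕ) (a : R) :
    evalHom g hx (monomial i a) = g a * x ^ i := by
  change eval₂ (g : R →+* B) x (monomial i a) = _
  rw [eval₂_monomial]
  rfl

@[simp] theorem evalHom_C (a : R) : evalHom g hx (Polynomial.C a) = g a := by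
  change eval₂ (g : R →+* B) x (Polynomial.C a) = _
  rw [eval₂_C]
  rfl

@[simp] theorem evalHom_X : evalHom g hx (X : R[X]) = x := by
  change eval₂ (g : R →+* B) x X = _
  rw [eval₂_X]

theorem IsFormScalar.pow {F' : FormStructure B} {x : B} (hx : F'.IsFormScalar x) (i : ℕ) :
    F'.IsFormScalar (x ^ i) := by
  induction i with
  | zero => rw [pow_zero]; exact isFormScalar_one _
  | succ i ih => rw [pow_succ]; exact ih.mul hx

theorem evalHom_isFormHom (hg : IsFormHom F F' (g : R →+* B)) :
    IsFormHom F.poly F' (evalHom g hx : R[X] →+* B) where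
  map_star p := by
    change evalHom g hx (star p) = star (evalHom g hx p)
    induction p using Polynomial.induction_on' with
    | add p q hp hq => rw [star_add, map_add, hp, hq, map_add, star_add]
    | monomial i a =>
      have h : star (monomial i a) = monomial i (star a) := by
        ext j
        rw [coeff_star, coeff_monomial, coeff_monomial]
        split_ifs <;> simp
      have h2 := hg.map_star a
      simp only [RingHom.coe_coe] at h2
      rw [h, evalHom_monomial, evalHom_monomial, star_mul, (hx.pow i).star_eq, h2,
        ((hx.pow i).comm _).eq]
  map_lam := by
    change evalHom g hx (Polynomial.C F.lam) = _
    rw [evalHom_C]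
    exact hg.map_lam
  map_mem p hp := by
    change evalHom g hx p ∈ _
    rw [p.as_sum_support, map_sum]
    refine F'.Λ.sum_mem fun i _ => ?_
    rw [evalHom_monomial]
    exact (hx.pow i).mul_mem _ (hg.map_mem _ (hp i))

theorem evalHom_hom_ext {f₁ f₂ : R[X] →ₐ[K] B} (h : ∀ a, f₁ (Polynomial.C a) = f₂ (Polynomial.C a))
    (hX : f₁ X = f₂ X) : f₁ = f₂ := by
  refine AlgHom.ext fun p => ?_
  induction p using Polynomial.induction_on' with
  | add p q hp hq => rw [map_add, map_add, hp, hq]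
  | monomial i a => rw [← C_mul_X_pow_eq_monomial, map_mul, map_mul, map_pow, map_pow, h, hX]

end

theorem isFormHom_CAlgHom (F : FormStructure R) :
    IsFormHom F F.poly ((CAlgHom : R →ₐ[K] R[X]) : R →+* R[X]) := isFormHom_C F

variable (K) in
theorem isFormScalar_scale (F : FormStructure R) (q : K) :
    F.poly.IsFormScalar (algebraMap K R[X] (q * q) * X) :=
  (isFormScalar_sq F.poly q).mul (isFormScalar_X F)

/-- The endomorphism of the polynomial ring which multiplies the variable by `q²`. -/
noncomputable def scaleHom (F : FormStructure R) (q : K) : R[X] →ₐ[K] R[X] :=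
  evalHom CAlgHom (isFormScalar_scale K F q)

variable (K) in
/-- The endomorphism of the polynomial ring which annihilates the variable. -/
noncomputable def constHom (F : FormStructure R) : R[X] →ₐ[K] R[X] :=
  evalHom CAlgHom (isFormScalar_zero F.poly)

theorem scaleHom_isFormHom (F : FormStructure R) (q : K) :
    IsFormHom F.poly F.poly (scaleHom F q : R[X] →+* R[X]) :=
  evalHom_isFormHom _ _ (isFormHom_CAlgHom F)

variable (K) in
theorem constHom_isFormHom (F : FormStructure R) :
    IsFormHom F.poly F.poly (constHom K F : R[X] →+* R[X]) :=
  evalHom_isFormHom _ _ (isFormHom_CAlgHom F)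

theorem scaleHom_C (F : FormStructure R) (q : K) (a : R) : scaleHom F q (C a) = C a :=
  evalHom_C _ _ _

theorem scaleHom_X (F : FormStructure R) (q : K) :
    scaleHom F q (X : R[X]) = algebraMap K R[X] (q * q) * X := evalHom_X _ _

theorem constHom_C (F : FormStructure R) (a : R) : constHom K F (C a) = C a :=
  evalHom_C _ _ _

theorem constHom_X (F : FormStructure R) : constHom K F (X : R[X]) = 0 := evalHom_X _ _

theorem scaleHom_mul (F : FormStructure R) (q t : K) (p : R[X]) :
    scaleHom F (q * t) p = scaleHom F t (scaleHom F q p) := by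
  refine congrFun (congrArg DFunLike.coe (evalHom_hom_ext (f₁ := scaleHom F (q * t))
    (f₂ := (scaleHom F t).comp (scaleHom F q)) (fun a => ?_) ?_)) p
  · simp [scaleHom_C]
  · rw [AlgHom.comp_apply, scaleHom_X, scaleHom_X, map_mul (scaleHom F t), AlgHom.commutes,
      scaleHom_X, ← mul_assoc (algebraMap K R[X] (q * q)),
      ← map_mul (algebraMap K R[X]), mul_mul_mul_comm]

theorem constHom_scaleHom (F : FormStructure R) (q : K) (p : R[X]) :
    constHom K F (scaleHom F q p) = constHom K F p := by
  refine congrFun (congrArg DFunLike.coe (evalHom_hom_ext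
    (f₁ := (constHom K F).comp (scaleHom F q)) (f₂ := constHom K F) (fun a => ?_) ?_)) p
  · simp [scaleHom_C]
  · simp only [AlgHom.comp_apply, scaleHom_X, map_mul, constHom_X, mul_zero]

theorem constHom_eq (F : FormStructure R) (p : R[X]) : constHom K F p = C (p.coeff 0) := by
  induction p using Polynomial.induction_on' with
  | add p q hp hq => rw [map_add, hp, hq, coeff_add, C_add]
  | monomial i a =>
    rw [constHom, evalHom_monomial]
    rcases i with _ | i <;> simp

theorem mem_poly_longParam {F : FormStructure R} {n : ℕ} {i : Fin n ⊕ Fin n} {p : R[X]} :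
    p ∈ F.poly.longParam i ↔ ∀ j, p.coeff j ∈ F.longParam i := by
  have hk : F.poly.lam * star (F.poly.kap i) = C (F.lam * star (F.kap i)) := by
    rw [← (isFormHom_C F).map_kap, star_C, C_mul]
    rfl
  rw [mem_longParam, hk, mem_poly_Λ]
  simp only [coeff_C_mul, mem_longParam]

/-- Writing p = p₁X + p(0) gives p(q²X) − p(0) = q²·p₁(q²X)X, and p₁ inherits its coefficients from
p, so long parameters remain long parameters. -/
theorem exists_scaleHom_sub_constHom (F : FormStructure R) (q : K) (p : R[X]) :
    ∃ c, scaleHom F q p - constHom K F p = (q * q) • c ∧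
      ∀ {n : ℕ} (i : Fin n ⊕ Fin n), p ∈ F.poly.longParam i → c ∈ F.poly.longParam i := by
  refine ⟨scaleHom F q (p.divX) * X, ?_, fun i hp => ?_⟩
  · conv_lhs => rw [← p.divX_mul_X_add]
    rw [map_add, map_mul, map_add, map_mul, scaleHom_X, constHom_X, scaleHom_C, constHom_C,
      Algebra.smul_def, ← mul_assoc, ← mul_assoc, Algebra.commutes]
    simp
  · have h1 : p.divX ∈ F.poly.longParam i := by
      rw [mem_poly_longParam] at *
      intro j
      rw [coeff_divX]
      exact hp (j + 1)
    have h2 := (scaleHom_isFormHom F q).map_longParam h1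
    rw [mem_longParam] at *
    rw [← mul_assoc]
    exact (isFormScalar_X F).mul_mem _ h2

/-- Without constant term, p = p₁X with t·p₁ = 0, and the substitution X ↦ t²X produces a factor t²
that kills p₁. An identity valid up to torsion and at X = 0 thus becomes exact after rescaling. -/
theorem scaleHom_eq_zero (F : FormStructure R) {t : K} {p : R[X]} (h : t • p = 0)
    (h0 : constHom K F p = 0) : scaleHom F t p = 0 := by
  rw [constHom_eq, C_eq_zero] at h0
  have h1 : t • p.divX = 0 := by
    ext i
    have h2 := congrArg (fun r => r.coeff (i + 1)) h
    simpa using h2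
  have h3 : scaleHom F t (p.divX) * algebraMap K R[X] (t * t) = 0 := by
    rw [← Algebra.commutes, ← Algebra.smul_def, ← map_smul, mul_smul, h1, smul_zero, map_zero]
  rw [← p.divX_mul_X_add, h0, C_0, add_zero, map_mul, scaleHom_X, ← mul_assoc, h3, zero_mul]

end PolynomialRing

/-! ### Localization of form rings and of homomorphisms -/

section LocalizationFunctor

variable {K R : Type*} [CommRing K] [StarRing K] [TrivialStar K]
  [Ring R] [StarRing R] [Algebra K R] [StarModule K R] (S : Submonoid K)

instance localizedStarModule : StarModule K (LocalizedModule S R) where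
  star_smul k x := by
    induction x using LocalizedModule.induction_on with
    | _ a s => simp only [LocalizedModule.smul'_mk, star_mk, star_smul]

/-- The localization map as a homomorphism of algebras. -/
noncomputable def numeratorAlgHom : R →ₐ[K] LocalizedModule S R where
  toRingHom := LocalizedModule.numeratorRingHom
  commutes' _ := rfl

theorem numeratorAlgHom_apply (a : R) : numeratorAlgHom S a = LocalizedModule.mk a 1 := rfl

theorem isFormLocalization (F : FormStructure R) :
    IsFormLocalization S F (F.localize S) (numeratorAlgHom S) where
  hom :=
    { map_star := fun a => rfl
      map_lam := rfl
      map_mem := fun a ha => ⟨a, ha, 1, by simp [numeratorAlgHom_apply]⟩ }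
  exists_smul x := by
    induction x using LocalizedModule.induction_on with
    | _ a s =>
      refine ⟨s, s.2, (s : K) • a, ?_⟩
      rw [numeratorAlgHom_apply, mul_smul, LocalizedModule.smul'_mk, LocalizedModule.smul'_mk]
      exact LocalizedModule.mk_cancel s _
  exists_smul_mem := by
    rintro _ ⟨a, ha, s, rfl⟩
    refine ⟨s, s.2, a, ha, ?_⟩
    rw [numeratorAlgHom_apply, LocalizedModule.smul'_mk]
    exact LocalizedModule.mk_cancel (s * s) _
  smul_injective s hs x hx := by
    induction x using LocalizedModule.induction_on with
    | _ a t =>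
      rw [LocalizedModule.smul'_mk, ← LocalizedModule.zero_mk t, LocalizedModule.mk_eq] at hx
      obtain ⟨u, hu⟩ := hx
      rw [← LocalizedModule.zero_mk t, LocalizedModule.mk_eq]
      refine ⟨u * ⟨s, hs⟩, ?_⟩
      simp only [smul_zero, Submonoid.smul_def, Submonoid.coe_mul, smul_smul] at hu ⊢
      rw [← hu]
      congr 1
      ring
  exists_smul_eq_zero b hb := by
    rw [numeratorAlgHom_apply, ← LocalizedModule.zero_mk 1, LocalizedModule.mk_eq] at hb
    obtain ⟨u, hu⟩ := hb
    exact ⟨u, u.2, by simpa [Submonoid.smul_def] using hu⟩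

variable {B : Type*} [Ring B] [StarRing B] [Algebra K B] [StarModule K B]

/-- Localization of a homomorphism of algebras. -/
noncomputable def localizeHom (g : R →ₐ[K] B) : LocalizedModule S R →ₐ[K] LocalizedModule S B where
  toFun x := LocalizedModule.liftOn x (fun p => LocalizedModule.mk (g p.1) p.2) (by
    rintro ⟨a, s⟩ ⟨b, t⟩ ⟨u, hu⟩
    refine LocalizedModule.mk_eq.2 ⟨u, ?_⟩
    have h := congrArg g hu
    simpa only [Submonoid.smul_def, map_smul] using h)
  map_one' := by
    rw [OreLocalization.one_def, OreLocalization.one_def]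
    exact (LocalizedModule.liftOn_mk _ _ _).trans (by rw [map_one])
  map_mul' x y := by
    induction x, y using LocalizedModule.induction_on₂ with
    | _ a b s t => simp only [LocalizedModule.liftOn_mk, LocalizedModule.mk_mul_mk, map_mul]
  map_zero' := by
    rw [← LocalizedModule.zero_mk 1, LocalizedModule.liftOn_mk, map_zero,
      LocalizedModule.zero_mk]
  map_add' x y := by
    induction x, y using LocalizedModule.induction_on₂ with
    | _ a b s t =>
      simp only [LocalizedModule.liftOn_mk, LocalizedModule.mk_add_mk, map_add, Submonoid.smul_def,
        map_smul]
  commutes' k := by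
    change LocalizedModule.liftOn (LocalizedModule.mk (algebraMap K R k) 1) _ _ =
      LocalizedModule.mk (algebraMap K B k) 1
    rw [LocalizedModule.liftOn_mk, AlgHom.commutes]

theorem localizeHom_comp_numerator (g : R →ₐ[K] B) (a : R) :
    localizeHom S g (numeratorAlgHom S a) = numeratorAlgHom S (g a) := rfl

theorem localizeHom_isFormHom {F : FormStructure R} {F' : FormStructure B} {g : R →ₐ[K] B}
    (hg : IsFormHom F F' (g : R →+* B)) : IsFormHom (F.localize S) (F'.localize S)
      (localizeHom S g : LocalizedModule S R →+* LocalizedModule S B) where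
  map_star x := by
    induction x using LocalizedModule.induction_on with
    | _ a s =>
      change LocalizedModule.mk (g (star a)) s = LocalizedModule.mk (star (g a)) s
      exact congrArg (fun b => LocalizedModule.mk b s) (hg.map_star a)
  map_lam := congrArg (fun b => LocalizedModule.mk b (1 : S)) hg.map_lam
  map_mem := by
    rintro _ ⟨a, ha, s, rfl⟩
    exact ⟨g a, hg.map_mem a ha, s, rfl⟩

end LocalizationFunctor

end FormStructure

namespace FormStructure

/-! ### The dilation principle -/

section Dilation

open Polynomial

variable {K A : Type*} [CommRing K] [StarRing K] [TrivialStar K]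
  [Ring A] [StarRing A] [Algebra K A] [StarModule K A] {S : Submonoid K} {n : ℕ}

theorem exists_smul_eq_zero_of_finite {M ι : Type*} [Finite ι] [AddCommGroup M] [Module K M]
    (z : ι → M) (h : ∀ i, ∃ s ∈ S, s • z i = 0) : ∃ s ∈ S, ∀ i, s • z i = 0 := by
  cases nonempty_fintype ι
  choose t ht h using h
  refine ⟨∏ i, t i, prod_mem fun i _ => ht i, fun i => ?_⟩
  obtain ⟨c, hc⟩ := Finset.dvd_prod_of_mem t (Finset.mem_univ i)
  rw [hc, mul_comm, mul_smul, h, smul_zero]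

variable (F : FormStructure A)

/-- The nonconstant part of the rescaled numerator is divisible by (spq)², and the denominator costs
only s². The factor p² survives for every `q`. -/
theorem scale_sub_const_mem {s p q : K} (hs : s ∈ S) {x : LocalizedModule S A[X]} {b : A[X]}
    (hx : (s * s) • x = numeratorAlgHom S b) :
    ∃ c, localizeHom S (scaleHom F (s * p * q)) x - localizeHom S (constHom K F) x =
      (p * p) • numeratorAlgHom S c ∧
      ∀ {n : ℕ} (i : Fin n ⊕ Fin n), b ∈ F.poly.longParam i → c ∈ F.poly.longParam i := by
  obtain ⟨c, hc, hc'⟩ := exists_scaleHom_sub_constHom F (s * p * q) b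
  refine ⟨(q * q) • c, ?_, fun i hi => sq_smul_mem_longParam _ q (hc' i hi)⟩
  have hS := (isFormLocalization S F.poly).smul_injective
  rw [← sub_eq_zero]
  refine hS s hs _ (hS s hs _ ?_)
  rw [smul_smul, smul_sub, smul_sub, ← map_smul, ← map_smul, hx, localizeHom_comp_numerator,
    localizeHom_comp_numerator, ← map_sub, hc, map_smul, map_smul, smul_smul, smul_smul,
    ← sub_smul]
  convert zero_smul K _ using 2
  ring


theorem mul_conj_cancel {G : Type*} [Monoid G] {g g' : G} (h : g' * g = 1) (a b c : G) :
    a * (b * c) = a * g' * (g * b * g') * (g * c) := by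
  calc a * (b * c) = a * (1 * (b * (1 * c))) := by rw [one_mul, one_mul]
    _ = _ := by rw [← h]; simp only [mul_assoc]

/-- Induction on the word M = xy. Since M(q²X) = (x(q²X)x(0)⁻¹)·(x(0)Nx(0)⁻¹)·M(0), where y(q²X) =
N·y(0), it is enough to make the first factor divisible by rescaling and to choose N so divisible
that conjugation by x(0) leaves divisible parameters. Having the result for all further multiples
`q` of the scaling lets the two requirements be met at once. -/
theorem exists_dilation_factor (hn : 3 ≤ n)
    {M : Matrix (Fin n ⊕ Fin n) (Fin n ⊕ Fin n) (LocalizedModule S A[X])}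
    (hM : M ∈ (F.poly.localize S).elemMonoid n) :
    ∀ p ∈ S, ∃ q₀ ∈ S, ∀ q ∈ S,
      ∃ N ∈ sqElem F.poly (F.poly.localize S) (numeratorAlgHom (K := K) S) n p,
      (localizeHom S (scaleHom F (q₀ * q)) : _ →+* LocalizedModule S A[X]).mapMatrix M =
        N * (localizeHom S (constHom K F) : _ →+* LocalizedModule S A[X]).mapMatrix M := by
  have hf := isFormLocalization S F.poly
  have hτ (q : K) := localizeHom_isFormHom S (scaleHom_isFormHom F q)
  have hε := localizeHom_isFormHom S (constHom_isFormHom K F)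
  induction hM using Submonoid.closure_induction_left with
  | one => exact fun p hp => ⟨1, one_mem _, fun q _ => ⟨1, one_mem _, by simp⟩⟩
  | mul_left x hx y hy ih =>
    intro p hp
    have step : ∃ g g' : Matrix (Fin n ⊕ Fin n) (Fin n ⊕ Fin n) (LocalizedModule S A[X]),
        (localizeHom S (constHom K F) : _ →+* LocalizedModule S A[X]).mapMatrix x = g ∧
        g' * g = 1 ∧ (∃ p' ∈ S, ∀ N ∈ sqElem F.poly (F.poly.localize S) (numeratorAlgHom S) n p',
          g * N * g' ∈ sqElem F.poly (F.poly.localize S) (numeratorAlgHom S) n p) ∧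
        ∃ r ∈ S, ∀ q ∈ S,
          (localizeHom S (scaleHom F (r * q)) : _ →+* LocalizedModule S A[X]).mapMatrix x * g' ∈
            sqElem F.poly (F.poly.localize S) (numeratorAlgHom S) n p := by
      rcases hx with ⟨i, j, hij, hij', a, -⟩ | ⟨i, a, ha⟩
      · obtain ⟨s, hs, b, hb⟩ := hf.exists_smul a
        have hb' : (s * s) • localizeHom S (constHom K F) a =
            numeratorAlgHom S (constHom K F b) := by
          rw [← map_smul, hb, localizeHom_comp_numerator]
        refine ⟨_, _, hε.map_shortRoot i j a, shortRoot_neg_mul _ hij _,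
          ⟨_, S.pow_mem (mul_mem (mul_mem hs hs) hp) 6, fun N hN =>
            hf.short_conj hn hij hij' hb' p hN⟩, s * p, mul_mem hs hp, fun q _ => ?_⟩
        rw [(hτ _).map_shortRoot, ← shortRoot_add _ hij, ← sub_eq_add_neg]
        obtain ⟨c, hc, -⟩ := scale_sub_const_mem F (p := p) (q := q) hs hb
        exact short_mem_sqElem hij hij' ⟨c, hc⟩
      · obtain ⟨s, hs, b, hbl, hb⟩ := hf.exists_smul_mem_longParam ha
        have hb' : (s * s) • localizeHom S (constHom K F) a =
            numeratorAlgHom S (constHom K F b) := by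
          rw [← map_smul, hb, localizeHom_comp_numerator]
        refine ⟨_, _, map_longRoot _ i a, longRoot_neg_mul i _,
          ⟨_, S.pow_mem (mul_mem (mul_mem hs hs) hp) 6, fun N hN =>
            hf.long_conj hn (hε.map_longParam ha) ((constHom_isFormHom K F).map_longParam hbl)
              hb' p hN⟩, s * p, mul_mem hs hp, fun q _ => ?_⟩
        rw [map_longRoot, ← longRoot_add, ← sub_eq_add_neg]
        obtain ⟨c, hc, hcl⟩ := scale_sub_const_mem F (p := p) (q := q) hs hb
        exact long_mem_sqElem ⟨c, hcl i hbl, hc⟩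
    obtain ⟨g, g', hg, hgg', ⟨p', hp', hconj⟩, r, hr, hr'⟩ := step
    obtain ⟨q₁, hq₁, h₁⟩ := ih p' hp'
    refine ⟨r * q₁, mul_mem hr hq₁, fun q hq => ?_⟩
    -- The common scaling is read once as a multiple of `r` and once as a multiple of `q₁`.
    obtain ⟨N, hN, h₂⟩ := h₁ (r * q) (mul_mem hr hq)
    refine ⟨_, mul_mem (hr' (q₁ * q) (mul_mem hq₁ hq)) (hconj N hN), ?_⟩
    rw [map_mul, map_mul, hg, show r * q₁ * q = r * (q₁ * q) by ring,
      show r * (q₁ * q) = q₁ * (r * q) by ring, h₂]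
    exact mul_conj_cancel hgg' _ _ _

/-- The parameters come from `A` without denominators, so the same word can be written over `A`. The
lift need not be unique, because localization may have a kernel. -/
theorem exists_lift_sqElem {p : K}
    {N : Matrix (Fin n ⊕ Fin n) (Fin n ⊕ Fin n) (LocalizedModule S A)}
    (hN : N ∈ sqElem F (F.localize S) (numeratorAlgHom (K := K) S) n p) :
    ∃ M ∈ F.elemMonoid n, (numeratorAlgHom (K := K) (R := A) S : A →+* LocalizedModule S A).mapMatrix M = N := by
  have hf := isFormLocalization S F
  induction hN using Submonoid.closure_induction with
  | mem x hx =>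
    rcases hx with ⟨i, j, hij, hij', _, ⟨b, rfl⟩⟩ | ⟨i, _, ⟨b, hb, rfl⟩⟩
    · refine ⟨_, F.shortRoot_mem hij hij' ((p * p) • b), ?_⟩
      rw [hf.hom.map_shortRoot, RingHom.coe_coe, map_smul]
    · refine ⟨_, F.longRoot_mem (F.sq_smul_mem_longParam p hb), ?_⟩
      rw [map_longRoot, RingHom.coe_coe, map_smul]
  | one => exact ⟨1, one_mem _, map_one _⟩
  | mul x y _ _ hx hy =>
    obtain ⟨M, hM, rfl⟩ := hx
    obtain ⟨M', hM', rfl⟩ := hy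
    exact ⟨M * M', mul_mem hM hM', map_mul _ _ _⟩

/-- Dilation principle: a matrix over `A[X]` which is trivial at `X = 0` and elementary over a
localization becomes elementary when the variable is multiplied by a suitable denominator. -/
theorem exists_scale_mem_elemMonoid (hn : 3 ≤ n)
    {γ : Matrix (Fin n ⊕ Fin n) (Fin n ⊕ Fin n) A[X]}
    (h0 : (constHom K F : A[X] →+* A[X]).mapMatrix γ = 1)
    (hγ : (numeratorAlgHom (K := K) (R := A[X]) S : A[X] →+* LocalizedModule S A[X]).mapMatrix γ ∈
      (F.poly.localize S).elemMonoid n) :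
    ∃ q ∈ S, (scaleHom F q : A[X] →+* A[X]).mapMatrix γ ∈ F.poly.elemMonoid n := by
  have hf := isFormLocalization S F.poly
  set f := (numeratorAlgHom (K := K) (R := A[X]) S : A[X] →+* LocalizedModule S A[X]) with hfdef
  set ε := (constHom K F : A[X] →+* A[X]) with hε
  have hε' : IsFormHom F.poly F.poly ε := constHom_isFormHom K F
  obtain ⟨q, hq, hq'⟩ := exists_dilation_factor F hn hγ 1 S.one_mem
  obtain ⟨N, hN, h1⟩ := hq' 1 S.one_mem
  rw [mul_one] at h1
  obtain ⟨δ, hδ, hδN⟩ := exists_lift_sqElem F.poly hN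
  have comm (g : A[X] →ₐ[K] A[X]) (M : Matrix (Fin n ⊕ Fin n) (Fin n ⊕ Fin n) A[X]) :
      (localizeHom S g : _ →+* LocalizedModule S A[X]).mapMatrix (f.mapMatrix M) =
        f.mapMatrix ((g : A[X] →+* A[X]).mapMatrix M) := by
    ext i j; rfl
  rw [comm, comm, h0, map_one, mul_one, ← hδN] at h1
  set γ' := (scaleHom F q : A[X] →+* A[X]).mapMatrix γ with hγ'
  have h0' : ε.mapMatrix γ' = 1 := by
    rw [← h0]
    ext i j
    simp only [hγ', RingHom.mapMatrix_apply, map_apply]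
    rw [show ε ((scaleHom F q : A[X] →+* A[X]) (γ i j)) = ε (γ i j) from
      constHom_scaleHom F q _]
  have h2 : f.mapMatrix (ε.mapMatrix δ) = 1 := by
    rw [← comm, show f.mapMatrix δ = f.mapMatrix γ' from h1.symm, comm, ← hε, h0', map_one]
  -- The lift δ agrees with the rescaled γ only after localization, and δ(0) need not be 1.
  -- Multiplication by η = δ(0)⁻¹, which is elementary and trivial after localization, corrects the
  -- value at 0.
  obtain ⟨η, hη, -, hη'⟩ := exists_inv_of_mem_elemMonoid (hε'.map_elemMonoid hδ)
  have hεε (M : Matrix (Fin n ⊕ Fin n) (Fin n ⊕ Fin n) A[X]) :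
      ε.mapMatrix (ε.mapMatrix M) = ε.mapMatrix M := by
    ext i j
    simp only [RingHom.mapMatrix_apply, map_apply]
    change (constHom K F (constHom K F (M i j))).coeff _ = (constHom K F (M i j)).coeff _
    rw [constHom_eq (K := K) F (M i j), constHom_C]
  have hη1 : f.mapMatrix η = 1 := by
    have := congrArg f.mapMatrix hη'
    rwa [map_mul, h2, mul_one, map_one] at this
  have hη2 : ε.mapMatrix η * ε.mapMatrix δ = 1 := by
    have := congrArg ε.mapMatrix hη'
    rwa [map_mul, hεε, map_one] at this
  -- The difference ηδ − γ' vanishes after localization and at X = 0. One `t` in `S` kills its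
  -- finitely many entries, and rescaling by `t` turns this into an equality.
  have hz : ∀ ij : (Fin n ⊕ Fin n) × (Fin n ⊕ Fin n), ∃ s ∈ S,
      s • ((η * δ - γ') ij.1 ij.2) = 0 := by
    intro ij
    refine hf.exists_smul_eq_zero _ ?_
    have : f.mapMatrix (η * δ - γ') = 0 := by
      rw [map_sub, map_mul, hη1, one_mul, sub_eq_zero]
      exact h1.symm
    exact congrFun (congrFun this ij.1) ij.2
  obtain ⟨t, ht, htz⟩ := exists_smul_eq_zero_of_finite _ hz
  refine ⟨q * t, mul_mem hq ht, ?_⟩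
  have h3 : (scaleHom F (q * t) : A[X] →+* A[X]).mapMatrix γ =
      (scaleHom F t : A[X] →+* A[X]).mapMatrix (η * δ) := by
    rw [← sub_eq_zero]
    have : (scaleHom F t : A[X] →+* A[X]).mapMatrix (η * δ - γ') = 0 := by
      ext1 i j
      refine scaleHom_eq_zero F (htz (i, j)) ?_
      have : ε.mapMatrix (η * δ - γ') = 0 := by
        rw [map_sub, map_mul, hη2, h0', sub_self]
      exact congrFun (congrFun this i) j
    rw [map_sub, sub_eq_zero] at this
    rw [this, sub_eq_zero]
    ext1 i j
    exact scaleHom_mul F q t _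
  rw [h3]
  exact (scaleHom_isFormHom F t).map_elemMonoid (mul_mem hη hδ)

end Dilation

end FormStructure

namespace FormStructure

/-! ### Patching over the subring generated by squares -/

section Patching

variable {K R : Type*} [CommRing K] [StarRing K] [TrivialStar K]
  [Ring R] [StarRing R] [Algebra K R] [StarModule K R]

variable (K) in
/-- The subring generated by the squares. -/
def squareSubring : Subring K := Subring.closure (Set.range fun k => k * k)

theorem mul_self_mem_squareSubring (k : K) : k * k ∈ squareSubring K :=
  Subring.subset_closure ⟨k, rfl⟩

theorem isFormScalar_of_mem (F : FormStructure R) {k : K} (hk : k ∈ squareSubring K) :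
    F.IsFormScalar (algebraMap K R k) := by
  induction hk using Subring.closure_induction with
  | mem x hx => obtain ⟨y, rfl⟩ := hx; exact isFormScalar_sq F y
  | zero => rw [map_zero]; exact isFormScalar_zero F
  | one => rw [map_one]; exact isFormScalar_one F
  | add x y _ _ hx hy => rw [map_add]; exact hx.add hy
  | neg x _ hx => rw [map_neg]; exact hx.neg
  | mul x y _ _ hx hy => rw [map_mul]; exact hx.mul hy

instance isIntegral_squareSubring : Algebra.IsIntegral (squareSubring K) K where
  isIntegral k := by
    refine ⟨Polynomial.X ^ 2 - Polynomial.C ⟨k * k, mul_self_mem_squareSubring k⟩,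
      Polynomial.monic_X_pow_sub_C _ two_ne_zero, ?_⟩
    rw [Polynomial.eval₂_sub, Polynomial.eval₂_pow, Polynomial.eval₂_X, Polynomial.eval₂_C]
    change k ^ 2 - k * k = 0
    ring

/-- Each k in `K` is a root of X² − k², so `K` is integral over the subring and a maximal ideal
containing `G` is the trace of a maximal ideal Q of `K`. An s outside Q with s² in `G` would give s²
in Q, a contradiction. -/
theorem eq_top_of_forall_isMaximal (G : Ideal (squareSubring K))
    (h : ∀ (m : Ideal K) [m.IsMaximal],
      ∃ s ∈ m.primeCompl, (⟨s * s, mul_self_mem_squareSubring s⟩ : squareSubring K) ∈ G) :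
    G = ⊤ := by
  by_contra hG
  obtain ⟨M, hM, hGM⟩ := Ideal.exists_le_maximal G hG
  obtain ⟨Q, hQ, hQM⟩ := Ideal.exists_ideal_over_maximal_of_isIntegral (S := K) M (by
    rw [(RingHom.injective_iff_ker_eq_bot _).1 Subtype.val_injective]
    exact bot_le)
  obtain ⟨s, hs, hsG⟩ := h Q
  have h1 := hGM hsG
  rw [← hQM, Ideal.mem_comap] at h1
  exact hs ((hQ.isPrime.mem_or_mem h1).elim id id)

end Patching

/-! ### The local-global principle for graded form rings -/

section GradedRing

open Polynomial

variable {K R : Type*} [CommRing K] [StarRing K] [TrivialStar K]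
  [Ring R] [StarRing R] [Algebra K R] [StarModule K R]
  (𝒜 : ℕ → Submodule K R) [GradedAlgebra 𝒜]

/-- The homomorphism from the external direct sum of the components to the polynomial ring. -/
noncomputable def directSumToPolynomial : (DirectSum ℕ fun i => 𝒜 i) →ₐ[K] R[X] :=
  DirectSum.toAlgebra K (fun i => 𝒜 i)
    (fun i => ((monomial i : R →ₗ[R] R[X]).restrictScalars K) ∘ₗ (𝒜 i).subtype)
    (by simp [GradedMonoid.GOne.one])
    (by intro i j a b; simp [GradedMonoid.GMul.mul, monomial_mul_monomial])

theorem directSumToPolynomial_of (i : ℕ) (a : 𝒜 i) :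
    directSumToPolynomial 𝒜 (DirectSum.of (fun i => 𝒜 i) i a) = monomial i (a : R) :=
  DirectSum.toAddMonoid_of (β := fun i => 𝒜 i) (fun i =>
    (((monomial i : R →ₗ[R] R[X]).restrictScalars K) ∘ₗ (𝒜 i).subtype).toAddMonoidHom) i a

/-- The homomorphism `a ↦ ∑ aᵢ Xⁱ` from a graded algebra to its polynomial ring. -/
noncomputable def gradingHom : R →ₐ[K] R[X] :=
  (directSumToPolynomial 𝒜).comp
    (DirectSum.decomposeAlgEquiv 𝒜 : R →ₐ[K] DirectSum ℕ fun i => 𝒜 i)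

theorem gradingHom_of_mem {i : ℕ} {a : R} (ha : a ∈ 𝒜 i) : gradingHom 𝒜 a = monomial i a := by
  lift a to 𝒜 i using ha
  rw [← directSumToPolynomial_of, ← DirectSum.decompose_coe 𝒜 a]
  rfl

theorem algHom_ext_of_homogeneous {B : Type*} [Ring B] [Algebra K B] {f g : R →ₐ[K] B}
    (h : ∀ i, ∀ a ∈ 𝒜 i, f a = g a) : f = g := by
  refine AlgHom.ext fun a => ?_
  induction a using DirectSum.Decomposition.inductionOn 𝒜 with
  | zero => rw [map_zero, map_zero]
  | homogeneous a => exact h _ _ a.2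
  | add a b ha hb => rw [map_add, map_add, ha, hb]

theorem coeff_gradingHom (a : R) (i : ℕ) :
    (gradingHom 𝒜 a).coeff i = GradedRing.proj 𝒜 i a := by
  induction a using DirectSum.Decomposition.inductionOn 𝒜 with
  | zero => simp
  | @homogeneous j a =>
    rw [gradingHom_of_mem 𝒜 a.2, coeff_monomial, GradedRing.proj_apply]
    split_ifs with h
    · subst h; rw [DirectSum.decompose_of_mem_same 𝒜 a.2]
    · rw [DirectSum.decompose_of_mem_ne 𝒜 a.2 h]
  | add a b ha hb => rw [map_add, coeff_add, map_add, ha, hb]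

variable {𝒜} {F : FormStructure R}

theorem gradingHom_isFormHom (hF : F.IsGraded 𝒜) :
    IsFormHom F F.poly (gradingHom 𝒜 : R →+* R[X]) where
  map_star a := by
    change gradingHom 𝒜 (star a) = star (gradingHom 𝒜 a)
    induction a using DirectSum.Decomposition.inductionOn 𝒜 with
    | zero => simp
    | @homogeneous j a =>
      rw [gradingHom_of_mem 𝒜 a.2, gradingHom_of_mem 𝒜 (hF.star_mem j _ a.2)]
      ext i
      rw [coeff_star, coeff_monomial, coeff_monomial]
      split_ifs <;> simp
    | add a b ha hb => rw [star_add, map_add, ha, hb, map_add, star_add]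
  map_lam := gradingHom_of_mem 𝒜 hF.lam_mem
  map_mem a ha i := by
    rw [RingHom.coe_coe, coeff_gradingHom]
    exact hF.component_mem a ha i

variable {B : Type*} [Ring B] [StarRing B] [Algebra K B] [StarModule K B] {F' : FormStructure B}

variable (𝒜) in
/-- The homomorphism `a ↦ ∑ g(aᵢ) xⁱ` from a graded algebra. -/
noncomputable def gradedEval (g : R →ₐ[K] B) {x : B} (hx : F'.IsFormScalar x) : R →ₐ[K] B :=
  (evalHom g hx).comp (gradingHom 𝒜)

theorem gradedEval_of_mem (g : R →ₐ[K] B) {x : B} (hx : F'.IsFormScalar x) {i : ℕ} {a : R}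
    (ha : a ∈ 𝒜 i) : gradedEval 𝒜 g hx a = g a * x ^ i := by
  rw [gradedEval, AlgHom.comp_apply, gradingHom_of_mem 𝒜 ha, evalHom_monomial]

theorem gradedEval_isFormHom (hF : F.IsGraded 𝒜) {g : R →ₐ[K] B}
    (hg : IsFormHom F F' (g : R →+* B)) {x : B} (hx : F'.IsFormScalar x) :
    IsFormHom F F' (gradedEval 𝒜 g hx : R →+* B) :=
  (evalHom_isFormHom g hx hg).comp (gradingHom_isFormHom hF)

theorem comp_gradedEval {B' : Type*} [Ring B'] [StarRing B'] [Algebra K B'] [StarModule K B']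
    {F'' : FormStructure B'} (h : B →ₐ[K] B') (g : R →ₐ[K] B) {x : B} (hx : F'.IsFormScalar x)
    (g' : R →ₐ[K] B') {x' : B'} (hx' : F''.IsFormScalar x') (hg : ∀ a, h (g a) = g' a)
    (hxx : h x = x') : h.comp (gradedEval 𝒜 g hx) = gradedEval 𝒜 g' hx' := by
  refine algHom_ext_of_homogeneous 𝒜 fun i a ha => ?_
  rw [AlgHom.comp_apply, gradedEval_of_mem _ _ ha, gradedEval_of_mem _ _ ha, map_mul, map_pow, hg,
    hxx]

theorem mapMatrix_comp_apply {R₁ R₂ R₃ : Type*} [Ring R₁] [Ring R₂] [Ring R₃] [Algebra K R₁]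
    [Algebra K R₂] [Algebra K R₃] (h : R₂ →ₐ[K] R₃) (g : R₁ →ₐ[K] R₂) {ι : Type*} [Fintype ι]
    [DecidableEq ι] (M : Matrix ι ι R₁) :
    (h : R₂ →+* R₃).mapMatrix ((g : R₁ →+* R₂).mapMatrix M) =
      ((h.comp g : R₁ →ₐ[K] R₃) : R₁ →+* R₃).mapMatrix M := by
  ext i j; rfl

variable (𝒜 F) in
/-- The endomorphism of a graded algebra which multiplies the component of degree `i`
by `kⁱ`. -/
noncomputable def gradedScale (k : squareSubring K) : R →ₐ[K] R :=
  gradedEval 𝒜 (AlgHom.id K R) (isFormScalar_of_mem F k.2)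

/-- Write α(k) for α with its degree i components multiplied by kⁱ. Over R[Y][X] the matrix β = α(Y
+ X)α(Y)⁻¹ is trivial at X = 0 and locally elementary, so dilation in X makes α(Y + q²X)α(Y)⁻¹
elementary. The specialization Y = c, X = d gives the claim with `q` independent of `c` and `d`. -/
theorem exists_scale_quotient_mem {n : ℕ} (hn : 3 ≤ n) (hF : F.IsGraded 𝒜) {S : Submonoid K}
    {α α' : Matrix (Fin n ⊕ Fin n) (Fin n ⊕ Fin n) R} (h : α * α' = 1)
    (hα : (numeratorAlgHom (K := K) (R := R) S : R →+* LocalizedModule S R).mapMatrix α ∈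
      (F.localize S).elemMonoid n)
    (hα' : (numeratorAlgHom (K := K) (R := R) S : R →+* LocalizedModule S R).mapMatrix α' ∈
      (F.localize S).elemMonoid n) :
    ∃ q ∈ S, ∀ c d : squareSubring K,
      (gradedScale 𝒜 F (c + ⟨q * q, mul_self_mem_squareSubring q⟩ * d) : R →+* R).mapMatrix α *
        (gradedScale 𝒜 F c : R →+* R).mapMatrix α' ∈ F.elemMonoid n := by
  let g : R →ₐ[K] R[X][X] := CAlgHom.comp CAlgHom
  have hg : IsFormHom F F.poly.poly (g : R →+* R[X][X]) :=
    (isFormHom_C F.poly).comp (isFormHom_C F)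
  have hx₁ : F.poly.poly.IsFormScalar (C X) := (isFormScalar_X F).C
  have hx₂ : F.poly.poly.IsFormScalar (C X + X) := hx₁.add (isFormScalar_X F.poly)
  let Φ₁ := gradedEval 𝒜 g hx₁
  let Φ₂ := gradedEval 𝒜 g hx₂
  have hΦ₁ : IsFormHom F F.poly.poly (Φ₁ : R →+* R[X][X]) := gradedEval_isFormHom hF hg hx₁
  have hΦ₂ : IsFormHom F F.poly.poly (Φ₂ : R →+* R[X][X]) := gradedEval_isFormHom hF hg hx₂
  set β := (Φ₂ : R →+* R[X][X]).mapMatrix α * (Φ₁ : R →+* R[X][X]).mapMatrix α' with hβ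
  have h0 : (constHom K F.poly : R[X][X] →+* R[X][X]).mapMatrix β = 1 := by
    have e1 : (constHom K F.poly).comp Φ₁ = Φ₁ :=
      comp_gradedEval _ _ _ _ _ (fun a => constHom_C _ _) (constHom_C _ _)
    have e2 : (constHom K F.poly).comp Φ₂ = Φ₁ :=
      comp_gradedEval _ _ _ _ _ (fun a => constHom_C _ _) (by
        rw [map_add, constHom_C, constHom_X, add_zero])
    rw [hβ, map_mul, mapMatrix_comp_apply, mapMatrix_comp_apply, e1, e2, ← map_mul, h, map_one]
  have hβS : (numeratorAlgHom (K := K) (R := R[X][X]) S : R[X][X] →+* LocalizedModule S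
      R[X][X]).mapMatrix β ∈ (F.poly.poly.localize S).elemMonoid n := by
    rw [hβ, map_mul]
    exact mul_mem ((localizeHom_isFormHom S hΦ₂).map_elemMonoid hα)
      ((localizeHom_isFormHom S hΦ₁).map_elemMonoid hα')
  obtain ⟨q, hq, hqβ⟩ := exists_scale_mem_elemMonoid F.poly hn h0 hβS
  refine ⟨q, hq, fun c d => ?_⟩
  have hid : IsFormHom F F ((AlgHom.id K R : R →ₐ[K] R) : R →+* R) :=
    ⟨fun _ => rfl, rfl, fun _ h => h⟩
  let e := evalHom (evalHom (AlgHom.id K R) (isFormScalar_of_mem F c.2))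
    (isFormScalar_of_mem F d.2)
  have he : IsFormHom F.poly.poly F (e : R[X][X] →+* R) :=
    evalHom_isFormHom _ _ (evalHom_isFormHom _ _ hid)
  have h1 := he.map_elemMonoid hqβ
  rw [hβ, map_mul, map_mul, mapMatrix_comp_apply, mapMatrix_comp_apply, mapMatrix_comp_apply,
    mapMatrix_comp_apply] at h1
  have eg : ∀ a, e (scaleHom F.poly q (g a)) = a := fun a => by
    change e (scaleHom F.poly q (C (C a))) = a
    rw [scaleHom_C, evalHom_C, evalHom_C]
    rfl
  have e1 : (e.comp (scaleHom F.poly q)).comp Φ₁ = gradedScale 𝒜 F c :=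
    comp_gradedEval _ _ _ _ _ eg (by
      rw [AlgHom.comp_apply, scaleHom_C, evalHom_C, evalHom_X])
  have e2 : (e.comp (scaleHom F.poly q)).comp Φ₂ =
      gradedScale 𝒜 F (c + ⟨q * q, mul_self_mem_squareSubring q⟩ * d) :=
    comp_gradedEval _ _ _ _ _ eg (by
      rw [AlgHom.comp_apply, map_add, map_add, scaleHom_C, evalHom_C, evalHom_X, scaleHom_X,
        map_mul, AlgHom.commutes, evalHom_X, ← map_mul, ← map_add]
      rfl)
  rw [e1, e2] at h1
  exact h1

/-- The local-global principle for the elementary quadratic group of a graded form ring. -/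
theorem mem_elemMonoid_of_forall_isMaximal {n : ℕ} (hn : 3 ≤ n) (hF : F.IsGraded 𝒜)
    {α α' : Matrix (Fin n ⊕ Fin n) (Fin n ⊕ Fin n) R} (h : α * α' = 1)
    (h' : α' * α = 1) (h0 : α'.map (GradedRing.projZeroRingHom 𝒜) = 1)
    (hα : ∀ (m : Ideal K) [m.IsMaximal], (numeratorAlgHom (K := K) (R := R) m.primeCompl :
      R →+* LocalizedModule m.primeCompl R).mapMatrix α ∈
      (F.localize m.primeCompl).elemMonoid n)
    (hα' : ∀ (m : Ideal K) [m.IsMaximal], (numeratorAlgHom (K := K) (R := R) m.primeCompl :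
      R →+* LocalizedModule m.primeCompl R).mapMatrix α' ∈
      (F.localize m.primeCompl).elemMonoid n) :
    α ∈ F.elemMonoid n := by
  have hmul (k : squareSubring K) : (gradedScale 𝒜 F k : R →+* R).mapMatrix α' *
      (gradedScale 𝒜 F k : R →+* R).mapMatrix α = 1 := by
    rw [← map_mul, h', map_one]
  -- Quillen's ideal. Quantifying over all `c` and `d` makes it closed under sums, by telescoping
  -- through α(c + kd), and under multiples, by absorbing them into `d`.
  let G : Ideal (squareSubring K) :=
    { carrier := {k | ∀ c d, (gradedScale 𝒜 F (c + k * d) : R →+* R).mapMatrix α *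
        (gradedScale 𝒜 F c : R →+* R).mapMatrix α' ∈ F.elemMonoid n}
      zero_mem' := fun c d => by
        rw [zero_mul, add_zero, ← map_mul, h, map_one]
        exact one_mem _
      add_mem' := fun {k l} hk hl c d => by
        have h1 := mul_mem (hl (c + k * d) d) (hk c d)
        rw [mul_assoc, ← mul_assoc _ (RingHom.mapMatrix _ α), hmul, one_mul] at h1
        rwa [add_mul, ← add_assoc]
      smul_mem' := fun k l hl c d => by
        have := hl c (k * d)
        rwa [smul_eq_mul, mul_comm k l, mul_assoc] }
  have hG : G = ⊤ := eq_top_of_forall_isMaximal G fun m _ =>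
    exists_scale_quotient_mem hn hF h (hα m) (hα' m)
  have h1 : (1 : squareSubring K) ∈ G := by rw [hG]; trivial
  -- The choice c = 0, d = 1 turns the quotient into α(1)α(0)⁻¹, which is α itself.
  have h2 := h1 0 1
  have e1 : gradedScale 𝒜 F (0 + 1 * 1) = AlgHom.id K R := by
    refine algHom_ext_of_homogeneous 𝒜 fun i a ha => ?_
    rw [gradedScale, gradedEval_of_mem _ _ ha]
    simp
  have e2 : ∀ a, gradedScale 𝒜 F 0 a = GradedRing.projZeroRingHom 𝒜 a := by
    intro a
    induction a using DirectSum.Decomposition.inductionOn 𝒜 with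
    | zero => simp
    | @homogeneous j a =>
      rw [gradedScale, gradedEval_of_mem _ _ a.2, GradedRing.projZeroRingHom_apply]
      rcases j with _ | j
      · rw [DirectSum.decompose_of_mem_same 𝒜 a.2]; simp
      · rw [DirectSum.decompose_of_mem_ne 𝒜 a.2 (Nat.succ_ne_zero j)]; simp
    | add a b ha hb => rw [map_add, map_add, ha, hb]
  have e3 : (gradedScale 𝒜 F 0 : R →+* R).mapMatrix α' = 1 := by
    rw [← h0]
    ext i j
    exact e2 _
  rw [e1, e3, mul_one] at h2
  exact h2

end GradedRing

end FormStructure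

/-! ### Stable rank one for finite-dimensional semisimple algebras -/

section StableRange

variable (k : Type*) {D : Type*} [Field k] [Ring D] [Algebra k D] [Module.Finite k D]

include k in
-- An injective right multiplication is surjective by dimension, so `a` has a left inverse; right
-- cancellation by `a` then makes it two-sided.
theorem isUnit_of_forall_mul_eq_zero {a : D} (h : ∀ x, x * a = 0 → x = 0) : IsUnit a := by
  have hinj : Function.Injective (LinearMap.mulRight k a) := by
    rw [injective_iff_map_eq_zero]
    exact h
  obtain ⟨u, hu⟩ := LinearMap.injective_iff_surjective.1 hinj 1
  rw [LinearMap.mulRight_apply] at hu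
  have h2 : a * u = 1 := by
    rw [← sub_eq_zero]
    apply h
    rw [sub_mul, mul_assoc, hu, mul_one, one_mul, sub_self]
  exact ⟨⟨a, u, h2, hu⟩, rfl⟩

variable [IsSemisimpleRing D]

include k in
/-- Finite-dimensional semisimple algebras have stable rank one. -/
theorem exists_add_isUnit_of_span_sup_eq_top (a : D) (I : Ideal D)
    (h : Ideal.span {a} ⊔ I = ⊤) : ∃ y ∈ I, IsUnit (a + y) := by
  obtain ⟨⟨y, hy⟩, -, hmin⟩ := WellFounded.has_min
    (measure fun y : I => Module.finrank k (LinearMap.ker (LinearMap.mulRight k (a + y)))).wf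
    Set.univ ⟨0, trivial⟩
  refine ⟨y, hy, ?_⟩
  set b := a + y with hb
  have hbI : Ideal.span {b} ⊔ I = ⊤ := by
    rw [← top_le_iff, ← h]
    refine sup_le ?_ le_sup_right
    rw [Ideal.span_singleton_le_iff_mem]
    have : a = b - y := by rw [hb, add_sub_cancel_right]
    rw [this]
    exact Submodule.sub_mem _ (Submodule.mem_sup_left (Ideal.mem_span_singleton_self b))
      (Submodule.mem_sup_right hy)
  set L := Ideal.span {b} with hL
  -- Then `Q ⊓ I` complements `L ⊓ I` inside `I`. It meets `L` trivially, so corrections taken from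
  -- it cannot cancel against multiples of `b`.
  obtain ⟨Q, hQd, hQs⟩ := exists_isCompl (L ⊓ I)
  have hdisj : ∀ x ∈ L, x ∈ Q ⊓ I → x = 0 := fun x hx hx' => by
    have := hQd.le_bot (show x ∈ (L ⊓ I) ⊓ Q from ⟨⟨hx, hx'.2⟩, hx'.1⟩)
    simpa using this
  obtain ⟨f, hf, hfQ⟩ := IsSemisimpleRing.ideal_eq_span_idempotent (Q ⊓ I)
  have hfm : f ∈ Q ⊓ I := by rw [hfQ]; exact Ideal.mem_span_singleton_self f
  have hL' (x : D) : x * b ∈ L := Ideal.mul_mem_left _ _ (Ideal.mem_span_singleton_self b)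
  by_cases hf0 : f = 0
  · have hIL : I ≤ L := by
      intro x hx
      have hx' : x ∈ (L ⊓ I) ⊔ Q := by rw [hQs.eq_top]; trivial
      obtain ⟨l, hl, z, hz, hlz⟩ := Submodule.mem_sup.1 hx'
      have hzI : z ∈ Q ⊓ I := ⟨hz, by
        have : z = x - l := by rw [← hlz, add_sub_cancel_left]
        rw [this]; exact I.sub_mem hx hl.2⟩
      rw [hfQ, hf0, Ideal.mem_span_singleton'] at hzI
      obtain ⟨c, hc⟩ := hzI
      rw [← hlz, ← hc, mul_zero, add_zero]
      exact hl.1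
    rw [sup_eq_left.2 hIL] at hbI
    obtain ⟨u, hu⟩ := Ideal.mem_span_singleton'.1 ((Ideal.eq_top_iff_one L).1 hbI)
    have hsurj : Function.Surjective (LinearMap.mulRight k b) := fun x =>
      ⟨x * u, by rw [LinearMap.mulRight_apply, mul_assoc, hu, mul_one]⟩
    refine isUnit_of_forall_mul_eq_zero k fun x hx => ?_
    exact (injective_iff_map_eq_zero _).1 (LinearMap.injective_iff_surjective.2 hsurj) x hx
  · by_contra hunit
    -- Otherwise right multiplication by `b` would be injective, hence bijective, on fD. Then f
    -- would lie in `L` and in `Q ⊓ I`, forcing f = 0.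
    have hn : ∃ n, f * n = n ∧ n * b = 0 ∧ n ≠ 0 := by
      by_contra! hno
      let V : Submodule k D := LinearMap.range (LinearMap.mulLeft k f)
      have hV : ∀ x, x ∈ V ↔ f * x = x := by
        intro x
        constructor
        · rintro ⟨z, rfl⟩
          simp only [LinearMap.mulLeft_apply]
          rw [← mul_assoc, hf.eq]
        · intro hx
          exact ⟨x, hx⟩
      let ρ : V →ₗ[k] V := (LinearMap.mulRight k b).restrict (fun x hx => by
        rw [hV] at *
        rw [LinearMap.mulRight_apply, ← mul_assoc, hx])
      have hρ : Function.Injective ρ := by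
        rw [injective_iff_map_eq_zero]
        rintro ⟨x, hx⟩ hx0
        by_contra hne
        exact hne (Subtype.ext (hno x ((hV x).1 hx) (congrArg Subtype.val hx0)))
      obtain ⟨⟨x, hx⟩, hxf⟩ := LinearMap.injective_iff_surjective.1 hρ ⟨f, (hV f).2 hf.eq⟩
      have hxf' : x * b = f := congrArg Subtype.val hxf
      exact hf0 (hdisj f (hxf' ▸ hL' x) hfm)
    obtain ⟨n, hfn, hnb, hn0⟩ := hn
    -- Otherwise nDf = 0 with fn = n shows that the idempotent generator dn of Dn squares to zero,
    -- so n = 0.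
    have hz : ∃ d, n * (d * f) ≠ 0 := by
      by_contra! hno
      obtain ⟨e, he, hne⟩ := IsSemisimpleRing.ideal_eq_span_idempotent (Ideal.span {n})
      have hen : e ∈ Ideal.span {n} := by rw [hne]; exact Ideal.mem_span_singleton_self e
      obtain ⟨d, rfl⟩ := Ideal.mem_span_singleton'.1 hen
      have h0 : d * n = 0 := by
        rw [← he.eq]
        calc d * n * (d * n) = d * n * (d * (f * n)) := by rw [hfn]
          _ = d * (n * (d * f)) * n := by simp only [mul_assoc]
          _ = 0 := by rw [hno]; simp
      rw [h0, Ideal.span_singleton_eq_bot.2 rfl, Ideal.span_singleton_eq_bot] at hne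
      exact hn0 hne
    obtain ⟨d, hd⟩ := hz
    have hzm : d * f ∈ Q ⊓ I := Ideal.mul_mem_left _ _ hfm
    have hker : ∀ x, x * (b + d * f) = 0 → x * b = 0 ∧ x * (d * f) = 0 := by
      intro x hx
      rw [mul_add] at hx
      have h1 : x * b = 0 := by
        refine hdisj _ (hL' x) ?_
        rw [eq_neg_of_add_eq_zero_left hx]
        exact Submodule.neg_mem _ (Ideal.mul_mem_left _ _ hzm)
      refine ⟨h1, ?_⟩
      rwa [h1, zero_add] at hx
    refine hmin ⟨y + d * f, I.add_mem hy hzm.2⟩ trivial ?_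
    change Module.finrank k (LinearMap.ker (LinearMap.mulRight k (a + (y + d * f)))) <
      Module.finrank k (LinearMap.ker (LinearMap.mulRight k (a + y)))
    rw [← add_assoc, ← hb]
    refine Submodule.finrank_lt_finrank_of_lt (lt_of_le_of_ne ?_ ?_)
    · intro x hx
      exact (hker x hx).1
    · intro heq
      have : n ∈ LinearMap.ker (LinearMap.mulRight k b) := hnb
      rw [← heq] at this
      exact hd (hker n this).2

include k in
-- The left ideal Da + Db is De with e idempotent. Stable rank one applied to `a` together with `b`
-- and 1 − e gives a unit u with a + xb = ue, and then b = be = bu⁻¹(a + xb).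
theorem exists_elim_of_isSemisimpleRing (a b : D) : ∃ x y : D, b + y * (a + x * b) = 0 := by
  obtain ⟨e, he, hspan⟩ := IsSemisimpleRing.ideal_eq_span_idempotent (Ideal.span {a, b})
  have hmem : ∀ c ∈ Ideal.span {a, b}, c * e = c := by
    intro c hc
    rw [hspan] at hc
    obtain ⟨d, rfl⟩ := Ideal.mem_span_singleton'.1 hc
    rw [mul_assoc, he.eq]
  have ha := hmem a (Ideal.subset_span (by simp))
  have hb := hmem b (Ideal.subset_span (by simp))
  obtain ⟨y, hy, hu⟩ := exists_add_isUnit_of_span_sup_eq_top k a (Ideal.span {b, 1 - e}) (by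
    have h1 : e ∈ Ideal.span {a} ⊔ Ideal.span {b, 1 - e} := by
      have h2 : e ∈ Ideal.span {a, b} := by rw [hspan]; exact Ideal.mem_span_singleton_self e
      refine (Ideal.span_le.2 ?_) h2
      rintro _ (rfl | rfl)
      · exact Submodule.mem_sup_left (Ideal.mem_span_singleton_self _)
      · exact Submodule.mem_sup_right (Ideal.subset_span (by simp))
    have h3 : 1 - e ∈ Ideal.span {a} ⊔ Ideal.span {b, 1 - e} :=
      Submodule.mem_sup_right (Ideal.subset_span (by simp))
    rw [Ideal.eq_top_iff_one]
    simpa using Submodule.add_mem _ h1 h3)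
  obtain ⟨x, w, rfl⟩ := Ideal.mem_span_pair.1 hy
  obtain ⟨u, hu⟩ := hu
  refine ⟨x, -(b * (u⁻¹ : Dˣ)), ?_⟩
  have h1 : a + x * b = u * e := by
    rw [hu, add_mul, add_mul, mul_assoc x, mul_assoc w, ha, hb, sub_mul, one_mul, he.eq, sub_self,
      mul_zero, add_zero]
  rw [h1, neg_mul, mul_assoc, ← mul_assoc (u⁻¹ : Dˣ).val, Units.inv_mul, one_mul, hb,
    add_neg_cancel]

end StableRange

namespace FormStructure

/-! ### Moving unimodular isotropic vectors to a basis vector -/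

section Columns

variable {R : Type*} [Ring R] [StarRing R] (F : FormStructure R) {n : ℕ}

theorem shortRoot_mulVec (i j : Fin n ⊕ Fin n) (a : R) (v : Fin n ⊕ Fin n → R) :
    F.shortRoot i j a *ᵥ v =
      v + Pi.single i (a * v j) - Pi.single j.swap (F.bar i j a * v i.swap) := by
  simp only [shortRoot, sub_mulVec, add_mulVec, one_mulVec, single_mulVec]
  rfl

theorem longRoot_mulVec (i : Fin n ⊕ Fin n) (a : R) (v : Fin n ⊕ Fin n → R) :
    longRoot i a *ᵥ v = v + Pi.single i (a * v i.swap) := by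
  simp only [longRoot, add_mulVec, one_mulVec, single_mulVec]
  rfl

/-- Two vectors in the same orbit of the elementary quadratic group. -/
def Reach (v w : Fin n ⊕ Fin n → R) : Prop := ∃ M ∈ F.elemMonoid n, M *ᵥ v = w

variable {F}

theorem Reach.refl (v : Fin n ⊕ Fin n → R) : F.Reach v v := ⟨1, one_mem _, one_mulVec v⟩

theorem Reach.trans {u v w : Fin n ⊕ Fin n → R} (h : F.Reach u v) (h' : F.Reach v w) :
    F.Reach u w := by
  obtain ⟨M, hM, rfl⟩ := h
  obtain ⟨N, hN, rfl⟩ := h'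
  exact ⟨N * M, mul_mem hN hM, by rw [mulVec_mulVec]⟩

theorem Reach.short {i j : Fin n ⊕ Fin n} (h : i ≠ j) (h' : i ≠ j.swap) (a : R)
    (v : Fin n ⊕ Fin n → R) :
    F.Reach v (v + Pi.single i (a * v j) - Pi.single j.swap (F.bar i j a * v i.swap)) :=
  ⟨_, F.shortRoot_mem h h' a, F.shortRoot_mulVec i j a v⟩

/-- The quadratic form of the hyperbolic module, modulo `Λ`. -/
def hypForm (v : Fin n ⊕ Fin n → R) : R := ∑ i, star (v (.inl i)) * v (.inr i)

/-- A vector, one of whose coordinates is a unit, all of whose translates under the elementary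
group are isotropic, is a translate of a basis vector. -/
theorem reach_single_of_isUnit {p q : Fin n} (hpq : p ≠ q) {v : Fin n ⊕ Fin n → R}
    (hv : ∀ w, F.Reach v w → hypForm w ∈ F.Λ) (hu : IsUnit (v (.inl p))) :
    F.Reach v (Pi.single (.inl p) 1) := by
  obtain ⟨u, hu⟩ := hu
  -- Clearing coordinate k with the unit at `inl p` disturbs only the coordinate `inr p`, so the
  -- coordinates already cleared stay zero.
  have clear : ∀ s : Finset (Fin n ⊕ Fin n), Sum.inl p ∉ s → Sum.inr p ∉ s →
      ∃ w, F.Reach v w ∧ w (.inl p) = u ∧ (∀ k ∈ s, w k = 0) := by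
    intro s
    induction s using Finset.induction_on with
    | empty => exact fun _ _ => ⟨v, .refl v, hu.symm, by simp⟩
    | insert k s hk ih =>
      intro h1 h2
      simp only [Finset.mem_insert, not_or] at h1 h2
      obtain ⟨w, hw, hwp, hws⟩ := ih h1.2 h2.2
      have hks : k ≠ (Sum.inl p : Fin n ⊕ Fin n).swap := fun e => h2.1 e.symm
      refine ⟨_, hw.trans (.short (i := k) (j := .inl p) (fun e => h1.1 e.symm) hks
        (-(w k * (u⁻¹ : Rˣ))) w), ?_, ?_⟩
      · simp [Pi.single_apply, h1.1, hwp]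
      · intro l hl
        have hl2 : l ≠ Sum.inr p := by
          rintro rfl
          rcases Finset.mem_insert.1 hl with e | e
          exacts [h2.1 e, h2.2 e]
        by_cases hlk : l = k
        · subst hlk
          simp [Pi.single_apply, hl2, hwp, mul_assoc]
        · rcases Finset.mem_insert.1 hl with e | e
          · exact (hlk e).elim
          · simp [Pi.single_apply, hl2, hlk, hws l e]
  obtain ⟨w, hw, hwp, hws⟩ := clear (Finset.univ.filter fun k => k ≠ .inl p ∧ k ≠ .inr p)
    (by simp) (by simp)
  have hw0 : ∀ k, k ≠ .inl p → k ≠ .inr p → w k = 0 := fun k h1 h2 =>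
    hws k (by simp [h1, h2])
  have hΛ : star (u : R) * w (.inr p) ∈ F.Λ := by
    have h := hv w hw
    rwa [hypForm, Finset.sum_eq_single p, hwp] at h
    · intro i _ hi
      rw [hw0 (.inl i) (by simpa using hi) (by simp), star_zero, zero_mul]
    · simp
  -- Isotropy leaves u*w in `Λ` for the last coordinate w. Conjugating by u⁻¹ turns this into wu⁻¹
  -- in `Λ`, so a long root can clear w.
  have hx : -(w (.inr p) * (u⁻¹ : Rˣ)) ∈ F.longParam (.inr p : Fin n ⊕ Fin n) := by
    rw [mem_longParam_inr]
    have h := F.Λ.neg_mem (F.conj_mem _ hΛ ((u⁻¹ : Rˣ) : R))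
    have h1 : star ((u⁻¹ : Rˣ) : R) * star (u : R) = 1 := by
      rw [← star_mul, Units.mul_inv, star_one]
    rwa [← mul_assoc (star _), h1, one_mul] at h
  have h2 : F.Reach v (Pi.single (.inl p) (u : R)) := by
    refine hw.trans ⟨_, F.longRoot_mem hx, ?_⟩
    rw [longRoot_mulVec]
    ext k
    by_cases h1 : k = .inl p
    · subst h1; simp [hwp]
    by_cases h3 : k = .inr p
    · subst h3; simp [hwp, mul_assoc]
    · simp [Pi.single_apply, h1, h3, hw0 k h1 h3]
  refine h2.trans ?_
  -- The unit is normalized through a second coordinate: (u, 0) → (u, 1) → (1, 1) → (1, 0).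
  have h3 : F.Reach (Pi.single (.inl p) (u : R) : Fin n ⊕ Fin n → R)
      (Pi.single (.inl p) (u : R) + Pi.single (.inl q) 1) := by
    convert Reach.short (F := F) (i := .inl q) (j := .inl p) (by simpa using hpq.symm) (by simp)
      ((u⁻¹ : Rˣ) : R) (Pi.single (.inl p) (u : R)) using 1
    ext k
    simp [Pi.single_apply]
  have h4 : F.Reach (Pi.single (.inl p) (u : R) + Pi.single (.inl q) 1 : Fin n ⊕ Fin n → R)
      (Pi.single (.inl p) 1 + Pi.single (.inl q) 1) := by
    convert Reach.short (F := F) (i := .inl p) (j := .inl q) (by simpa using hpq) (by simp)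
      (1 - u : R) (Pi.single (.inl p) (u : R) + Pi.single (.inl q) 1) using 1
    ext k
    by_cases hk : k = .inl p
    · subst hk; simp [Pi.single_apply, hpq, hpq.symm]
    · simp [Pi.single_apply, hpq, hpq.symm, hk]
  have h5 : F.Reach (Pi.single (.inl p) 1 + Pi.single (.inl q) 1 : Fin n ⊕ Fin n → R)
      (Pi.single (.inl p) 1) := by
    convert Reach.short (F := F) (i := .inl q) (j := .inl p) (by simpa using hpq.symm) (by simp)
      (-1 : R) (Pi.single (.inl p) 1 + Pi.single (.inl q) 1) using 1
    ext k
    simp [Pi.single_apply, hpq, hpq.symm]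
    by_cases hk : k = .inl p
    · subst hk; simp [hpq, hpq.symm]
    · by_cases hk' : k = .inl q <;> simp [hk, hk', hpq.symm]
  exact h3.trans (h4.trans h5)

/-- Over a ring which is semilocal in the sense that it has a surjection, reflecting units, onto a
finite-dimensional semisimple algebra, unimodular isotropic vectors are translates of a basis
vector. -/
theorem reach_single {k D : Type*} [Field k] [Ring D] [Algebra k D] [Module.Finite k D]
    [IsSemisimpleRing D] (π : R →+* D) (hπ : Function.Surjective π)
    (hunit : ∀ a, IsUnit (π a) → IsUnit a) {p q : Fin n} (hpq : p ≠ q)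
    {v : Fin n ⊕ Fin n → R} (hv : ∀ w, F.Reach v w → hypForm w ∈ F.Λ)
    (huni : ∃ w, w ⬝ᵥ v = 1) : F.Reach v (Pi.single (.inl p) 1) := by
  have huni' : ∀ w, F.Reach v w → ∃ w', w' ⬝ᵥ w = 1 := by
    rintro _ ⟨M, hM, rfl⟩
    obtain ⟨N, _, -, hN⟩ := exists_inv_of_mem_elemMonoid hM
    obtain ⟨w, hw⟩ := huni
    refine ⟨w ᵥ* N, ?_⟩
    rw [← dotProduct_mulVec, mulVec_mulVec, hN, one_mulVec, hw]
  -- Two transvections among second-half coordinates realize the elimination over `D`; their adjoint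
  -- terms touch only first-half coordinates. The image of `π` is killed at `inr p` in preparation
  -- for the next step.
  have h1 : ∃ w, F.Reach v w ∧ π (w (.inr p)) = 0 := by
    obtain ⟨x, y, hxy⟩ := exists_elim_of_isSemisimpleRing k (π (v (.inr q))) (π (v (.inr p)))
    obtain ⟨x, rfl⟩ := hπ x
    obtain ⟨y, rfl⟩ := hπ y
    refine ⟨_, (Reach.short (i := .inr q) (j := .inr p) (by simpa using hpq.symm) (by simp) x
      v).trans (Reach.short (i := .inr p) (j := .inr q) (by simpa using hpq) (by simp) y _), ?_⟩
    simpa [Pi.single_apply, hpq, hpq.symm] using hxy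
  obtain ⟨w, hw, hwp⟩ := h1
  have h2 : ∃ w', F.Reach w w' ∧ IsUnit (π (w' (.inl p))) := by
    obtain ⟨y, hy, hyu⟩ := exists_add_isUnit_of_span_sup_eq_top k (π (w (.inl p)))
      (Ideal.span (π ∘ w '' {l | l ≠ .inl p ∧ l ≠ .inr p})) (by
        obtain ⟨w', hw'⟩ := huni' w hw
        rw [Ideal.eq_top_iff_one, ← map_one π, ← hw', dotProduct, map_sum]
        refine Submodule.sum_mem _ fun l _ => ?_
        rw [map_mul]
        refine Ideal.mul_mem_left _ _ ?_
        by_cases h1 : l = .inl p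
        · subst h1; exact Submodule.mem_sup_left (Ideal.mem_span_singleton_self _)
        by_cases h2 : l = .inr p
        · subst h2; rw [hwp]; exact Submodule.zero_mem _
        exact Submodule.mem_sup_right (Ideal.subset_span ⟨l, ⟨h1, h2⟩, rfl⟩))
    -- Adding multiples of coordinate l to coordinate `inl p` also changes coordinate `l.swap`, but
    -- by a multiple of the coordinate `inr p`, which `π` kills. Modulo `π` the other coordinates
    -- therefore remain available.
    have key : ∀ y ∈ Ideal.span (π ∘ w '' {l | l ≠ .inl p ∧ l ≠ .inr p}),
        ∀ z, (∀ l, π (z l) = π (w l) ∨ l = .inl p) →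
        ∃ z', F.Reach z z' ∧ (∀ l, π (z' l) = π (w l) ∨ l = .inl p) ∧
          π (z' (.inl p)) = π (z (.inl p)) + y := by
      intro y hy
      induction hy using Submodule.closure_induction with
      | zero => exact fun z hz => ⟨z, .refl z, hz, by simp⟩
      | add y y' _ _ ih ih' =>
        intro z hz
        obtain ⟨z₁, h₁, h₁', h₁''⟩ := ih z hz
        obtain ⟨z₂, h₂, h₂', h₂''⟩ := ih' z₁ h₁'
        exact ⟨z₂, h₁.trans h₂, h₂', by rw [h₂'', h₁'', add_assoc]⟩
      | smul_mem r y hy =>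
        intro z hz
        obtain ⟨l, ⟨hl, hl'⟩, rfl⟩ := hy
        obtain ⟨r, rfl⟩ := hπ r
        have hzp : π (z (.inr p)) = 0 := by
          rw [← hwp]; simpa using hz (.inr p)
        have hls : Sum.inl p ≠ l.swap := by
          intro e
          exact hl' (by rw [← swap_inj, ← e]; rfl)
        have hzl : π (z l) = π (w l) := (hz l).resolve_right hl
        refine ⟨_, Reach.short (i := .inl p) (j := l) hl.symm hls r z, fun m => ?_, ?_⟩
        · by_cases hm : m = .inl p
          · exact .inr hm
          left
          have hzm : π (z m) = π (w m) := (hz m).resolve_right hm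
          by_cases hm' : m = l.swap
          · subst hm'
            simp [Pi.single_apply, hls.symm, hzp, hzm]
          · simp [Pi.single_apply, hm, hm', ← hzm]
        · simp [Pi.single_apply, hls, hzl]
    obtain ⟨z', h₁, -, h₂⟩ := key y hy w fun l => .inl rfl
    exact ⟨z', h₁, by rwa [h₂]⟩
  obtain ⟨w', hw', hu⟩ := h2
  have hvw := hw.trans hw'
  exact hvw.trans (reach_single_of_isUnit hpq (fun z hz => hv z (hvw.trans hz)) (hunit _ hu))

end Columns

end FormStructure

namespace FormStructure

/-! ### Unipotent radical of the stabilizer of an isotropic line -/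

section Parabolic

variable {R : Type*} [Ring R] [StarRing R] {F : FormStructure R} {n : ℕ}

theorem conjTranspose_mul_psi_mul_apply (σ τ : Matrix (Fin n ⊕ Fin n) (Fin n ⊕ Fin n) R)
    (k l : Fin n ⊕ Fin n) :
    (σᴴ * F.psi n * τ) k l = ∑ x, star (σ x k) * F.kap x * τ x.swap l := by
  rw [Matrix.mul_assoc, mul_apply]
  refine Finset.sum_congr rfl fun x _ => ?_
  rw [mul_apply, Finset.sum_eq_single x.swap]
  · simp [psi_apply, mul_assoc]
  · intro y _ hy
    simp [psi_apply, hy]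
  · simp

theorem mul_shortRoot_apply (M : Matrix (Fin n ⊕ Fin n) (Fin n ⊕ Fin n) R) (i j : Fin n ⊕ Fin n)
    (a : R) (k l : Fin n ⊕ Fin n) :
    (M * F.shortRoot i j a) k l = M k l + (if l = j then M k i * a else 0) -
      (if l = i.swap then M k j.swap * F.bar i j a else 0) := by
  simp only [shortRoot, Matrix.mul_sub, Matrix.mul_add, Matrix.mul_one, Matrix.sub_apply,
    Matrix.add_apply]
  congr 2
  · split_ifs with h
    · subst h; simp
    · simp [h]
  · split_ifs with h
    · subst h; simp
    · simp [h]

/-- A quadratic matrix in the unipotent radical of the stabilizer of an isotropic line is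
elementary. -/
theorem IsQuadratic.mem_elemMonoid_of_unipotent {M : Matrix (Fin n ⊕ Fin n) (Fin n ⊕ Fin n) R}
    (hM : F.IsQuadratic n M) {p : Fin n} (h1 : M (.inl p) (.inl p) = 1)
    (h : ∀ k l, k ≠ .inl p → l ≠ .inr p → M k l = (1 : Matrix (Fin n ⊕ Fin n) (Fin n ⊕ Fin n) R) k l) :
    M ∈ F.elemMonoid n := by
  -- Row `inl p` is cleared by column operations. Column `inl p` is a basis vector, so each
  -- operation changes only the targeted entry and the column `inr p`.
  have clear : ∀ s : Finset (Fin n ⊕ Fin n), Sum.inl p ∉ s → Sum.inr p ∉ s →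
      ∃ E ∈ F.elemMonoid n, (M * E) (.inl p) (.inl p) = 1 ∧
        (∀ k l, k ≠ .inl p → l ≠ .inr p → (M * E) k l = (1 : Matrix (Fin n ⊕ Fin n) (Fin n ⊕ Fin n) R) k l) ∧
        ∀ l ∈ s, (M * E) (.inl p) l = 0 := by
    intro s
    induction s using Finset.induction_on with
    | empty => exact fun _ _ => ⟨1, one_mem _, by rwa [Matrix.mul_one],
      fun k l hk hl => by rw [Matrix.mul_one, h k l hk hl], by simp⟩
    | insert j s hj ih =>
      intro h1 h2
      simp only [Finset.mem_insert, not_or] at h1 h2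
      obtain ⟨E, hE, hEp, hE1, hEs⟩ := ih h1.2 h2.2
      have hjs : Sum.inl p ≠ j.swap := fun e => h2.1 (by rw [← swap_eq_comm.2 e]; rfl)
      refine ⟨E * F.shortRoot (.inl p) j (-(M * E) (.inl p) j),
        mul_mem hE (F.shortRoot_mem h1.1 hjs _), ?_, fun k l hk hl => ?_, fun l hl => ?_⟩
      · rw [← Matrix.mul_assoc, mul_shortRoot_apply]
        simp [h1.1, hEp]
      · rw [← Matrix.mul_assoc, mul_shortRoot_apply, hE1 k l hk hl, hE1 k (.inl p) hk (by simp)]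
        simp [hl, hk]
      · have hlp : l ≠ Sum.inr p := by
          rintro rfl
          rcases Finset.mem_insert.1 hl with e | e
          exacts [h2.1 e, h2.2 e]
        rw [← Matrix.mul_assoc, mul_shortRoot_apply, hEp]
        by_cases hlj : l = j
        · subst hlj; simp [hlp]
        · rcases Finset.mem_insert.1 hl with e | e
          · exact (hlj e).elim
          · simp [hlp, hlj, hEs l e]
  obtain ⟨E, hE, hEp, hE1, hE0⟩ := clear (Finset.univ.filter fun k => k ≠ .inl p ∧ k ≠ .inr p)
    (by simp) (by simp)
  have hq : F.IsQuadratic n (M * E) := hM.mul (isQuadratic_of_mem_elemMonoid hE)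
  have hcol : ∀ k l, l ≠ .inr p → (M * E) k l = (1 : Matrix (Fin n ⊕ Fin n) (Fin n ⊕ Fin n) R) k l := by
    intro k l hl
    by_cases hk : k = .inl p
    · subst hk
      by_cases hlp : l = .inl p
      · subst hlp; simpa using hEp
      · rw [hE0 l (by simp [hlp, hl]), one_apply_ne (Ne.symm hlp)]
    · exact hE1 k l hk hl
  -- Once the other columns are standard, preservation of `psi` determines column `inr p` away from
  -- row `inl p`. The one free entry satisfies the form parameter condition, so a long root is left.
  have hw : ∀ k, k ≠ .inl p → (M * E) k (.inr p) = (1 : Matrix (Fin n ⊕ Fin n) (Fin n ⊕ Fin n) R) k (.inr p) := by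
    intro k hk
    have hk' : k.swap ≠ Sum.inr p := fun e => hk (by rw [swap_eq_comm.1 e]; rfl)
    have e := congrFun₂ hq.1 k.swap (.inr p)
    rw [conjTranspose_mul_psi_mul_apply, Finset.sum_eq_single k.swap, hcol _ _ hk',
      one_apply_eq, star_one, one_mul, Sum.swap_swap, psi_apply, Sum.swap_swap] at e
    · have e' := congrArg (star (F.kap k.swap) * ·) e
      simp only [← mul_assoc, star_kap_mul, one_mul] at e'
      rw [e', one_apply]
      by_cases hkp : k = .inr p
      · simp [hkp, star_lam_mul, star_kap_mul]
      · simp [hkp, Ne.symm hkp]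
    · intro x _ hx
      rw [hcol _ _ hk', one_apply_ne hx, star_zero, zero_mul, zero_mul]
    · simp
  have hL : M * E = longRoot (.inl p) ((M * E) (.inl p) (.inr p)) := by
    ext k l
    by_cases hl : l = .inr p
    · subst hl
      by_cases hk : k = .inl p
      · subst hk; simp [longRoot]
      · rw [hw k hk]; simp [longRoot, Ne.symm hk]
    · rw [hcol k l hl]; simp [longRoot, Ne.symm hl]
  have hΛ : star ((M * E) (.inl p) (.inr p)) ∈ F.Λ := by
    have h3 := hq.2.2 p
    rw [mul_apply, Finset.sum_eq_single p] at h3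
    · have : (M * E) (.inr p) (.inr p) = 1 := by rw [hw _ (by simp), one_apply_eq]
      simpa [toBlocks₁₂, toBlocks₂₂, this] using h3
    · intro x _ hx
      have : (M * E) (.inr x) (.inr p) = 0 := by
        rw [hw _ (by simp), one_apply_ne (by simpa using hx)]
      simp [toBlocks₂₂, this]
    · simp
  obtain ⟨E', hE', hEE, -⟩ := exists_inv_of_mem_elemMonoid hE
  have hM' : M = M * E * E' := by rw [Matrix.mul_assoc, hEE, Matrix.mul_one]
  rw [hM', hL]
  exact mul_mem (F.longRoot_mem (by simpa using hΛ)) hE'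

variable {δ δ' : Matrix (Fin n ⊕ Fin n) (Fin n ⊕ Fin n) R} {p : Fin n} {c : Fin n ⊕ Fin n}

/-- The relation δ*ψ = ψδ⁻¹ identifies, up to central units and a swap of indices, row `c.swap` of
the inverse with the adjoint of column `c`, which is a basis vector. -/
theorem IsQuadratic.inv_swap_apply (hδ : F.IsQuadratic n δ) (h : δ * δ' = 1)
    (hc : ∀ k, δ k c = if k = .inl p then 1 else 0) {l : Fin n ⊕ Fin n} (hl : l ≠ .inr p) :
    δ' c.swap l = 0 := by
  have e : δᴴ * F.psi n * 1 = 1ᴴ * F.psi n * δ' := by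
    have e1 := congrArg (· * δ') hδ.1
    simp only [Matrix.mul_assoc, h, Matrix.mul_one] at e1
    rw [Matrix.mul_one, conjTranspose_one, Matrix.one_mul, e1]
  have e' := congrFun₂ e c l
  rw [conjTranspose_mul_psi_mul_apply, conjTranspose_mul_psi_mul_apply,
    Finset.sum_eq_single (.inl p), Finset.sum_eq_single c] at e'
  · rw [one_apply_ne (by simpa using hl.symm), mul_zero, one_apply_eq, star_one, one_mul] at e'
    have e2 := congrArg (star (F.kap c) * ·) e'
    simpa [← mul_assoc, star_kap_mul] using e2.symm
  · intro x _ hx; simp [one_apply_ne hx]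
  · simp
  · intro x _ hx; simp [hc, hx]
  · simp

theorem inv_apply_of_col (h' : δ' * δ = 1)
    (hc : ∀ k, δ k c = if k = .inl p then 1 else 0) (j : Fin n ⊕ Fin n) :
    δ' j (.inl p) = (1 : Matrix (Fin n ⊕ Fin n) (Fin n ⊕ Fin n) R) j c := by
  have e := congrFun₂ h' j c
  rw [mul_apply, Finset.sum_eq_single (.inl p)] at e
  · simpa [hc] using e
  · intro x _ hx; simp [hc, hx]
  · simp

theorem mul_single_mul_apply (A B : Matrix (Fin n ⊕ Fin n) (Fin n ⊕ Fin n) R)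
    (i j k l : Fin n ⊕ Fin n) (a : R) : (A * single i j a * B) k l = A k i * a * B j l := by
  rw [mul_apply, Finset.sum_eq_single j]
  · simp
  · intro x _ hx; simp [hx]
  · simp

/-- The conjugate is 1 plus two rank one terms. One contains column `c` of δ and lives in row `inl
p`; the other contains row `c.swap` of δ⁻¹ and lives in column `inr p`. So the conjugate has the
shape handled by `IsQuadratic.mem_elemMonoid_of_unipotent`. -/
theorem conj_shortRoot_mem_of_col (hδ : F.IsQuadratic n δ) (h : δ * δ' = 1) (h' : δ' * δ = 1)
    (hc : ∀ k, δ k c = if k = .inl p then 1 else 0) {j : Fin n ⊕ Fin n} (hj : c ≠ j)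
    (hj' : c ≠ j.swap) (a : R) : δ * F.shortRoot c j a * δ' ∈ F.elemMonoid n := by
  have hrow {l} := hδ.inv_swap_apply h hc (l := l)
  have hM (k l) : (δ * F.shortRoot c j a * δ') k l = (1 : Matrix (Fin n ⊕ Fin n) (Fin n ⊕ Fin n) R) k l +
      δ k c * a * δ' j l - δ k j.swap * F.bar c j a * δ' c.swap l := by
    rw [← h, ← mul_single_mul_apply, ← mul_single_mul_apply, ← Matrix.add_apply,
      ← Matrix.sub_apply]
    simp [shortRoot, Matrix.mul_add, Matrix.mul_sub, Matrix.add_mul, Matrix.sub_mul]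
  refine ((hδ.mul (isQuadratic_of_mem_elemMonoid (F.shortRoot_mem hj hj' a))).mul
    (hδ.of_mul_eq_one h h')).mem_elemMonoid_of_unipotent (p := p) ?_ fun k l hk hl => ?_
  · rw [hM, inv_apply_of_col h' hc, one_apply_ne hj.symm, hrow (by simp)]
    simp
  · rw [hM, hc k, hrow hl]
    simp [hk]

theorem conj_longRoot_mem_of_col (hδ : F.IsQuadratic n δ) (h : δ * δ' = 1) (h' : δ' * δ = 1)
    (hc : ∀ k, δ k c = if k = .inl p then 1 else 0) {a : R} (ha : a ∈ F.longParam c) :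
    δ * longRoot c a * δ' ∈ F.elemMonoid n := by
  have hrow {l} := hδ.inv_swap_apply h hc (l := l)
  have hM (k l) : (δ * longRoot c a * δ') k l = (1 : Matrix (Fin n ⊕ Fin n) (Fin n ⊕ Fin n) R) k l +
      δ k c * a * δ' c.swap l := by
    rw [← h, ← mul_single_mul_apply, ← Matrix.add_apply]
    simp [longRoot, Matrix.mul_add, Matrix.add_mul]
  refine ((hδ.mul (isQuadratic_of_mem_elemMonoid (F.longRoot_mem ha))).mul
    (hδ.of_mul_eq_one h h')).mem_elemMonoid_of_unipotent (p := p) ?_ fun k l hk hl => ?_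
  · rw [hM, hrow (by simp)]
    simp
  · rw [hM, hrow hl]
    simp

end Parabolic

end FormStructure

/-! ### Semisimple quotients of finite algebras over local rings -/

section LocalAlgebra

open TensorProduct

/-- An algebra which is finite over a field has a semisimple quotient modulo which units lift. -/
theorem exists_isSemisimpleRing_quotient (k D : Type*) [Field k] [Ring D] [Algebra k D]
    [Module.Finite k D] :
    ∃ I : Ideal D, ∃ _ : I.IsTwoSided, IsSemisimpleRing (D ⧸ I) ∧
      ∀ a : D, IsUnit (Ideal.Quotient.mk I a) → IsUnit a := by
  have : IsArtinianRing D := IsArtinianRing.of_finite k D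
  refine ⟨Ring.jacobson D, inferInstance, inferInstance, fun a ha => ?_⟩
  have key (a b : D) (h : Ideal.Quotient.mk (Ring.jacobson D) (a * b) = 1) : IsUnit (a * b) := by
    rw [← map_one (Ideal.Quotient.mk (Ring.jacobson D)), Ideal.Quotient.eq] at h
    obtain ⟨N, hN⟩ := IsSemiprimaryRing.isNilpotent (R := D)
    have hn : IsNilpotent (a * b - 1) := ⟨N, by
      have := Ideal.pow_mem_pow h N
      rw [hN] at this
      simpa using this⟩
    simpa using hn.isUnit_one_add
  obtain ⟨u, hu⟩ := ha
  obtain ⟨b, hb⟩ := Ideal.Quotient.mk_surjective ((u⁻¹ : (D ⧸ Ring.jacobson D)ˣ) : D ⧸ Ring.jacobson D)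
  have h1 := key a b (by rw [map_mul, ← hu, hb, Units.mul_inv])
  have h2 := key b a (by rw [map_mul, ← hu, hb, Units.inv_mul])
  obtain ⟨x, hx⟩ := h1.exists_right_inv
  obtain ⟨y, hy⟩ := h2.exists_left_inv
  exact isUnit_iff_exists_and_exists.2 ⟨⟨b * x, by rw [← mul_assoc, hx]⟩, ⟨y * b, by rw [mul_assoc, hy]⟩⟩

/-- Units lift along the reduction of a finite algebra over a local ring. -/
theorem isUnit_of_isUnit_includeRight {L Q : Type*} [CommRing L] [IsLocalRing L] [Ring Q]
    [Algebra L Q] [Module.Finite L Q] {a : Q}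
    (ha : IsUnit (Algebra.TensorProduct.includeRight a : IsLocalRing.ResidueField L ⊗[L] Q)) :
    IsUnit a := by
  have hs : Function.Surjective
      (Algebra.TensorProduct.includeRight : Q →ₐ[L] IsLocalRing.ResidueField L ⊗[L] Q) :=
    TensorProduct.mk_surjective _ _ _ IsLocalRing.residue_surjective
  obtain ⟨u, hu⟩ := ha
  -- Nakayama: aQ is all of Q because this holds over the residue field. The same argument for Qa
  -- gives an inverse on the other side.
  have h1 : LinearMap.range (LinearMap.mulLeft L a) = ⊤ := by
    rw [← IsLocalRing.map_tensorProduct_mk_eq_top, eq_top_iff]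
    intro x _
    obtain ⟨y, hy⟩ := hs (((u⁻¹ : (IsLocalRing.ResidueField L ⊗[L] Q)ˣ) :
      IsLocalRing.ResidueField L ⊗[L] Q) * x)
    refine ⟨a * y, ⟨y, rfl⟩, ?_⟩
    change (Algebra.TensorProduct.includeRight : Q →ₐ[L] _) (a * y) = x
    rw [map_mul, ← hu, hy, Units.mul_inv_cancel_left]
  have h2 : LinearMap.range (LinearMap.mulRight L a) = ⊤ := by
    rw [← IsLocalRing.map_tensorProduct_mk_eq_top, eq_top_iff]
    intro x _
    obtain ⟨y, hy⟩ := hs (x * ((u⁻¹ : (IsLocalRing.ResidueField L ⊗[L] Q)ˣ) :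
      IsLocalRing.ResidueField L ⊗[L] Q))
    refine ⟨y * a, ⟨y, rfl⟩, ?_⟩
    change (Algebra.TensorProduct.includeRight : Q →ₐ[L] _) (y * a) = x
    rw [map_mul, ← hu, hy, Units.inv_mul_cancel_right]
  obtain ⟨b, hb⟩ := LinearMap.range_eq_top.1 h1 1
  obtain ⟨c, hc⟩ := LinearMap.range_eq_top.1 h2 1
  exact isUnit_iff_exists_and_exists.2 ⟨⟨b, hb⟩, ⟨c, hc⟩⟩

/-- A finite algebra over a local ring has a semisimple quotient, finite over the residue field,
along which units lift. -/
theorem exists_semisimple_reduction (L Q : Type*) [CommRing L] [IsLocalRing L] [Ring Q]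
    [Algebra L Q] [Module.Finite L Q] :
    ∃ I : Ideal (IsLocalRing.ResidueField L ⊗[L] Q), ∃ _ : I.IsTwoSided,
      IsSemisimpleRing ((IsLocalRing.ResidueField L ⊗[L] Q) ⧸ I) ∧
      ∃ π : Q →+* (IsLocalRing.ResidueField L ⊗[L] Q) ⧸ I, Function.Surjective π ∧
        ∀ a, IsUnit (π a) → IsUnit a := by
  obtain ⟨I, hI, hss, h⟩ := exists_isSemisimpleRing_quotient (IsLocalRing.ResidueField L)
    (IsLocalRing.ResidueField L ⊗[L] Q)
  refine ⟨I, hI, hss, (Ideal.Quotient.mk I).comp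
    (Algebra.TensorProduct.includeRight : Q →ₐ[L] IsLocalRing.ResidueField L ⊗[L] Q).toRingHom,
    ?_, fun a ha => isUnit_of_isUnit_includeRight (h _ ha)⟩
  exact Ideal.Quotient.mk_surjective.comp
    (TensorProduct.mk_surjective _ _ _ IsLocalRing.residue_surjective)

end LocalAlgebra

namespace FormStructure

/-! ### Columns of quadratic matrices over local base rings -/

section LocalColumn

variable {R : Type*} [Ring R] [StarRing R] {F : FormStructure R} {n : ℕ}

theorem IsQuadratic.hypForm_col_mem {σ : Matrix (Fin n ⊕ Fin n) (Fin n ⊕ Fin n) R}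
    (h : F.IsQuadratic n σ) (c : Fin n ⊕ Fin n) : hypForm (fun k => σ k c) ∈ F.Λ := by
  rcases c with c | c
  · exact h.2.1 c
  · exact h.2.2 c

/-- Over a finite algebra over a local ring, each column of a quadratic matrix is a translate of
a basis vector under the elementary quadratic group. -/
theorem exists_mul_col_eq_single (L : Type*) [CommRing L] [IsLocalRing L] [Algebra L R]
    [Module.Finite L R] {σ σ' : Matrix (Fin n ⊕ Fin n) (Fin n ⊕ Fin n) R}
    (hσ : F.IsQuadratic n σ) (h' : σ' * σ = 1) {p q : Fin n} (hpq : p ≠ q) (c : Fin n ⊕ Fin n) :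
    ∃ η ∈ F.elemMonoid n, ∀ k, (η * σ) k c = if k = .inl p then 1 else 0 := by
  obtain ⟨I, hI, hss, π, hπ, hu⟩ := exists_semisimple_reduction L R
  obtain ⟨η, hη, h⟩ := reach_single (F := F) (k := IsLocalRing.ResidueField L) π hπ hu hpq
    (v := fun k => σ k c) (by
      rintro _ ⟨M, hM, rfl⟩
      exact ((isQuadratic_of_mem_elemMonoid hM).mul hσ).hypForm_col_mem c)
    ⟨fun k => σ' c k, by
      have := congrFun₂ h' c c
      rwa [one_apply_eq] at this⟩
  refine ⟨η, hη, fun k => ?_⟩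
  have e := congrFun h k
  rw [Pi.single_apply] at e
  exact e

end LocalColumn

end FormStructure

theorem exists_algebra_finite_localizedModule {K : Type*} [CommRing K] (S : Submonoid K)
    (L A : Type*) [CommRing L] [Algebra K L] [IsLocalization S L] [Ring A] [Algebra K A]
    [Module.Finite K A] : ∃ _ : Algebra L (LocalizedModule S A),
      Module.Finite L (LocalizedModule S A) := by
  let := LocalizedModule.algebraOfIsLocalization (S := S) L (A := A)
  exact ⟨this, Module.Finite.of_isLocalizedModule S (LocalizedModule.mkLinearMap S A)⟩

namespace FormStructure

open Polynomial

/-! ### Conjugates of root elements by matrices with a standard column -/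

section RootConj

variable {R : Type*} [Ring R] [StarRing R] {F : FormStructure R} {n : ℕ}

/-- Each root element is conjugated into the elementary group by a quadratic matrix with a
suitable column that is a basis vector. -/
theorem IsRoot.exists_conj_mem {T : Matrix (Fin n ⊕ Fin n) (Fin n ⊕ Fin n) R}
    (hT : F.IsRootElt T) : ∃ c, ∀ (p : Fin n) (δ δ' : Matrix (Fin n ⊕ Fin n) (Fin n ⊕ Fin n) R),
      F.IsQuadratic n δ → δ * δ' = 1 → δ' * δ = 1 →
      (∀ k, δ k c = if k = .inl p then 1 else 0) → δ * T * δ' ∈ F.elemMonoid n := by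
  cases hT with
  | short i j h h' a _ =>
    exact ⟨i, fun p δ δ' hδ h1 h2 hc => conj_shortRoot_mem_of_col hδ h1 h2 hc h h' a⟩
  | long i a ha =>
    exact ⟨i, fun p δ δ' hδ h1 h2 hc => conj_longRoot_mem_of_col hδ h1 h2 hc ha⟩

end RootConj

/-! ### Normality over finite algebras -/

section FiniteAlgebra

variable {K A : Type*} [CommRing K] [StarRing K] [TrivialStar K]
  [Ring A] [StarRing A] [Algebra K A] [StarModule K A] {F : FormStructure A} {n : ℕ}
  [Module.Finite K A]

/-- The conjugate of an elementary matrix which involves a variable becomes elementary after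
localization at a maximal ideal. -/
theorem IsQuadratic.map_conj_mem_localize (hn : 3 ≤ n)
    {σ σ' : Matrix (Fin n ⊕ Fin n) (Fin n ⊕ Fin n) A}
    (hσ : F.IsQuadratic n σ) (h : σ * σ' = 1) (h' : σ' * σ = 1)
    {T : Matrix (Fin n ⊕ Fin n) (Fin n ⊕ Fin n) A[X]} (hT : F.poly.IsRootElt T)
    (m : Ideal K) [m.IsMaximal] :
    (numeratorAlgHom (K := K) (R := A[X]) m.primeCompl :
        A[X] →+* LocalizedModule m.primeCompl A[X]).mapMatrix
      ((C : A →+* A[X]).mapMatrix σ * T * (C : A →+* A[X]).mapMatrix σ') ∈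
      (F.poly.localize m.primeCompl).elemMonoid n := by
  set S := m.primeCompl
  set f := (numeratorAlgHom (K := K) (R := A[X]) S : A[X] →+* LocalizedModule S A[X])
  set f₀ := (numeratorAlgHom (K := K) (R := A) S : A →+* LocalizedModule S A)
  set g := (localizeHom (K := K) S (CAlgHom : A →ₐ[K] A[X]) :
    LocalizedModule S A →+* LocalizedModule S A[X])
  have hg : IsFormHom (F.localize S) (F.poly.localize S) g :=
    localizeHom_isFormHom S (isFormHom_CAlgHom F)
  have hf₀ := (isFormLocalization S F).hom
  have hcomm (M : Matrix (Fin n ⊕ Fin n) (Fin n ⊕ Fin n) A) :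
      f.mapMatrix ((C : A →+* A[X]).mapMatrix M) = g.mapMatrix (f₀.mapMatrix M) := by
    ext i j; rfl
  have : IsLocalRing (Localization S) := Localization.AtPrime.isLocalRing m
  obtain ⟨_, _⟩ := exists_algebra_finite_localizedModule S (Localization S) A
  -- Only one column of σ, determined by the root of `T`, has to be standard. As σ is constant in X,
  -- the column is reduced over the localization of `A`, which is finite over a local ring, and the
  -- result is then moved to polynomials.
  obtain ⟨c, hc⟩ := IsRoot.exists_conj_mem ((isFormLocalization S F.poly).hom.map_isRootElt hT)
  have hp : (⟨0, by omega⟩ : Fin n) ≠ ⟨1, by omega⟩ := by simp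
  have hσσ' : f₀.mapMatrix σ * f₀.mapMatrix σ' = 1 := by rw [← map_mul, h, map_one]
  have hσ'σ : f₀.mapMatrix σ' * f₀.mapMatrix σ = 1 := by rw [← map_mul, h', map_one]
  obtain ⟨η, hη, hcol⟩ := exists_mul_col_eq_single (Localization S) (hf₀.map_isQuadratic hσ)
    hσ'σ hp c
  obtain ⟨η', hη', h1, h2⟩ := exists_inv_of_mem_elemMonoid hη
  have key := hc ⟨0, by omega⟩ (g.mapMatrix (η * f₀.mapMatrix σ)) (g.mapMatrix (f₀.mapMatrix σ' * η'))
    (hg.map_isQuadratic ((isQuadratic_of_mem_elemMonoid hη).mul (hf₀.map_isQuadratic hσ)))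
    (by rw [← map_mul, Matrix.mul_assoc, ← Matrix.mul_assoc _ _ η', hσσ', Matrix.one_mul, h1, map_one])
    (by rw [← map_mul, Matrix.mul_assoc, ← Matrix.mul_assoc η', h2, Matrix.one_mul, hσ'σ, map_one])
    (fun k => by
      rw [RingHom.mapMatrix_apply, map_apply, hcol]
      split_ifs <;> simp)
  have h1' : g.mapMatrix η' * g.mapMatrix η = 1 := by rw [← map_mul, h2, map_one]
  rw [map_mul, map_mul, hcomm, hcomm]
  -- The identity used is σTσ⁻¹ = η⁻¹·((ησ)T(ησ)⁻¹)·η.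
  convert mul_mem (mul_mem (hg.map_elemMonoid hη') key) (hg.map_elemMonoid hη) using 1
  rw [map_mul, map_mul]
  simp only [Matrix.mul_assoc, h1', Matrix.mul_one]
  simp only [← Matrix.mul_assoc, h1', Matrix.one_mul]
  rfl

/-- Conjugates of one-parameter families of elementary matrices are elementary. -/
theorem IsQuadratic.conj_mem_of_family (hn : 3 ≤ n)
    {σ σ' : Matrix (Fin n ⊕ Fin n) (Fin n ⊕ Fin n) A}
    (hσ : F.IsQuadratic n σ) (h : σ * σ' = 1) (h' : σ' * σ = 1)
    {T : Matrix (Fin n ⊕ Fin n) (Fin n ⊕ Fin n) A[X]} (hT : F.poly.IsRootElt T)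
    (T' : A → Matrix (Fin n ⊕ Fin n) (Fin n ⊕ Fin n) A)
    (hT' : ∀ {x : A} (hx : F.IsFormScalar x),
      ((evalHom (AlgHom.id K A) hx : A[X] →ₐ[K] A) : A[X] →+* A).mapMatrix T = T' x)
    (h0 : T' 0 = 1) (hadd : ∀ x y, T' (x + y) = T' x * T' y) :
    σ * T' 1 * σ' ∈ F.elemMonoid n := by
  have hcancel (M N : Matrix (Fin n ⊕ Fin n) (Fin n ⊕ Fin n) A) :
      σ * (M * N) * σ' = σ * M * σ' * (σ * N * σ') := by
    rw [show σ * M * σ' * (σ * N * σ') = σ * M * (σ' * σ) * N * σ' by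
      simp only [Matrix.mul_assoc], h', Matrix.mul_one]
    simp only [Matrix.mul_assoc]
  -- The scalars k such that the family at every multiple of k has elementary conjugates. The factor
  -- `d` gives closure under multiples, and additivity of the family gives closure under sums.
  let G : Ideal (squareSubring K) :=
    { carrier := {k | ∀ d : squareSubring K,
        σ * T' (algebraMap K A ((d : K) * k)) * σ' ∈ F.elemMonoid n}
      zero_mem' := fun d => by simp [h0, h, one_mem]
      add_mem' := fun {x y} hx hy d => by
        have := mul_mem (hx d) (hy d)
        rw [← hcancel, ← hadd, ← map_add, ← mul_add] at this
        exact this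
      smul_mem' := fun c x hx d => by
        have := hx (d * c)
        simpa [mul_assoc] using this }
  have hG : G = ⊤ := by
    refine eq_top_of_forall_isMaximal G fun m _ => ?_
    have hconst : (constHom K F : A[X] →+* A[X]).mapMatrix
        ((C : A →+* A[X]).mapMatrix σ * T * (C : A →+* A[X]).mapMatrix σ') = 1 := by
      have hc : (constHom K F : A[X] →ₐ[K] A[X]) =
          (CAlgHom : A →ₐ[K] A[X]).comp (evalHom (AlgHom.id K A) (isFormScalar_zero F)) :=
        evalHom_hom_ext (fun a => by simp [constHom_C]) (by simp [constHom_X])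
      have h2 (M : Matrix (Fin n ⊕ Fin n) (Fin n ⊕ Fin n) A[X]) :
          (constHom K F : A[X] →+* A[X]).mapMatrix M = (C : A →+* A[X]).mapMatrix
            (((evalHom (AlgHom.id K A) (isFormScalar_zero F) : A[X] →ₐ[K] A) :
              A[X] →+* A).mapMatrix M) := by
        rw [hc]; rfl
      have h3 (M : Matrix (Fin n ⊕ Fin n) (Fin n ⊕ Fin n) A) :
          ((evalHom (AlgHom.id K A) (isFormScalar_zero F) : A[X] →ₐ[K] A) :
              A[X] →+* A).mapMatrix ((C : A →+* A[X]).mapMatrix M) = M := by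
        ext i j
        exact evalHom_C _ (isFormScalar_zero F) _
      simp only [h2, map_mul, h3, hT', h0, Matrix.mul_one]
      rw [← map_mul, h, map_one]
    -- Dilation makes σT(q²X)σ⁻¹ elementary over A[X]; evaluating X at `d` shows that q² lies in the
    -- ideal.
    obtain ⟨q, hq, hq'⟩ := exists_scale_mem_elemMonoid F hn hconst
      (hσ.map_conj_mem_localize hn h h' hT m)
    refine ⟨q, hq, fun d => ?_⟩
    have hd := isFormScalar_of_mem F d.2
    have hd' : F.IsFormScalar (algebraMap K A ((d : K) * (q * q))) :=
      isFormScalar_of_mem F (mul_mem d.2 (mul_self_mem_squareSubring q))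
    have hcomp : (evalHom (AlgHom.id K A) hd).comp (scaleHom F q) =
        evalHom (AlgHom.id K A) hd' :=
      evalHom_hom_ext (fun a => by simp [scaleHom_C])
        (by
          have : algebraMap K A[X] (q * q) = C (algebraMap K A (q * q)) := rfl
          rw [AlgHom.comp_apply, scaleHom_X, map_mul, this, evalHom_C, evalHom_X, evalHom_X,
            AlgHom.id_apply, ← map_mul, mul_comm])
    have h2 (M : Matrix (Fin n ⊕ Fin n) (Fin n ⊕ Fin n) A[X]) :
        ((evalHom (AlgHom.id K A) hd : A[X] →ₐ[K] A) : A[X] →+* A).mapMatrix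
          ((scaleHom F q : A[X] →+* A[X]).mapMatrix M) =
        ((evalHom (AlgHom.id K A) hd' : A[X] →ₐ[K] A) : A[X] →+* A).mapMatrix M := by
      rw [← hcomp]; rfl
    have h3 (M : Matrix (Fin n ⊕ Fin n) (Fin n ⊕ Fin n) A) :
        ((evalHom (AlgHom.id K A) hd' : A[X] →ₐ[K] A) :
            A[X] →+* A).mapMatrix ((C : A →+* A[X]).mapMatrix M) = M := by
      ext i j
      exact evalHom_C _ hd' _
    have hid : IsFormHom F F ((AlgHom.id K A : A →ₐ[K] A) : A →+* A) :=
      ⟨fun _ => rfl, rfl, fun _ h => h⟩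
    have := (evalHom_isFormHom (AlgHom.id K A) hd hid).map_elemMonoid hq'
    rwa [h2, map_mul, map_mul, h3, h3, hT'] at this
  have h1 : (1 : squareSubring K) ∈ G := hG ▸ Submodule.mem_top
  simpa using h1 1

variable (K) in
include K in
/-- Over a finite algebra over a commutative ring, the elementary quadratic group is normalized
by the quadratic group. -/
theorem IsQuadratic.conj_root_mem (hn : 3 ≤ n)
    {σ σ' : Matrix (Fin n ⊕ Fin n) (Fin n ⊕ Fin n) A}
    (hσ : F.IsQuadratic n σ) (h : σ * σ' = 1) (h' : σ' * σ = 1)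
    {T : Matrix (Fin n ⊕ Fin n) (Fin n ⊕ Fin n) A} (hT : F.IsRootElt T) :
    σ * T * σ' ∈ F.elemMonoid n := by
  cases hT with
  | short i j hij hij' a _ =>
    have := hσ.conj_mem_of_family (K := K) hn h h'
      (IsRootElt.short (F := F.poly) hij hij' (C a * X)) (fun x => F.shortRoot i j (a * x))
      (fun {x} hx => by
        rw [(evalHom_isFormHom (AlgHom.id K A) hx
          (F := F) ⟨fun _ => rfl, rfl, fun _ h => h⟩).map_shortRoot]
        simp)
      (by simp) (fun x y => by rw [mul_add, F.shortRoot_add hij])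
    simpa using this
  | long i a ha =>
    have := hσ.conj_mem_of_family (K := K) hn h h'
      (IsRootElt.long (F := F.poly) (i := i) (a := C a * X) (by
        rw [mem_poly_longParam]
        intro j
        rw [coeff_C_mul, coeff_X]
        split_ifs
        · simpa using ha
        · rw [mul_zero]
          exact (F.longParam i).zero_mem)) (fun x => longRoot i (a * x))
      (fun {x} hx => by
        rw [map_longRoot]
        simp)
      (by simp) (fun x y => by rw [mul_add, longRoot_add])
    simpa using this

end FiniteAlgebra

end FormStructure

/-! ### Finite star subalgebras over the symmetric centre -/

section SymmetricCenter

variable (R : Type*) [Ring R] [StarRing R]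

/-- The ring of central elements fixed by the involution. -/
def symmCenter : Subring (Subring.center R) where
  carrier := {c | star (c : R) = c}
  mul_mem' {a b} ha hb := by
    simp only [Set.mem_ofPred_eq] at ha hb ⊢
    rw [Subring.coe_mul, star_mul, ha, hb]
    exact Subring.mem_center_iff.1 a.2 b
  one_mem' := star_one R
  add_mem' {a b} ha hb := by
    simp only [Set.mem_ofPred_eq] at ha hb ⊢
    rw [Subring.coe_add, star_add, ha, hb]
  zero_mem' := star_zero R
  neg_mem' {a} ha := by
    simp only [Set.mem_ofPred_eq] at ha ⊢
    rw [Subring.coe_neg, star_neg, ha]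

/-- The trivial involution. -/
instance symmCenterStarRing : StarRing (symmCenter R) := starRingOfComm

instance symmCenterTrivialStar : TrivialStar (symmCenter R) := ⟨fun _ => rfl⟩

variable {R}

theorem smul_eq_coe_mul (z : symmCenter R) (a : R) : z • a = ((z : Subring.center R) : R) * a := rfl

instance symmCenterStarModule : StarModule (symmCenter R) R where
  star_smul z a := by
    have hz : star ((z : Subring.center R) : R) = (z : Subring.center R) := z.2
    rw [star_trivial z, smul_eq_coe_mul, smul_eq_coe_mul, star_mul, hz]
    exact Subring.mem_center_iff.1 (z : Subring.center R).2 _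

/-- The involution on the center. -/
def starCenter (c : Subring.center R) : Subring.center R :=
  ⟨star (c : R), Set.star_mem_center c.2⟩

/-- The polynomial (X − c)(X − c̄) has symmetric central coefficients and annihilates `c`. -/
theorem isIntegral_symmCenter (c : Subring.center R) : IsIntegral (symmCenter R) c := by
  have hc (a : R) : a * (c : R) = c * a := Subring.mem_center_iff.1 c.2 a
  have h1 : c + starCenter c ∈ symmCenter R := by
    change star ((c : R) + star (c : R)) = c + star (c : R)
    rw [star_add, star_star, add_comm]
  have h2 : c * starCenter c ∈ symmCenter R := by
    change star ((c : R) * star (c : R)) = c * star (c : R)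
    rw [star_mul, star_star]
  let s : symmCenter R := ⟨_, h1⟩
  let t : symmCenter R := ⟨_, h2⟩
  refine ⟨Polynomial.X ^ 2 + (Polynomial.C (-s) * Polynomial.X + Polynomial.C t), ?_, ?_⟩
  · refine Polynomial.monic_X_pow_add ?_
    exact Polynomial.degree_linear_lt
  · simp only [Polynomial.eval₂_add, Polynomial.eval₂_mul, Polynomial.eval₂_pow,
      Polynomial.eval₂_X, Polynomial.eval₂_C]
    change c ^ 2 + (-(c + starCenter c) * c + c * starCenter c) = 0
    ring

theorem starCenter_mem_adjoin {s : Set (Subring.center R)}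
    (hs : ∀ c ∈ s, starCenter c ∈ s) {c : Subring.center R}
    (hc : c ∈ Algebra.adjoin (symmCenter R) s) :
    starCenter c ∈ Algebra.adjoin (symmCenter R) s := by
  induction hc using Algebra.adjoin_induction with
  | mem x hx => exact Algebra.subset_adjoin (hs x hx)
  | algebraMap r =>
    have : starCenter (algebraMap (symmCenter R) (Subring.center R) r) = r := Subtype.ext r.2
    rw [this]
    exact Subalgebra.algebraMap_mem _ r
  | add x y _ _ hx hy =>
    have : starCenter (x + y) = starCenter x + starCenter y := Subtype.ext (star_add _ _)
    rw [this]
    exact add_mem hx hy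
  | mul x y _ _ hx hy =>
    have : starCenter (x * y) = starCenter y * starCenter x := Subtype.ext (star_mul _ _)
    rw [this]
    exact mul_mem hy hx

/-- In a module finite ring with involution, each finite set is contained in a subalgebra stable
under the involution which is finite over the ring of symmetric central elements. -/
theorem exists_finite_starSubalgebra [hR : Module.Finite (Subring.center R) R] {Y : Set R}
    (hY : Y.Finite) :
    ∃ A : StarSubalgebra (symmCenter R) R, Module.Finite (symmCenter R) A ∧ Y ⊆ A := by
  classical
  obtain ⟨X₀, hX₀⟩ := hR.fg_top
  set X : Finset R := (X₀ ∪ hY.toFinset) ∪ (X₀ ∪ hY.toFinset).image star ∪ {1} with hX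
  have hX1 : (1 : R) ∈ X := by simp [hX]
  have hXY : ∀ y ∈ Y, y ∈ X := fun y hy => by simp [hX, hy]
  have hXs : ∀ x ∈ X, star x ∈ X := by
    intro x hx
    simp only [hX, Finset.mem_union, Finset.mem_image, Finset.mem_singleton] at hx ⊢
    rcases hx with (hx | ⟨y, hy, rfl⟩) | rfl
    · exact .inl (.inr ⟨x, hx, rfl⟩)
    · rw [star_star]; exact .inl (.inl hy)
    · exact .inr (star_one R)
  have hspan : Submodule.span (Subring.center R) (X : Set R) = ⊤ := by
    rw [eq_top_iff, ← hX₀]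
    refine Submodule.span_mono fun x hx => ?_
    rw [Finset.mem_coe] at hx ⊢
    simp [hX, hx]
  have hmul (x y : R) : ∃ f : R → Subring.center R, ∑ z ∈ X, f z • z = x * y := by
    have h : x * y ∈ Submodule.span (Subring.center R) (X : Set R) := hspan ▸ Submodule.mem_top
    obtain ⟨f, -, hf⟩ := Submodule.mem_span_finset.1 h
    exact ⟨f, hf⟩
  choose f hf using hmul
  -- The structure constants of multiplication in terms of the finite generating set. Together with
  -- their conjugates they generate a star-stable central algebra, which is finite because its
  -- generators are integral.
  set c₀ : Set (Subring.center R) := (fun t : R × R × R => f t.1 t.2.1 t.2.2) '' (X ×ˢ X ×ˢ X : Finset _)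
  have hc₀ : c₀.Finite := (Finset.finite_toSet _).image _
  set c : Set (Subring.center R) := c₀ ∪ starCenter '' c₀ with hc
  have hcs : ∀ a ∈ c, starCenter a ∈ c := by
    rintro a (ha | ⟨b, hb, rfl⟩)
    · exact .inr ⟨a, ha, rfl⟩
    · refine .inl ?_
      have : starCenter (starCenter b) = b := Subtype.ext (star_star _)
      rwa [this]
  set ι : Subring.center R →ₐ[symmCenter R] R := IsScalarTower.toAlgHom _ _ _
  have hι (a : Subring.center R) : ι a = a := rfl
  -- The required subalgebra is E·P, with E the algebra of structure constants and P the span of the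
  -- star-stable generating set. It is closed under products because P·P ≤ E·P and E is central.
  set E : Submodule (symmCenter R) R :=
    (Subalgebra.toSubmodule (Algebra.adjoin (symmCenter R) c)).map ι.toLinearMap with hE
  set P : Submodule (symmCenter R) R := Submodule.span (symmCenter R) (X : Set R)
  have hEfg : E.FG := (fg_adjoin_of_finite (hc₀.union (hc₀.image _))
    fun x _ => isIntegral_symmCenter x).map _
  have hmem {a : Subring.center R} (ha : a ∈ Algebra.adjoin (symmCenter R) c) : (a : R) ∈ E :=
    ⟨a, ha, rfl⟩
  have hEE : E * E ≤ E := by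
    rw [Submodule.mul_le]
    rintro _ ⟨a, ha, rfl⟩ _ ⟨b, hb, rfl⟩
    exact ⟨a * b, mul_mem (S := Subalgebra _ _) ha hb, map_mul ι a b⟩
  have hPE : P * E ≤ E * P := by
    rw [Submodule.mul_le]
    rintro p hp _ ⟨a, ha, rfl⟩
    have : p * ι a = ι a * p := Subring.mem_center_iff.1 a.2 p
    exact this ▸ Submodule.mul_mem_mul (hmem ha) hp
  have hPP : P * P ≤ E * P := by
    rw [Submodule.span_mul_span, Submodule.span_le]
    rintro _ ⟨x, hx, y, hy, rfl⟩
    change x * y ∈ E * P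
    rw [← hf x y]
    refine Submodule.sum_mem _ fun z hz => ?_
    refine Submodule.mul_mem_mul (hmem (Algebra.subset_adjoin (.inl ⟨(x, y, z), ?_, rfl⟩)))
      (Submodule.subset_span hz)
    simpa using ⟨hx, hy, hz⟩
  have hone : (1 : R) ∈ E := hmem (one_mem _)
  have hEP : E * P * (E * P) ≤ E * P := calc
    E * P * (E * P) = E * (P * E) * P := by simp only [mul_assoc]
    _ ≤ E * (E * P) * P := by gcongr
    _ = E * E * (P * P) := by simp only [mul_assoc]
    _ ≤ E * (E * P) := by gcongr
    _ = E * E * P := by rw [mul_assoc]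
    _ ≤ E * P := by gcongr
  have hPstar : ∀ p ∈ P, star p ∈ P := by
    intro p hp
    induction hp using Submodule.span_induction with
    | mem x hx => exact Submodule.subset_span (hXs x hx)
    | zero => rw [star_zero]; exact zero_mem _
    | add x y _ _ hx hy => rw [star_add]; exact add_mem hx hy
    | smul a x _ hx => rw [star_smul]; exact Submodule.smul_mem _ _ hx
  have hEstar : ∀ e ∈ E, star e ∈ E := by
    rintro _ ⟨a, ha, rfl⟩
    exact hmem (starCenter_mem_adjoin hcs ha)
  refine ⟨⟨(E * P).toSubalgebra ?_ fun x y hx hy => hEP (Submodule.mul_mem_mul hx hy), ?_⟩, ?_, ?_⟩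
  · simpa using Submodule.mul_mem_mul hone (Submodule.subset_span (R := symmCenter R) hX1)
  · intro a ha
    change a ∈ E * P at ha
    change star a ∈ E * P
    induction ha using Submodule.mul_induction_on' with
    | mem_mul_mem e he p hp =>
      rw [star_mul]
      exact hPE (Submodule.mul_mem_mul (hPstar p hp) (hEstar e he))
    | add x _ y _ hx hy => rw [star_add]; exact add_mem hx hy
  · exact Module.Finite.iff_fg.2 (hEfg.mul ⟨X, rfl⟩)
  · intro y hy
    change y ∈ E * P
    simpa using Submodule.mul_mem_mul hone (Submodule.subset_span (R := symmCenter R) (hXY y hy))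

end SymmetricCenter

namespace FormStructure

/-! ### Restriction of the form structure to a star subalgebra -/

section Restriction

variable {R : Type*} [Ring R] [StarRing R] (F : FormStructure R) {n : ℕ}

/-- The form structure induced on a star subalgebra. -/
def restrict {K : Type*} [CommRing K] [StarRing K] [Algebra K R] [StarModule K R]
    (A : StarSubalgebra K R) (hA : F.lam ∈ A) : FormStructure A where
  lam := ⟨F.lam, hA⟩
  lam_mem_center := Subring.mem_center_iff.2 fun x => Subtype.ext (F.lam_comm (x : R)).symm
  lam_mul_star := Subtype.ext F.lam_mul_star
  Λ := F.Λ.comap (A.subtype : A →+* R).toAddMonoidHom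
  min_le a := F.min_le (a : R)
  le_max a ha := Subtype.ext (F.le_max (a : R) ha)
  conj_mem a ha x := F.conj_mem (a : R) ha x

variable {F} in
theorem IsFormHom.isQuadratic_of_map {R' : Type*} [Ring R'] [StarRing R'] {F' : FormStructure R'}
    {g : R →+* R'} (hg : IsFormHom F F' g) (hinj : Function.Injective g)
    (hΛ : ∀ a, g a ∈ F'.Λ → a ∈ F.Λ) {M : Matrix (Fin n ⊕ Fin n) (Fin n ⊕ Fin n) R}
    (hM : F'.IsQuadratic n (g.mapMatrix M)) : F.IsQuadratic n M := by
  obtain ⟨h1, h2, h3⟩ := hM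
  have hs (N : Matrix (Fin n ⊕ Fin n) (Fin n ⊕ Fin n) R) :
      (g.mapMatrix N)ᴴ = g.mapMatrix Nᴴ := by
    ext i j; simp [hg.map_star]
  have hp : F'.psi n = g.mapMatrix (F.psi n) := by
    ext i j
    simp only [RingHom.mapMatrix_apply, map_apply, psi_apply]
    split_ifs <;> simp [hg.map_kap]
  refine ⟨?_, fun i => hΛ _ ?_, fun i => hΛ _ ?_⟩
  · rw [hs, hp, ← map_mul, ← map_mul] at h1
    exact Matrix.map_injective hinj h1
  · convert h2 i using 1
    simp [mul_apply, map_sum, hg.map_star, toBlocks₁₁, toBlocks₂₁]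
  · convert h3 i using 1
    simp [mul_apply, map_sum, hg.map_star, toBlocks₁₂, toBlocks₂₂]

end Restriction

/-! ### Normality over module finite rings -/

section ModuleFinite

variable {R : Type*} [Ring R] [StarRing R] {F : FormStructure R} {n : ℕ}
  [Module.Finite (Subring.center R) R]

/-- Over a module finite ring, the elementary quadratic group is normalized by the quadratic
group. -/
theorem IsQuadratic.conj_mem_elemMonoid (hn : 3 ≤ n)
    {σ σ' : Matrix (Fin n ⊕ Fin n) (Fin n ⊕ Fin n) R}
    (hσ : F.IsQuadratic n σ) (h : σ * σ' = 1) (h' : σ' * σ = 1)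
    {M : Matrix (Fin n ⊕ Fin n) (Fin n ⊕ Fin n) R} (hM : M ∈ F.elemMonoid n) :
    σ * M * σ' ∈ F.elemMonoid n := by
  induction hM using Submonoid.closure_induction with
  | one => rw [Matrix.mul_one, h]; exact one_mem _
  | mul x y _ _ hx hy =>
    convert mul_mem hx hy using 1
    rw [show σ * x * σ' * (σ * y * σ') = σ * x * (σ' * σ) * y * σ' by
      simp only [Matrix.mul_assoc], h', Matrix.mul_one]
    simp only [Matrix.mul_assoc]
  | mem T hT =>
    -- The generator, the conjugating matrix and its inverse have finitely many entries. Including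
    -- `lam` among them lets the whole problem descend to a form ring finite over the symmetric
    -- centre, which acts with trivial involution.
    obtain ⟨A, hA, hYA⟩ := exists_finite_starSubalgebra (R := R)
      (Y := (Set.range fun ij : _ × _ => σ ij.1 ij.2) ∪ (Set.range fun ij : _ × _ => σ' ij.1 ij.2) ∪
        (Set.range fun ij : _ × _ => T ij.1 ij.2) ∪ {F.lam})
      ((((Set.finite_range _).union (Set.finite_range _)).union (Set.finite_range _)).union
        (Set.finite_singleton _))
    have hlam : F.lam ∈ A := hYA (.inr rfl)
    let g : A →+* R := A.subtype
    have hginj : Function.Injective g := Subtype.val_injective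
    have hg : IsFormHom (F.restrict A hlam) F g := ⟨fun _ => rfl, rfl, fun _ h => h⟩
    have hlift (M : Matrix (Fin n ⊕ Fin n) (Fin n ⊕ Fin n) R) (hM : ∀ i j, M i j ∈ A) :
        ∃ N : Matrix (Fin n ⊕ Fin n) (Fin n ⊕ Fin n) A, g.mapMatrix N = M :=
      ⟨Matrix.of fun i j => ⟨M i j, hM i j⟩, rfl⟩
    have hTA (i j) : T i j ∈ A := hYA (.inl (.inr ⟨(i, j), rfl⟩))
    obtain ⟨s, rfl⟩ := hlift σ fun i j => hYA (.inl (.inl (.inl ⟨(i, j), rfl⟩)))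
    obtain ⟨s', rfl⟩ := hlift σ' fun i j => hYA (.inl (.inl (.inr ⟨(i, j), rfl⟩)))
    obtain ⟨t, ht, rfl⟩ : ∃ t, (F.restrict A hlam).IsRootElt t ∧ g.mapMatrix t = T := by
      cases hT with
      | short i j hij hij' a _ =>
        -- The parameter is itself an entry of `T`, because the adjoint term of a short root sits at
        -- a different position.
        have ha : a ∈ A := by
          have := hTA i j
          have e : ¬ (j.swap = i ∧ i.swap = j) := fun e => hij' e.1.symm
          have e' : ¬ j.swap = i := fun e => hij' e.symm
          simpa [shortRoot, one_apply_ne hij, single_apply, e'] using this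
        exact ⟨_, .short hij hij' ⟨a, ha⟩, hg.map_shortRoot i j _⟩
      | long i a hai =>
        have ha : a ∈ A := by
          simpa [longRoot, one_apply_ne (ne_swap_self i)] using hTA i i.swap
        refine ⟨_, .long (i := i) (a := ⟨a, ha⟩) ?_, map_longRoot g i _⟩
        rcases i with i | i
        · exact (mem_longParam_inl _).2 ((F.mem_longParam_inl).1 hai)
        · exact (mem_longParam_inr _).2 ((F.mem_longParam_inr).1 hai)
    rw [← map_mul, ← map_mul]
    refine hg.map_elemMonoid (IsQuadratic.conj_root_mem (symmCenter R) hn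
      (hg.isQuadratic_of_map hginj (fun _ h => h) hσ) ?_ ?_ ht)
    · rw [← map_mul, ← map_one g.mapMatrix] at h
      exact Matrix.map_injective hginj h
    · rw [← map_mul, ← map_one g.mapMatrix] at h'
      exact Matrix.map_injective hginj h'

end ModuleFinite

end FormStructure

theorem mainTheorem4 {K R : Type*} [CommRing K] [StarRing K] [TrivialStar K]
    [Ring R] [StarRing R] [Algebra K R] [StarModule K R]
    (𝒜 : ℕ → Submodule K R) [GradedAlgebra 𝒜]
    (hR₀ : Module.Finite K (𝒜 0))
    (hR : Module.Finite (Subring.center R) R)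
    (F : FormStructure R) (hF : F.IsGraded 𝒜)
    (n : ℕ) (hn : 3 ≤ n) :
    ((F.EQ n).subgroupOf (F.GQ n)).Normal ↔
      ∀ α ∈ F.GQ n,
        α.val.map (GradedRing.projZeroRingHom 𝒜) = 1 →
        (∀ (m : Ideal K) [m.IsMaximal],
          localizeMatrix m.primeCompl n α ∈ (F.localize m.primeCompl).EQ n) →
        α ∈ F.EQ n := by
  -- Both sides are established outright: the first by normality over module finite rings, the
  -- second by the graded local-global principle.
  refine iff_of_true ⟨fun M hM σ => ?_⟩ fun α hα h0 hloc => ?_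
  · rw [Subgroup.mem_subgroupOf, FormStructure.mem_EQ_iff] at hM ⊢
    exact FormStructure.IsQuadratic.conj_mem_elemMonoid hn σ.2 σ.val.mul_inv σ.val.inv_mul hM
  · rw [FormStructure.mem_EQ_iff]
    -- The local-global principle uses the inverse as the normalizing factor α(0)⁻¹, so its degree
    -- zero part must be trivial too. This holds because the degree zero projection is a ring
    -- homomorphism.
    have hinv : (α⁻¹).val.map (GradedRing.projZeroRingHom 𝒜) = 1 := by
      have h : (GradedRing.projZeroRingHom 𝒜).mapMatrix (α.val * (α⁻¹).val) = 1 := by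
        rw [α.mul_inv, map_one]
      rw [map_mul, RingHom.mapMatrix_apply, h0, one_mul] at h
      exact h
    refine FormStructure.mem_elemMonoid_of_forall_isMaximal hn hF α.mul_inv α.inv_mul hinv
      (fun m _ => (FormStructure.mem_EQ_iff _ _).1 (hloc m)) fun m _ => ?_
    have h := inv_mem (hloc m)
    rw [← map_inv] at h
    exact (FormStructure.mem_EQ_iff _ _).1 h
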